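/- Fix an integer $n\ge 2$ and write $\mathcal A_n=\{1,\dots,n\}$. \emph{Tableaux.} A generalized partition is a weakly decreasing sequence $\lambda=(\lambda_r)_{r\in\mathbb Z}$ of non-negative integers which is $0$ for $r$ large and constant for $r\to-\infty$; rows are indexed by $\mathbb Z$, numbered downward, and row $r$ has the cells $(c,r)$ with $1\le c\le\lambda_r$. (A Young diagram whose top row is $r_0$ is extended upward by $\lambda_r=\lambda_{r_0}$ for $r<r_0$.) Let $\rho\subseteq\lambda$ be generalized partitions with $\rho_r=\lambda_r$ for all sufficiently small $r$. A semi-standard tableau of shape $\lambda/\rho$ is a filling of the cells of $\lambda/\rho$ with letters of $\mathcal A_n$, weakly increasing along rows and strictly increasing down columns. Let $\mathbb B$ be the set of all pairs $(P,Q)$ of semi-standard tableaux of the same shape $\lambda/\rho$, for arbitrary such $\lambda,\rho$ (the shape $\lambda/\rho$ is part of the data of a tableau). \emph{Insertions.} The internal insertion $\mathcal R_{[r]}$ vacates the leftmost labelled cell of row $r$ (which then belongs to the empty shape $\rho$) and inserts its label into row $r+1$ by Schensted's bumping: inserting $x$ into a row replaces the leftmost entry $y>x$ by $x$ and then inserts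 $y$ into the next row; if there is no such $y$, then $x$ is added at the right end of the row and the procedure stops. If row $r$ has no labelled cell, $\mathcal R_{[r]}$ adds an empty cell to it. For $(P,Q)\in\mathbb B$ let $P^{(0)}=P$, let $Q^{(0)}$ be the tableau of shape $\lambda/\lambda$, and for $j=1,\dots,n$ let $r_1\ge\dots\ge r_k$ be the rows of the $j$-cells of $Q$, put $P^{(j)}=\mathcal R_{[r_k]}\cdots\mathcal R_{[r_1]}(P^{(j-1)})$, and let $Q^{(j)}$ be $Q^{(j-1)}$ with $j$-cells added at the ends of its rows so that its external shape equals that of $P^{(j)}$. The skew RSK map is $\mathbf{RSK}(P,Q)=(P^{(n)},Q^{(n)})$. Put $\iota_2(P,Q)=(P',Q')$, where $P'=\mathcal R_{[r_k]}\cdots\mathcal R_{[r_1]}(P)$ for the rows $r_1\ge\dots\ge r_k$ of the $1$-cells of $Q$, and $Q'$ arises from $Q$ by vacating the $1$-cells, subtracting $1$ from all other labels, and adding $n$-cells at the ends of rows so that its external shape equals that of $P'$. Put $\iota_1=\mathrm{swap}\circ\iota_2\circ\mathrm{swap}$ with $\mathrm{swap}(x,y)=(y,x)$. \emph{Crystals.}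 Let $h_0=\mathbf e_n-\mathbf e_1$ and $h_i=\mathbf e_i-\mathbf e_{i+1}$ for $1\le i\le n-1$. An $\widehat{\mathfrak{sl}}_n$ crystal is a set $B$ with a content function $\gamma:B\to\mathbb N_0^n$ and partial maps $\widetilde E_i,\widetilde F_i$ on $B$, $0\le i\le n-1$ (value $\varnothing$ where undefined), such that $\widetilde F_i(b)=b'$ if and only if $\widetilde E_i(b')=b$; the numbers $\varphi_i(b)=\max\{m:\widetilde F_i^m(b)\ne\varnothing\}$ and $\varepsilon_i(b)=\max\{m:\widetilde E_i^m(b)\neq\varnothing\}$ exist and satisfy $\langle h_i,\gamma(b)\rangle=\varphi_i(b)-\varepsilon_i(b)$; and $\gamma(\widetilde F_i(b))=\gamma(b)-h_i$ whenever $\widetilde F_i(b)\ne\varnothing$. An $\widehat{\mathfrak{sl}}_n$ bicrystal is a set with two $\widehat{\mathfrak{sl}}_n$ crystal structures $\widetilde E^{(\epsilon)}_i,\widetilde F^{(\epsilon)}_i,\gamma^{(\epsilon)}$, $\epsilon=1,2$, such that each operator of the first family commutes with each operator of the second (as partial maps, $\varnothing\mapsto\varnothing$). An isomorphism of bicrystals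 is a bijection $\phi$ such that $\phi$ and $\phi^{-1}$ commute with all Kashiwara operators of both families (with $\phi(\varnothing)=\varnothing$) and preserve both contents. \emph{Operators on pairs.} For $1\le i\le n-1$ and a word in $\mathcal A_n$, replace each $i$ by ``$)$'' and each $i+1$ by ``$($'' and match parentheses; $\widetilde E_i$ changes the letter of the leftmost unmatched ``$($'' from $i+1$ to $i$, and $\widetilde F_i$ changes the letter of the rightmost unmatched ``$)$'' from $i$ to $i+1$; the result is $\varnothing$ if there is no such parenthesis. On a semi-standard tableau these operators act, with the shape fixed, through the column reading word (columns from left to right, each read from bottom to top). On $\mathbb B$ put, for $1\le i\le n-1$, $\widetilde E_i^{(1)}=\widetilde E_i\times\mathbf 1$, $\widetilde E_i^{(2)}=\mathbf 1\times\widetilde E_i$, $\widetilde F_i^{(1)}=\widetilde F_i\times\mathbf 1$, $\widetilde F_i^{(2)}=\mathbf 1\times\widetilde F_i$, and \[ \widetilde E_0^{(\epsilon)}=\iota_\epsilon\circ\widetilde E_1^{(\epsilon)}\circ\iota_\epsilon^{-1},\qquad \widetilde F_0^{(\epsilon)}=\iota_\epsilon\circ\widetilde F_1^{(\epsilon)}\circ\iota_\epsilon^{-1},\qquad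 \epsilon=1,2; \] let $\gamma^{(1)}(P,Q)$ and $\gamma^{(2)}(P,Q)$ be the contents of $P$ and of $Q$ (numbers of cells with each label). \textbf{Theorem.} The maps $\iota_1,\iota_2$ are bijections of $\mathbb B$ onto itself, the operators above make $\mathbb B$ an $\widehat{\mathfrak{sl}}_n$ bicrystal, and the skew RSK map $\mathbf{RSK}:\mathbb B\to\mathbb B$ is an isomorphism of $\widehat{\mathfrak{sl}}_n$ bicrystals. -/

import Mathlib

/-! ### Fillings of (generalized) skew diagrams

Rows are indexed by `ℤ` and grow downward; columns are numbered `1, 2, 3, …`.  The letter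
`k ∈ {1, …, n}` of the alphabet is the element `k - 1` of `Fin n`; subtraction in `Fin n` is
cyclic, so `0 - 1` is the letter `n`. -/

/-- A row-by-row filling of a skew diagram `λ/ρ`.  Row `r` consists of `ρ_r = inner r` empty cells,
followed by the labelled cells, whose labels, read from left to right, are the list `row r`. -/
structure SkewFilling (n : ℕ) where
  inner : ℤ → ℕ
  row : ℤ → List (Fin n)

namespace SkewFilling

variable {n : ℕ}

instance : Inhabited (SkewFilling n) := ⟨⟨fun _ => 0, fun _ => []⟩⟩

/-- The length `λ_r` of row `r` of the external shape. -/
def outer (T : SkewFilling n) (r : ℤ) : ℕ := T.inner r + (T.row r).length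

/-- The label of the cell in column `c` and row `r`; it is `none` when the cell is not in `λ/ρ`. -/
def label (T : SkewFilling n) (c : ℕ) (r : ℤ) : Option (Fin n) :=
  if T.inner r < c then (T.row r)[c - T.inner r - 1]? else none

/-- The labelled cells, that is, the cells of the skew diagram `λ/ρ`. -/
def cells (T : SkewFilling n) : Set (ℕ × ℤ) := {p | T.inner p.2 < p.1 ∧ p.1 ≤ T.outer p.2}

/-- `T` is a (generalized) semi-standard tableau.  The sequences `ρ` and `λ` are weakly decreasing
and vanish far below.  A generalized Young diagram has a topmost row, above which no labelled cell
is present; rows above it are regarded as consisting of empty cells only, as many as there are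
cells in the topmost row, so that `ρ` and `λ` agree and are constant far above.  Labels increase
weakly along rows and strictly down columns. -/
structure IsSemistandard (T : SkewFilling n) : Prop where
  inner_anti : Antitone T.inner
  outer_anti : Antitone T.outer
  below : ∃ b : ℤ, ∀ r, b ≤ r → T.outer r = 0
  above : ∃ (a : ℤ) (M : ℕ), ∀ r, r ≤ a → T.inner r = M ∧ T.outer r = M
  row_weak : ∀ r, (T.row r).Pairwise (· ≤ ·)
  col_strict : ∀ (c : ℕ) (r : ℤ) (x y : Fin n),
    T.label c r = some x → T.label c (r + 1) = some y → x < y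

/-- The number of cells of `T` with label `j`. -/
noncomputable def content (T : SkewFilling n) (j : Fin n) : ℕ :=
  {p : ℕ × ℤ | T.label p.1 p.2 = some j}.ncard

/-! ### Internal insertion -/

/-- Replace row `r` of labels by `l`. -/
def setRow (T : SkewFilling n) (r : ℤ) (l : List (Fin n)) : SkewFilling n :=
  { T with row := Function.update T.row r l }

/-- Turn the leftmost position after the empty cells of row `r` into an empty cell. -/
def addEmpty (T : SkewFilling n) (r : ℤ) : SkewFilling n :=
  { T with inner := Function.update T.inner r (T.inner r + 1) }

/-- Schensted insertion of `x` starting at row `r`: if some entry of row `r` is larger than `x`,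
the leftmost such entry `y` is replaced by `x`, and `y` is inserted at row `r + 1`; otherwise `x` is
added at the right end of row `r`. -/
def bump (T : SkewFilling n) (r : ℤ) (x : Fin n) : SkewFilling n :=
  match h : (T.row r).find? (fun y => decide (x < y)) with
  | none => T.setRow r (T.row r ++ [x])
  | some y => bump (T.setRow r ((T.row r).replace y x)) (r + 1) y
termination_by n - x.val
decreasing_by
  have hxy : x < y := by simpa using List.find?_some h
  have _h1 : x.val < y.val := hxy
  have _h2 := y.isLt
  omega

/-- The internal insertion at row `r`: the leftmost labelled cell of row `r` is vacated and its
label is inserted at row `r + 1`.  If row `r` has no label, an empty cell is added to it. -/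
def internalInsert (T : SkewFilling n) (r : ℤ) : SkewFilling n :=
  match T.row r with
  | [] => T.addEmpty r
  | x :: l => ((T.addEmpty r).setRow r l).bump (r + 1) x

open Classical in
/-- The rows that contain a label (a finite set for every semi-standard tableau). -/
noncomputable def labelledRows (T : SkewFilling n) : Finset ℤ :=
  if h : {r | T.row r ≠ []}.Finite then h.toFinset else ∅

/-- The row coordinates `r₁ ≥ r₂ ≥ ⋯ ≥ r_k` of all the cells with label `j`. -/
noncomputable def rowCoords (T : SkewFilling n) (j : Fin n) : List ℤ :=
  (T.labelledRows.sort (fun a b => b ≤ a)).flatMap (fun r => List.replicate ((T.row r).count j) r)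

/-- Internal insertions at the rows in the list, the head of the list first. -/
def internalInserts (T : SkewFilling n) (rs : List ℤ) : SkewFilling n :=
  rs.foldl internalInsert T

/-- Add cells with label `x` at the right ends of the rows, so that the external shape becomes
`κ`. -/
def extend (T : SkewFilling n) (κ : ℤ → ℕ) (x : Fin n) : SkewFilling n :=
  { T with row := fun r => T.row r ++ List.replicate (κ r - T.outer r) x }

/-- Vacate all the cells with label `1` and subtract `1` from the remaining labels. -/
def vacateOnes [NeZero n] (T : SkewFilling n) : SkewFilling n where
  inner r := T.inner r + (T.row r).count 0
  row r := ((T.row r).filter (fun x => decide (x ≠ 0))).map (fun x => x - 1)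

/-- The tableau with external shape `κ`, empty shape `κ` and no labelled cell. -/
def emptyOf (n : ℕ) (κ : ℤ → ℕ) : SkewFilling n := ⟨κ, fun _ => []⟩

end SkewFilling

/-! ### The skew RSK map and the internal insertions with cycling -/

/-- One step of the skew RSK map, for the letter `j` of `Q`; here `S = (P^{(j-1)}, Q^{(j-1)})`. -/
noncomputable def skewRSKStep {n m : ℕ} (Q : SkewFilling m) (S : SkewFilling n × SkewFilling m)
    (j : Fin m) : SkewFilling n × SkewFilling m :=
  let P' := S.1.internalInserts (Q.rowCoords j)
  (P', S.2.extend P'.outer j)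

/-- The skew RSK map. -/
noncomputable def skewRSK {n m : ℕ} (x : SkewFilling n × SkewFilling m) :
    SkewFilling n × SkewFilling m :=
  (List.finRange m).foldl (skewRSKStep x.2) (x.1, SkewFilling.emptyOf m x.1.outer)

/-- Internal insertion with cycling of the second tableau. -/
noncomputable def iota₂ {n : ℕ} [NeZero n] (x : SkewFilling n × SkewFilling n) :
    SkewFilling n × SkewFilling n :=
  let P' := x.1.internalInserts (x.2.rowCoords 0)
  (P', x.2.vacateOnes.extend P'.outer (0 - 1))

/-- Internal insertion with cycling of the first tableau. -/
noncomputable def iota₁ {n : ℕ} [NeZero n] (x : SkewFilling n × SkewFilling n) :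
    SkewFilling n × SkewFilling n :=
  (iota₂ x.swap).swap

/-- The set of pairs of (generalized) semi-standard tableaux of the same skew shape with labels in
`{1, …, n}`. -/
def sstPairs (n : ℕ) : Set (SkewFilling n × SkewFilling n) :=
  {x | x.1.IsSemistandard ∧ x.2.IsSemistandard ∧ x.1.inner = x.2.inner ∧ x.1.outer = x.2.outer}

/-! ### Classical Kashiwara operators -/

/-- Parenthesis matching for a word, in which each `a` stands for `)` and each `b` for `(`.
The word is read from left to right; `pos` is the current position, `cl` lists the positions of the
unmatched `)` and `op` the positions of the so far unmatched `(`, both the most recent first. -/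
def matchParens {A : Type*} [DecidableEq A] (a b : A) :
    (w : List A) → (pos : ℕ) → (cl op : List ℕ) → List ℕ × List ℕ
  | [], _, cl, op => (cl, op)
  | x :: w, pos, cl, op =>
    if x = a then
      match op with
      | [] => matchParens a b w (pos + 1) (pos :: cl) []
      | _ :: op' => matchParens a b w (pos + 1) cl op'
    else if x = b then matchParens a b w (pos + 1) cl (pos :: op)
    else matchParens a b w (pos + 1) cl op

/-- The raising operator on words: the leftmost unmatched `(` becomes `)`. -/
def wordRaise {A : Type*} [DecidableEq A] (a b : A) (w : List A) : Option (List A) :=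
  (matchParens a b w 0 [] []).2.getLast?.map (fun p => w.set p a)

/-- The lowering operator on words: the rightmost unmatched `)` becomes `(`. -/
def wordLower {A : Type*} [DecidableEq A] (a b : A) (w : List A) : Option (List A) :=
  (matchParens a b w 0 [] []).1.head?.map (fun p => w.set p b)

namespace SkewFilling

variable {n : ℕ}

open Classical in
/-- The cells in the order of the column reading: column by column from left to right, every column
from its lowest row up. -/
noncomputable def readingCells (T : SkewFilling n) : List (ℕ ×ₗ ℤᵒᵈ) :=
  if h : T.cells.Finite then
    (h.toFinset.image (fun p => toLex (p.1, OrderDual.toDual p.2))).sort (fun p q => p ≤ q)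
  else []

/-- The column reading word. -/
noncomputable def colWord (T : SkewFilling n) : List (Fin n) :=
  T.readingCells.filterMap
    (fun p => T.label (ofLex p).1 (OrderDual.ofDual (ofLex p).2))

open Classical in
/-- The filling that has the shape of `T` and column reading word `w`, where `w = none` stands for
an undefined word and yields an undefined filling. -/
noncomputable def withColWord (T : SkewFilling n) (w : Option (List (Fin n))) :
    Option (SkewFilling n) :=
  if h : ∃ T' : SkewFilling n, T'.inner = T.inner ∧ T'.outer = T.outer ∧ w = some T'.colWord
  then some h.choose else none

/-- The `i`-th classical raising operator, `i = 1, …, n - 1`.  The letters `i` and `i + 1` are the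
elements `i - 1` and `i` of `Fin n`. -/
noncomputable def raise [NeZero n] (i : Fin n) (T : SkewFilling n) : Option (SkewFilling n) :=
  T.withColWord (wordRaise (i - 1) i T.colWord)

/-- The `i`-th classical lowering operator, `i = 1, …, n - 1`. -/
noncomputable def lower [NeZero n] (i : Fin n) (T : SkewFilling n) : Option (SkewFilling n) :=
  T.withColWord (wordLower (i - 1) i T.colWord)

end SkewFilling

/-! ### Affine crystals and bicrystals -/

/-- The data of a crystal graph with colors `0, …, n - 1`: content function, raising and lowering
Kashiwara operators (partial maps: `none` means that the operator is not defined). -/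
structure CrystalData (n : ℕ) (X : Type*) where
  content : X → Fin n → ℕ
  raise : Fin n → X → Option X
  lower : Fin n → X → Option X

/-- Iteration of a partial map. -/
def partialIter {X : Type*} (f : X → Option X) (m : ℕ) (b : X) : Option X :=
  (fun o : Option X => o.bind f)^[m] (some b)

/-- `h_0 = e_n - e_1` and `h_i = e_i - e_{i+1}`, `i = 1, …, n - 1`.  As the letter `k` is the
element `k - 1` of `Fin n`, both cases read `e_{i-1} - e_i` in cyclic notation. -/
def simpleCoroot {n : ℕ} [NeZero n] (i j : Fin n) : ℤ :=
  (if j = i - 1 then 1 else 0) - (if j = i then 1 else 0)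

/-- The data `C` make the set `B` an affine crystal of type `A^{(1)}_{n-1}`. -/
structure IsAffineCrystal {n : ℕ} [NeZero n] {X : Type*} (B : Set X) (C : CrystalData n X) :
    Prop where
  raise_mem : ∀ i, ∀ b ∈ B, ∀ b', C.raise i b = some b' → b' ∈ B
  lower_mem : ∀ i, ∀ b ∈ B, ∀ b', C.lower i b = some b' → b' ∈ B
  lower_iff_raise : ∀ i, ∀ b ∈ B, ∀ b' ∈ B, C.lower i b = some b' ↔ C.raise i b' = some b
  string_lengths : ∀ i, ∀ b ∈ B, ∃ φ ε : ℕ,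
    IsGreatest {m | partialIter (C.lower i) m b ≠ none} φ ∧
    IsGreatest {m | partialIter (C.raise i) m b ≠ none} ε ∧
    ∑ j, simpleCoroot i j * (C.content b j : ℤ) = (φ : ℤ) - ε
  content_lower : ∀ i, ∀ b ∈ B, ∀ b', C.lower i b = some b' →
    ∀ j, (C.content b' j : ℤ) = C.content b j - simpleCoroot i j

/-- Two partial maps commute on `B`; composites are undefined as soon as one of their factors is. -/
def PartialCommute {X : Type*} (B : Set X) (f g : X → Option X) : Prop :=
  ∀ b ∈ B, (f b).bind g = (g b).bind f

/-- Two commuting affine crystal structures on the set `B`. -/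
structure IsAffineBicrystal {n : ℕ} [NeZero n] {X : Type*} (B : Set X)
    (C : Fin 2 → CrystalData n X) : Prop where
  crystal : ∀ ε, IsAffineCrystal B (C ε)
  raise_raise : ∀ i j, PartialCommute B ((C 0).raise i) ((C 1).raise j)
  raise_lower : ∀ i j, PartialCommute B ((C 0).raise i) ((C 1).lower j)
  lower_raise : ∀ i j, PartialCommute B ((C 0).lower i) ((C 1).raise j)
  lower_lower : ∀ i j, PartialCommute B ((C 0).lower i) ((C 1).lower j)

/-- `f : B → B'` commutes with all Kashiwara operators, with the convention `f(∅) = ∅`, and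
preserves the content. -/
structure IsCrystalMorphism {n : ℕ} {X Y : Type*} (B : Set X) (C : CrystalData n X)
    (B' : Set Y) (C' : CrystalData n Y) (f : X → Y) : Prop where
  mapsTo : Set.MapsTo f B B'
  raise : ∀ i, ∀ b ∈ B, (C.raise i b).map f = C'.raise i (f b)
  lower : ∀ i, ∀ b ∈ B, (C.lower i b).map f = C'.lower i (f b)
  content : ∀ b ∈ B, C'.content (f b) = C.content b

/-- `f : B → B'` is a bijection, and both `f` and its inverse are morphisms for both crystal
structures. -/
def IsBicrystalIso {n : ℕ} {X Y : Type*} (B : Set X) (C : Fin 2 → CrystalData n X)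
    (B' : Set Y) (C' : Fin 2 → CrystalData n Y) (f : X → Y) : Prop :=
  ∃ g : Y → X, Set.InvOn g f B B' ∧
    (∀ ε, IsCrystalMorphism B (C ε) B' (C' ε) f) ∧
    (∀ ε, IsCrystalMorphism B' (C' ε) B (C ε) g)

/-! ### The bicrystal of pairs of semi-standard tableaux -/

/-- The conjugate `ι ∘ f ∘ ι⁻¹` of a partial map `f`, where `ι⁻¹` is the inverse of
`ι` on the set of pairs of semi-standard tableaux of the same shape. -/
noncomputable def conjOnPairs {n : ℕ}
    (ι : SkewFilling n × SkewFilling n → SkewFilling n × SkewFilling n)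
    (f : SkewFilling n × SkewFilling n → Option (SkewFilling n × SkewFilling n))
    (x : SkewFilling n × SkewFilling n) : Option (SkewFilling n × SkewFilling n) :=
  (f (Function.invFunOn ι (sstPairs n) x)).map ι

/-- Apply a partial map to the first tableau. -/
def onFst {n : ℕ} (f : SkewFilling n → Option (SkewFilling n))
    (x : SkewFilling n × SkewFilling n) : Option (SkewFilling n × SkewFilling n) :=
  (f x.1).map (fun P => (P, x.2))

/-- Apply a partial map to the second tableau. -/
def onSnd {n : ℕ} (f : SkewFilling n → Option (SkewFilling n))
    (x : SkewFilling n × SkewFilling n) : Option (SkewFilling n × SkewFilling n) :=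
  (f x.2).map (fun Q => (x.1, Q))

/-- The first family of Kashiwara operators on pairs of tableaux. -/
noncomputable def pairCrystal₁ (n : ℕ) [NeZero n] :
    CrystalData n (SkewFilling n × SkewFilling n) where
  content x := x.1.content
  raise i := if i = 0 then conjOnPairs iota₁ (onFst (SkewFilling.raise 1))
    else onFst (SkewFilling.raise i)
  lower i := if i = 0 then conjOnPairs iota₁ (onFst (SkewFilling.lower 1))
    else onFst (SkewFilling.lower i)

/-- The second family of Kashiwara operators on pairs of tableaux. -/
noncomputable def pairCrystal₂ (n : ℕ) [NeZero n] :
    CrystalData n (SkewFilling n × SkewFilling n) where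
  content x := x.2.content
  raise i := if i = 0 then conjOnPairs iota₂ (onSnd (SkewFilling.raise 1))
    else onSnd (SkewFilling.raise i)
  lower i := if i = 0 then conjOnPairs iota₂ (onSnd (SkewFilling.lower 1))
    else onSnd (SkewFilling.lower i)

/-- The two families of Kashiwara operators on pairs of tableaux. -/
noncomputable def pairBicrystal (n : ℕ) [NeZero n] :
    Fin 2 → CrystalData n (SkewFilling n × SkewFilling n) :=
  ![pairCrystal₁ n, pairCrystal₂ n]

/-!
Everything is expressed through the Gelfand–Tsetlin chain of a tableau `T`: the function `T.lev k`
records the shape formed by the empty cells and the cells with one of the first `k` letters, so that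
`T` is semi-standard exactly if consecutive levels differ by horizontal strips.

*Insertion is a growth diagram.*  An internal insertion adds one cell to each level, and from one
level to the next this cell moves down by one row exactly if it displaces a cell
(`internalInsert_spec`).  Summed over a horizontal strip of insertions, read from the bottom, this
becomes the local rule `IsGrowth`, which determines the fourth corner of a square of shapes from the
three others, is symmetric in the two middle corners, and can be run backwards.  Consequently `ι₂`
moves the chain of the first tableau through one row of a growth diagram and cycles the chain of the
second one (`IsIota`).  Invertibility of the rule makes `ι₁` and `ι₂` bijections (`bijOn_iota₂`);
its symmetry makes them commute (`iota_comm`) and yields `RSK = ι₂ⁿ = ι₁ⁿ`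
(`skewRSK_eq_iterate_iota₂`, `skewRSK_eq_iterate_iota₁`), because both powers fill the same `n × n`
growth diagram.

*Classical operators.*  The operator `Ẽ_i` adds a single cell to one level of the chain, in the
row that maximizes the excess of opening over closing parentheses (`IsSemistandard.raise_cases`).
In this form a case analysis at the two rows touched by one insertion shows that `Ẽ_i` commutes
with every internal insertion (`internalInserts_raise`), hence `Ẽ_i` and its partial inverse `F̃_i`,
acting on the first tableau, commute with `ι₂`; by symmetry, those acting on the second tableau
commute with `ι₁`.

*Affine operators.*  The operators of color `0` are conjugates of those of color `1`, and `ι₁`, `ι₂`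
shift the content cyclically (`IsIota.content_eq`), so the axioms for color `0` are transported from
color `1`.  Since `ι₁` and `ι₂` commute, the first affine family commutes with `ι₂` and the second
with `ι₁`.  This gives the commutation of the two families (`PartialCommute.affine`), and since RSK
is a power of `ι₂` as well as of `ι₁`, it gives the compatibility of RSK with both families.
-/

namespace SkewFilling

variable {n : ℕ}

/-! ### Level functions of a filling -/

/-- The number of cells of row `r` that are empty or carry one of the first `k` letters.  For a
semi-standard tableau, `T.lev 0 ⊆ T.lev 1 ⊆ ⋯ ⊆ T.lev n` is the associated Gelfand–Tsetlin chain
of generalized partitions, from the empty shape to the external one. -/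
def lev (T : SkewFilling n) (k : ℕ) (r : ℤ) : ℕ :=
  T.inner r + (T.row r).countP (fun x => decide (x.val < k))

/-- Labels increase weakly along rows. -/
def RowSorted (T : SkewFilling n) : Prop := ∀ r, (T.row r).Pairwise (· ≤ ·)

theorem lev_zero (T : SkewFilling n) : T.lev 0 = T.inner := by
  funext r; simp [lev]

theorem lev_last (T : SkewFilling n) : T.lev n = T.outer := by
  funext r
  simp [lev, outer]

theorem lev_mono (T : SkewFilling n) {k l : ℕ} (h : k ≤ l) (r : ℤ) : T.lev k r ≤ T.lev l r := by
  refine Nat.add_le_add_left (List.countP_mono_left fun x _ hx => ?_) _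
  simp only [decide_eq_true_eq] at hx ⊢
  omega

theorem lev_succ (T : SkewFilling n) (x : Fin n) (r : ℤ) :
    T.lev (x.val + 1) r = T.lev x.val r + (T.row r).count x := by
  have : ∀ l : List (Fin n), l.countP (fun y => decide (y.val < x.val + 1)) =
      l.countP (fun y => decide (y.val < x.val)) + l.count x := by
    intro l
    induction l with
    | nil => simp
    | cons y l ih =>
      simp only [List.countP_cons, List.count_cons, ih, decide_eq_true_eq, beq_iff_eq, Fin.ext_iff]
      split_ifs <;> omega
  simp only [lev, this]; omega

theorem count_row (T : SkewFilling n) (x : Fin n) (r : ℤ) :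
    (T.row r).count x = T.lev (x.val + 1) r - T.lev x.val r := by
  rw [lev_succ]; omega

/-- A filling with weakly increasing rows is determined by its level functions. -/
theorem ext_of_lev {T T' : SkewFilling n} (hT : T.RowSorted) (hT' : T'.RowSorted)
    (h : ∀ k ≤ n, T.lev k = T'.lev k) : T = T' := by
  have h1 : T.inner = T'.inner := by rw [← lev_zero, ← lev_zero, h 0 (Nat.zero_le _)]
  have h2 : T.row = T'.row := by
    funext r
    refine List.Perm.eq_of_pairwise (fun a b _ _ => le_antisymm) (hT r) (hT' r) ?_
    rw [List.perm_iff_count]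
    intro x
    rw [count_row, count_row, h _ x.isLt, h _ x.isLt.le]
  cases T; cases T'; simp_all

theorem lt_countP_iff {l : List (Fin n)} (hl : l.Pairwise (· ≤ ·)) (k i : ℕ) :
    i < l.countP (fun x => decide (x.val < k)) ↔ ∃ x, l[i]? = some x ∧ x.val < k := by
  induction l generalizing i with
  | nil => simp
  | cons y l ih =>
    rw [List.pairwise_cons] at hl
    by_cases hy : y.val < k
    · cases i with
      | zero => simp [hy]
      | succ i => simp [hy, ih hl.2]
    · have h0 : (y :: l).countP (fun x => decide (x.val < k)) = 0 := by
        rw [List.countP_eq_zero]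
        intro x hx
        have : y ≤ x := by
          rcases List.mem_cons.1 hx with rfl | hx
          · exact le_rfl
          · exact hl.1 x hx
        have := Fin.le_def.1 this
        simp; omega
      rw [h0]
      simp only [Nat.not_lt_zero, false_iff]
      rintro ⟨x, hx, hxk⟩
      have hx := List.mem_of_getElem? hx
      have : y ≤ x := by
        rcases List.mem_cons.1 hx with rfl | hx
        · exact le_rfl
        · exact hl.1 x hx
      have := Fin.le_def.1 this
      omega

theorem le_lev_iff {T : SkewFilling n} (hT : T.RowSorted) {c : ℕ} {r : ℤ} (hc : T.inner r < c)
    (k : ℕ) : c ≤ T.lev k r ↔ ∃ x, T.label c r = some x ∧ x.val < k := by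
  rw [label, if_pos hc, ← lt_countP_iff (hT r), lev]
  omega

theorem label_eq_some_iff {T : SkewFilling n} (hT : T.RowSorted) {c : ℕ} {r : ℤ} {x : Fin n} :
    T.label c r = some x ↔ T.lev x.val r < c ∧ c ≤ T.lev (x.val + 1) r := by
  by_cases hc : T.inner r < c
  · rw [← not_le, le_lev_iff hT hc, le_lev_iff hT hc]
    constructor
    · intro h
      refine ⟨?_, x, h, by omega⟩
      rintro ⟨y, hy, hyx⟩
      rw [h] at hy
      cases hy
      omega
    · rintro ⟨h1, y, hy, hyx⟩
      rw [hy]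
      congr 1
      by_contra hne
      refine h1 ⟨y, hy, ?_⟩
      have : y.val ≠ x.val := fun h => hne (Fin.ext h)
      omega
  · have := T.lev_mono (Nat.zero_le x.val) r
    rw [lev_zero] at this
    simp only [label, if_neg hc]
    constructor
    · intro h; cases h
    · intro h; omega

/-- The filling with weakly increasing rows that has the level functions `L 0, …, L n`. -/
def ofLev (n : ℕ) (L : ℕ → ℤ → ℕ) : SkewFilling n where
  inner := L 0
  row r := (List.finRange n).flatMap fun k => List.replicate (L (k.val + 1) r - L k.val r) k

theorem rowSorted_ofLev (L : ℕ → ℤ → ℕ) : (ofLev n L).RowSorted := by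
  intro r
  simp only [ofLev, List.pairwise_flatMap, List.mem_replicate]
  constructor
  · intro a _
    exact List.pairwise_replicate.2 (Or.inr le_rfl)
  · refine (List.pairwise_lt_finRange n).imp ?_
    rintro a b hab x ⟨_, rfl⟩ y ⟨_, rfl⟩
    exact hab.le

theorem lev_ofLev {L : ℕ → ℤ → ℕ} (hL : ∀ k < n, ∀ r, L k r ≤ L (k + 1) r) {k : ℕ} (hk : k ≤ n) :
    (ofLev n L).lev k = L k := by
  funext r
  have hc : ∀ x : Fin n, ((ofLev n L).row r).count x = L (x.val + 1) r - L x.val r := by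
    intro x
    simp only [ofLev, List.count_flatMap, Function.comp_def, List.count_replicate]
    rw [List.sum_map_eq_nsmul_single x]
    · simp
    · intro y hy _
      simp [hy]
  induction k with
  | zero => simp [lev_zero, ofLev]
  | succ k ih =>
    have h1 := lev_succ (ofLev n L) ⟨k, hk⟩ r
    rw [hc] at h1
    have h2 := hL k hk r
    have h3 := ih (by omega)
    simp only at h1
    omega

/-! ### Semi-standardness in terms of the level functions -/

end SkewFilling

/-- `β/α` is a horizontal strip. -/
def IsStrip (α β : ℤ → ℕ) : Prop := ∀ r, α r ≤ β r ∧ β (r + 1) ≤ α r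

theorem IsStrip.antitone_left {α β : ℤ → ℕ} (h : IsStrip α β) : Antitone α :=
  antitone_int_of_succ_le fun r => ((h (r + 1)).1).trans (h r).2

theorem IsStrip.antitone_right {α β : ℤ → ℕ} (h : IsStrip α β) : Antitone β :=
  antitone_int_of_succ_le fun r => ((h r).2).trans (h r).1

namespace SkewFilling

variable {n : ℕ}

theorem IsSemistandard.rowSorted {T : SkewFilling n} (hT : T.IsSemistandard) : T.RowSorted :=
  hT.row_weak

theorem IsSemistandard.isStrip {T : SkewFilling n} (hT : T.IsSemistandard) {k : ℕ} (hk : k < n) :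
    IsStrip (T.lev k) (T.lev (k + 1)) := by
  intro r
  refine ⟨T.lev_mono (Nat.le_succ k) r, ?_⟩
  by_contra hlt
  push Not at hlt
  set c := T.lev (k + 1) (r + 1) with hc
  have i1 : T.inner (r + 1) ≤ T.inner r := hT.inner_anti (by omega)
  have i2 : T.inner r ≤ T.lev k r := by
    rw [← lev_zero]; exact T.lev_mono (Nat.zero_le k) r
  have o1 : c ≤ T.outer r := by
    refine le_trans ?_ (hT.outer_anti (show r ≤ r + 1 by omega))
    rw [← lev_last]; exact T.lev_mono hk _
  obtain ⟨y, hy, hyk⟩ :=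
    (le_lev_iff hT.rowSorted (show T.inner (r + 1) < c by omega) (k + 1)).1 hc.le
  rw [← lev_last] at o1
  obtain ⟨x, hx, -⟩ := (le_lev_iff hT.rowSorted (show T.inner r < c by omega) n).1 o1
  have hxy := Fin.lt_def.1 (hT.col_strict c r x y hx hy)
  have := (le_lev_iff hT.rowSorted (show T.inner r < c by omega) k).2 ⟨x, hx, by omega⟩
  omega

theorem isSemistandard_of_isStrip [NeZero n] {T : SkewFilling n} (hs : T.RowSorted)
    (h : ∀ k < n, IsStrip (T.lev k) (T.lev (k + 1)))
    (hb : ∃ b : ℤ, ∀ r, b ≤ r → T.lev n r = 0)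
    (ha : ∃ (a : ℤ) (M : ℕ), ∀ r, r ≤ a → T.lev 0 r = M ∧ T.lev n r = M) : T.IsSemistandard where
  inner_anti := by
    rw [← lev_zero]
    exact (h 0 (NeZero.pos n)).antitone_left
  outer_anti := by
    rw [← lev_last]
    have h1 := NeZero.pos n
    have := (h (n - 1) (by omega)).antitone_right
    rwa [Nat.sub_add_cancel h1] at this
  below := by rwa [lev_last] at hb
  above := by rwa [lev_last, lev_zero] at ha
  row_weak := hs
  col_strict := by
    intro c r x y hx hy
    rw [label_eq_some_iff hs] at hx hy
    by_contra hlt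
    have hyx : y.val ≤ x.val := by simpa using hlt
    have h1 := (h y.val y.isLt r).2
    have h2 := T.lev_mono hyx r
    omega

/-- The level functions do not change far above and far below. -/
theorem IsSemistandard.lev_bounds {T : SkewFilling n} (hT : T.IsSemistandard) :
    ∃ (a b : ℤ) (M : ℕ), (∀ k ≤ n, ∀ r, r ≤ a → T.lev k r = M) ∧
      (∀ k ≤ n, ∀ r, b ≤ r → T.lev k r = 0) := by
  obtain ⟨b, hb⟩ := hT.below
  obtain ⟨a, M, ha⟩ := hT.above
  refine ⟨a, b, M, fun k hk r hr => ?_, fun k hk r hr => ?_⟩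
  · have h1 := T.lev_mono (Nat.zero_le k) r
    have h2 := T.lev_mono hk r
    rw [lev_zero] at h1
    rw [lev_last] at h2
    have := ha r hr
    omega
  · have h2 := T.lev_mono hk r
    rw [lev_last, hb r hr] at h2
    omega

end SkewFilling

/-! ### Insertion paths -/

/-- The path of a new cell through the levels `k₀, k₀ + 1, …, n` of a chain `L`: at each step the
cell moves one row down exactly when it displaces a cell of the strip `L (k + 1) / L k`. -/
def IsPath (n k₀ : ℕ) (L : ℕ → ℤ → ℕ) (p : ℕ → ℤ) : Prop :=
  ∀ k, k₀ ≤ k → k < n → p (k + 1) = if L k (p k) < L (k + 1) (p k) then p k + 1 else p k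

theorem IsPath.start_le {n k₀ : ℕ} {L : ℕ → ℤ → ℕ} {p : ℕ → ℤ} (h : IsPath n k₀ L p) {k : ℕ}
    (hk : k₀ ≤ k) (hkn : k ≤ n) : p k₀ ≤ p k := by
  induction k, hk using Nat.le_induction with
  | base => exact le_rfl
  | succ k hk ih =>
    have h1 := ih (by omega)
    have h2 := h k hk (by omega)
    split_ifs at h2 <;> omega

namespace SkewFilling

variable {n : ℕ}

/-- Inserting `x` adds one cell to every level that counts the letter `x`, along an insertion path:
as a level grows by letters `y`, its new cell moves down exactly when a letter `y` is displaced. -/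
theorem bump_spec (T : SkewFilling n) (r : ℤ) (x : Fin n) (hT : T.RowSorted) :
    (T.bump r x).RowSorted ∧ ∃ p : ℕ → ℤ, p (x.val + 1) = r ∧ IsPath n (x.val + 1) T.lev p ∧
      ∀ k ≤ n, ∀ s, (T.bump r x).lev k s = T.lev k s + if x.val < k ∧ s = p k then 1 else 0 := by
  induction T, r, x using bump.induct with
  | case1 T r x h =>
    have hle : ∀ y ∈ T.row r, y ≤ x := by
      intro y hy
      have := List.find?_eq_none.1 h y hy
      simpa using this
    have hb : T.bump r x = T.setRow r (T.row r ++ [x]) := by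
      rw [bump]; split
      · rfl
      · rename_i y hy; rw [h] at hy; cases hy
    rw [hb]
    refine ⟨?_, fun _ => r, rfl, ?_, ?_⟩
    · intro s
      by_cases hs : s = r
      · subst hs
        simp only [setRow, Function.update_self, List.pairwise_append]
        refine ⟨hT s, List.pairwise_singleton _ _, ?_⟩
        intro a ha b hb
        rw [List.mem_singleton] at hb
        exact hb ▸ hle a ha
      · simpa only [setRow, Function.update_of_ne hs] using hT s
    · intro k hk hkn
      rw [if_neg]
      rw [lev_succ T ⟨k, hkn⟩ r, List.count_eq_zero_of_not_mem]
      · simp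
      · intro hmem
        have := Fin.le_def.1 (hle _ hmem)
        simp only at this
        omega
    · intro k hk s
      by_cases hs : s = r
      · subst hs
        simp [lev, setRow, add_assoc, List.countP_cons]
      · simp [lev, setRow, hs]
  | case2 T r x y h ih =>
    obtain ⟨hxy, as, bs, hrow, has⟩ := List.find?_eq_some_iff_append.1 h
    have hxy : x < y := by simpa using hxy
    have hxy' : x.val < y.val := hxy
    have has : ∀ a ∈ as, a ≤ x := fun a ha => by simpa using has a ha
    have hy : y ∉ as := fun hy => absurd (has y hy) (not_le.2 hxy)
    have hrep : (T.row r).replace y x = as ++ x :: bs := by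
      rw [hrow, List.replace_append_right hy, List.replace_cons_self]
    have hsort := hT r
    rw [hrow, List.pairwise_append, List.pairwise_cons] at hsort
    obtain ⟨hs1, ⟨hs2, hs3⟩, hs4⟩ := hsort
    have hb : T.bump r x = (T.setRow r ((T.row r).replace y x)).bump (r + 1) y := by
      conv_lhs => rw [bump]
      split
      · rename_i hy; rw [h] at hy; cases hy
      · rename_i z hz; rw [h] at hz; cases hz; rfl
    rw [hb]
    set T1 := T.setRow r ((T.row r).replace y x) with hT1
    have hT1s : T1.RowSorted := by
      intro s
      by_cases hs : s = r
      · subst hs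
        simp only [hT1, setRow, Function.update_self, hrep, List.pairwise_append,
          List.pairwise_cons]
        refine ⟨hs1, ⟨fun b hb => hxy.le.trans (hs2 b hb), hs3⟩, ?_⟩
        intro a ha b hb
        rcases List.mem_cons.1 hb with rfl | hb
        · exact has a ha
        · exact hs4 a ha b (List.mem_cons_of_mem _ hb)
      · simpa only [hT1, setRow, Function.update_of_ne hs] using hT s
    have hlev : ∀ k s, T1.lev k s = T.lev k s + if s = r ∧ x.val < k ∧ k ≤ y.val then 1 else 0 := by
      intro k s
      by_cases hs : s = r
      · subst hs
        simp only [lev, hT1, setRow, Function.update_self, hrep]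
        rw [hrow]
        simp only [List.countP_append, List.countP_cons, decide_eq_true_eq, true_and]
        split_ifs <;> omega
      · simp [lev, hT1, setRow, hs]
    obtain ⟨ihs, p, hp0, hp, hpl⟩ := ih hT1s
    refine ⟨ihs, fun k => if k ≤ y.val then r else p k, by simp; omega, ?_, ?_⟩
    · intro k hk hkn
      have hcount := lev_succ T ⟨k, hkn⟩ r
      simp only at hcount
      rcases lt_trichotomy k y.val with hky | hky | hky
      · simp only [show k + 1 ≤ y.val by omega, show k ≤ y.val by omega, if_true]
        rw [if_neg]
        rw [hcount, hrow, List.count_eq_zero_of_not_mem]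
        · omega
        · intro hmem
          rcases List.mem_append.1 hmem with hm | hm
          · have := Fin.le_def.1 (has _ hm)
            simp only at this
            omega
          · rcases List.mem_cons.1 hm with hm | hm
            · have := congrArg Fin.val hm
              simp only at this
              omega
            · have := Fin.le_def.1 (hs2 _ hm)
              simp only at this
              omega
      · have : 0 < (T.row r).count ⟨k, hkn⟩ := by
          rw [List.count_pos_iff, hrow]
          have : (⟨k, hkn⟩ : Fin n) = y := Fin.ext hky
          simp [this]
        simp only [show ¬ k + 1 ≤ y.val by omega, show k ≤ y.val by omega, if_true, if_false]
        rw [if_pos (by omega), hky, hp0]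
      · have h1 := hp k hky hkn
        have h2 := hp.start_le hky hkn.le
        rw [hp0] at h2
        have hl : ∀ j, T1.lev j (p k) = T.lev j (p k) := fun j => by
          rw [hlev, if_neg (by omega), add_zero]
        rw [hl, hl] at h1
        simp only [show ¬ k + 1 ≤ y.val by omega, show ¬ k ≤ y.val by omega, if_false]
        exact h1
    · intro k hk s
      beta_reduce
      rw [hpl k hk s, hlev]
      split_ifs <;> omega

/-- An internal insertion adds one cell to each level, along an insertion path. -/
theorem internalInsert_spec (T : SkewFilling n) (r : ℤ) (hT : T.RowSorted) :
    (T.internalInsert r).RowSorted ∧ ∃ p : ℕ → ℤ, p 0 = r ∧ IsPath n 0 T.lev p ∧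
      ∀ k ≤ n, ∀ s, (T.internalInsert r).lev k s = T.lev k s + if s = p k then 1 else 0 := by
  unfold internalInsert
  split
  · rename_i hrow
    refine ⟨hT, fun _ => r, rfl, ?_, ?_⟩
    · intro k _ _
      simp [lev, hrow]
    · intro k _ s
      by_cases hs : s = r
      · subst hs; simp [lev, addEmpty, hrow]
      · simp [lev, addEmpty, hs]
  · rename_i x l hrow
    set T1 := (T.addEmpty r).setRow r l with hT1
    have hsort := hT r
    rw [hrow, List.pairwise_cons] at hsort
    have hT1s : T1.RowSorted := by
      intro s
      by_cases hs : s = r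
      · subst hs
        simpa only [hT1, setRow, Function.update_self] using hsort.2
      · simpa only [hT1, setRow, addEmpty, Function.update_of_ne hs] using hT s
    have hlev : ∀ k s, T1.lev k s = T.lev k s + if s = r ∧ k ≤ x.val then 1 else 0 := by
      intro k s
      by_cases hs : s = r
      · subst hs
        simp only [lev, hT1, setRow, addEmpty, Function.update_self, hrow, List.countP_cons,
          decide_eq_true_eq, true_and]
        split_ifs <;> omega
      · simp [lev, hT1, setRow, addEmpty, hs]
    obtain ⟨ihs, p, hp0, hp, hpl⟩ := bump_spec T1 (r + 1) x hT1s
    refine ⟨ihs, fun k => if k ≤ x.val then r else p k, by simp, ?_, ?_⟩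
    · intro k _ hkn
      have hcount := lev_succ T ⟨k, hkn⟩ r
      simp only at hcount
      rcases lt_trichotomy k x.val with hky | hky | hky
      · simp only [show k + 1 ≤ x.val by omega, show k ≤ x.val by omega, if_true]
        rw [if_neg]
        rw [hcount, hrow, List.count_eq_zero_of_not_mem]
        · omega
        · intro hmem
          rcases List.mem_cons.1 hmem with hm | hm
          · have := congrArg Fin.val hm
            simp only at this
            omega
          · have := Fin.le_def.1 (hsort.1 _ hm)
            simp only at this
            omega
      · have : 0 < (T.row r).count ⟨k, hkn⟩ := by
          rw [List.count_pos_iff, hrow]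
          have : (⟨k, hkn⟩ : Fin n) = x := Fin.ext hky
          simp [this]
        simp only [show ¬ k + 1 ≤ x.val by omega, show k ≤ x.val by omega, if_true, if_false]
        rw [if_pos (by omega), hky, hp0]
      · have h1 := hp k hky hkn
        have h2 := hp.start_le hky hkn.le
        rw [hp0] at h2
        have hl : ∀ j, T1.lev j (p k) = T.lev j (p k) := fun j => by
          rw [hlev, if_neg (by omega), add_zero]
        rw [hl, hl] at h1
        simp only [show ¬ k + 1 ≤ x.val by omega, show ¬ k ≤ x.val by omega, if_false]
        exact h1
    · intro k hk s
      beta_reduce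
      rw [hpl k hk s, hlev]
      split_ifs <;> omega

theorem internalInserts_append_singleton (T : SkewFilling n) (rs : List ℤ) (t : ℤ) :
    T.internalInserts (rs ++ [t]) = (T.internalInserts rs).internalInsert t := by
  simp [internalInserts]

theorem rowSorted_internalInserts {T : SkewFilling n} (hT : T.RowSorted) (rs : List ℤ) :
    (T.internalInserts rs).RowSorted := by
  induction rs generalizing T with
  | nil => exact hT
  | cons t rs ih => exact ih (T.internalInsert_spec t hT).1

end SkewFilling

/-! ### The local growth rule -/

/-- The local rule of the growth diagrams of row insertion: `κ` is the fourth corner of the square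
with lower left corner `ρ` and neighbouring corners `α`, `β`.  It is symmetric in `α` and `β`, and
`ρ` can be recovered from the three other corners. -/
def IsGrowth (ρ α β κ : ℤ → ℕ) : Prop :=
  ∀ i, κ (i + 1) + ρ i = max (α (i + 1)) (β (i + 1)) + min (α i) (β i)

namespace IsGrowth

variable {ρ ρ' α β κ κ' : ℤ → ℕ}

theorem symm (h : IsGrowth ρ α β κ) : IsGrowth ρ β α κ := fun i => by
  rw [h i, max_comm, min_comm]

/-- The local rule determines the fourth corner. -/
theorem top_unique (h : IsGrowth ρ α β κ) (h' : IsGrowth ρ α β κ') : κ = κ' := by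
  funext i
  have h1 := h (i - 1)
  have h2 := h' (i - 1)
  rw [sub_add_cancel] at h1 h2
  omega

/-- The local rule can be run backwards. -/
theorem bot_unique (h : IsGrowth ρ α β κ) (h' : IsGrowth ρ' α β κ) : ρ = ρ' := by
  funext i
  have h1 := h i
  have h2 := h' i
  omega

theorem isStrip_top (h : IsGrowth ρ α β κ) (hα : IsStrip ρ α) (hβ : IsStrip ρ β) :
    IsStrip α κ := by
  intro i
  have h1 := h (i - 1)
  have h2 := h i
  have a1 := hα (i - 1)
  have b1 := hβ (i - 1)
  have a2 := hα i
  have b2 := hβ i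
  rw [sub_add_cancel] at h1 a1 b1
  omega

theorem isStrip_bot (h : IsGrowth ρ α β κ) (hα : IsStrip α κ) (hβ : IsStrip β κ) :
    IsStrip ρ α := by
  intro i
  have h2 := h i
  have a1 := hα (i + 1)
  have b1 := hβ (i + 1)
  have a2 := hα i
  have b2 := hβ i
  omega

end IsGrowth

namespace SkewFilling

variable {n : ℕ}

/-- Internal insertion along a horizontal strip, from the bottom row to the top row, acts on each
pair of consecutive levels by the local growth rule. -/
theorem internalInserts_spec {T : SkewFilling n} (hT : T.RowSorted) {rs : List ℤ}
    (hrs : rs.Pairwise (fun a b => b ≤ a)) :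
    (∀ r, (T.internalInserts rs).lev 0 r = T.lev 0 r + rs.count r) ∧
    ∀ k < n, IsGrowth (T.lev k) (T.lev (k + 1)) ((T.internalInserts rs).lev k)
      ((T.internalInserts rs).lev (k + 1)) := by
  induction rs using List.reverseRecOn with
  | nil =>
    refine ⟨fun r => by simp [internalInserts], fun k _ i => ?_⟩
    have h1 := T.lev_mono (Nat.le_succ k) (i + 1)
    have h2 := T.lev_mono (Nat.le_succ k) i
    simp only [internalInserts, List.foldl_nil, Nat.succ_eq_add_one] at *
    omega
  | append_singleton rs t ih =>
    rw [List.pairwise_append] at hrs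
    obtain ⟨hrs, -, hlast⟩ := hrs
    obtain ⟨ih0, ih1⟩ := ih hrs
    rw [internalInserts_append_singleton]
    set T1 := T.internalInserts rs with hT1
    obtain ⟨-, p, hp0, hp, hpl⟩ := T1.internalInsert_spec t (rowSorted_internalInserts hT rs)
    -- Above the insertion path the earlier insertions have not changed anything.
    have key : ∀ k ≤ n, ∀ i < p k, T1.lev k i = T.lev k i := by
      intro k
      induction k with
      | zero =>
        intro _ i hi
        rw [ih0, List.count_eq_zero_of_not_mem, add_zero]
        intro hmem
        have := hlast i hmem t (List.mem_singleton_self t)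
        omega
      | succ k ihk =>
        intro hk i hi
        have hk0 := ihk (by omega)
        have hpk := hp k (Nat.zero_le k) hk
        have g := ih1 k hk (i - 1)
        rw [sub_add_cancel] at g
        have m1 := T.lev_mono (Nat.le_succ k) (i - 1)
        have m2 := T.lev_mono (Nat.le_succ k) i
        have e1 := hk0 (i - 1) (by split_ifs at hpk <;> omega)
        simp only [Nat.succ_eq_add_one] at m1 m2
        by_cases hi' : i < p k
        · have := hk0 i hi'
          omega
        · split_ifs at hpk with hlt
          · have : p k = i := by omega
            rw [this] at hlt
            omega
          · omega
    refine ⟨fun r => ?_, fun k hk i => ?_⟩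
    · rw [hpl 0 (Nat.zero_le _), ih0, hp0, List.count_append, List.count_singleton]
      simp only [beq_iff_eq, eq_comm (a := r), add_assoc]
    · rw [hpl k hk.le, hpl (k + 1) hk, hpl k hk.le]
      have hpk := hp k (Nat.zero_le k) hk
      have g := ih1 k hk i
      have g' := ih1 k hk (p k - 1)
      rw [sub_add_cancel] at g'
      have m1 := T.lev_mono (Nat.le_succ k) (p k - 1)
      have e1 := key k hk.le (p k - 1) (by omega)
      simp only [Nat.succ_eq_add_one] at m1
      by_cases c1 : i = p k
      · subst c1
        split_ifs at hpk ⊢ <;> omega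
      · by_cases c2 : i + 1 = p k
        · rw [c2] at g ⊢
          split_ifs at hpk ⊢ <;> omega
        · split_ifs at hpk ⊢ <;> omega

/-! ### Rows of the cells with a given label -/

theorem IsSemistandard.finite_rows {T : SkewFilling n} (hT : T.IsSemistandard) :
    {r | T.row r ≠ []}.Finite := by
  obtain ⟨b, hb⟩ := hT.below
  obtain ⟨a, M, ha⟩ := hT.above
  refine (Set.finite_Icc a b).subset fun r hr => ?_
  have hr : 0 < (T.row r).length := List.length_pos_iff.2 hr
  constructor
  · by_contra h
    have := ha r (by omega)
    rw [outer] at this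
    omega
  · by_contra h
    have := hb r (by omega)
    rw [outer] at this
    omega

theorem pairwise_rowCoords (T : SkewFilling n) (j : Fin n) :
    (T.rowCoords j).Pairwise (fun a b => b ≤ a) := by
  rw [rowCoords, List.pairwise_flatMap]
  refine ⟨fun r _ => List.pairwise_replicate.2 (Or.inr le_rfl), ?_⟩
  refine (Finset.pairwise_sort _ _).imp ?_
  intro r s hrs a ha b hb
  rw [List.mem_replicate] at ha hb
  rw [ha.2, hb.2]
  exact hrs

theorem IsSemistandard.count_rowCoords {T : SkewFilling n} (hT : T.IsSemistandard) (j : Fin n)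
    (r : ℤ) : (T.rowCoords j).count r = (T.row r).count j := by
  have hfin := hT.finite_rows
  rw [rowCoords, List.count_flatMap]
  simp only [Function.comp_def, List.count_replicate]
  by_cases hr : T.row r = []
  · rw [hr, List.count_nil, List.sum_eq_zero]
    intro a ha
    obtain ⟨s, -, rfl⟩ := List.mem_map.1 ha
    by_cases hs : s = r
    · subst hs; simp [hr]
    · simp [hs]
  · rw [List.sum_map_eq_nsmul_single r]
    · rw [List.count_eq_one_of_mem (Finset.sort_nodup _ _)]
      · simp
      · rw [Finset.mem_sort, labelledRows, dif_pos hfin]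
        simpa using hr
    · intro s hs _
      simp [hs]

/-! ### Adding and vacating cells -/

theorem lev_extend (T : SkewFilling n) (κ : ℤ → ℕ) (x : Fin n) (k : ℕ) (r : ℤ) :
    (T.extend κ x).lev k r = T.lev k r + if x.val < k then κ r - T.outer r else 0 := by
  simp only [lev, extend, List.countP_append, List.countP_replicate, decide_eq_true_eq, add_assoc]

theorem rowSorted_extend {T : SkewFilling n} (hT : T.RowSorted) {x : Fin n}
    (hx : T.lev (x.val + 1) = T.lev n) (κ : ℤ → ℕ) : (T.extend κ x).RowSorted := by
  intro r
  simp only [extend, List.pairwise_append]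
  refine ⟨hT r, List.pairwise_replicate.2 (Or.inr le_rfl), ?_⟩
  intro a ha b hb
  rw [(List.mem_replicate.1 hb).2]
  have h := congrFun hx r
  rw [lev_last, lev, outer] at h
  have := List.countP_eq_length.1 (Nat.add_left_cancel h) a ha
  simp only [decide_eq_true_eq] at this
  exact Fin.le_def.2 (by omega)

theorem val_sub_one [NeZero n] {x : Fin n} (hx : x ≠ 0) : (x - 1).val + 1 = x.val := by
  have h := Fin.val_sub_one_of_ne_zero hx
  have : x.val ≠ 0 := fun h => hx (Fin.ext (by simpa using h))
  omega

theorem val_zero_sub_one [NeZero n] : ((0 : Fin n) - 1).val + 1 = n := by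
  obtain ⟨m, rfl⟩ : ∃ m, n = m + 1 := ⟨n - 1, by have := NeZero.pos n; omega⟩
  have := Fin.coe_neg_one (n := m)
  rw [zero_sub]
  exact congrArg (· + 1) this

theorem lev_vacateOnes [NeZero n] (T : SkewFilling n) (k : ℕ) (r : ℤ) :
    T.vacateOnes.lev k r = T.lev (k + 1) r := by
  have : ∀ l : List (Fin n), l.count 0 + ((l.filter (fun x => decide (x ≠ 0))).map
      (fun x => x - 1)).countP (fun x => decide (x.val < k)) =
      l.countP (fun x => decide (x.val < k + 1)) := by
    intro l
    induction l with
    | nil => simp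
    | cons x l ih =>
      by_cases hx : x = 0
      · subst hx
        rw [List.filter_cons_of_neg (by simp), List.count_cons_self,
          List.countP_cons_of_pos (by simp), ← ih]
        omega
      · have h1 := val_sub_one hx
        rw [List.filter_cons_of_pos (by simpa using hx), List.map_cons, List.countP_cons,
          List.countP_cons, List.count_cons_of_ne hx, ← ih]
        simp only [decide_eq_true_eq]
        split_ifs <;> omega
  simp only [lev, vacateOnes, add_assoc, this]

theorem rowSorted_vacateOnes [NeZero n] {T : SkewFilling n} (hT : T.RowSorted) :
    T.vacateOnes.RowSorted := by
  intro r
  simp only [vacateOnes, List.pairwise_map, List.pairwise_filter]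
  refine (hT r).imp ?_
  intro a b hab ha hb
  have h1 := val_sub_one (of_decide_eq_true ha)
  have h2 := val_sub_one (of_decide_eq_true hb)
  have := Fin.le_def.1 hab
  exact Fin.le_def.2 (by omega)

end SkewFilling

open SkewFilling

section Cycling

variable {n : ℕ}

/-! ### Internal insertion with cycling in terms of the level functions -/

theorem lev_zero_eq {x : SkewFilling n × SkewFilling n} (hx : x ∈ sstPairs n) :
    x.1.lev 0 = x.2.lev 0 := by
  rw [lev_zero, lev_zero, hx.2.2.1]

theorem lev_last_eq {x : SkewFilling n × SkewFilling n} (hx : x ∈ sstPairs n) :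
    x.1.lev n = x.2.lev n := by
  rw [lev_last, lev_last, hx.2.2.2]

theorem swap_mem {x : SkewFilling n × SkewFilling n} (hx : x ∈ sstPairs n) :
    x.swap ∈ sstPairs n :=
  ⟨hx.2.1, hx.1, hx.2.2.1.symm, hx.2.2.2.symm⟩

theorem mem_sstPairs_of_lev [NeZero n] {x : SkewFilling n × SkewFilling n}
    (h1 : x.1.RowSorted) (h2 : x.2.RowSorted)
    (s1 : ∀ k < n, IsStrip (x.1.lev k) (x.1.lev (k + 1)))
    (s2 : ∀ k < n, IsStrip (x.2.lev k) (x.2.lev (k + 1)))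
    (h0 : x.1.lev 0 = x.2.lev 0) (hn : x.1.lev n = x.2.lev n)
    (hb : ∃ b : ℤ, ∀ r, b ≤ r → x.1.lev n r = 0)
    (ha : ∃ (a : ℤ) (M : ℕ), ∀ r, r ≤ a → x.1.lev 0 r = M ∧ x.1.lev n r = M) :
    x ∈ sstPairs n := by
  refine ⟨isSemistandard_of_isStrip h1 s1 hb ha,
    isSemistandard_of_isStrip h2 s2 (hn ▸ hb) (h0 ▸ hn ▸ ha), ?_, ?_⟩
  · rw [← lev_zero, ← lev_zero, h0]
  · rw [← lev_last, ← lev_last, hn]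

/-- The relation `y = ι₂ x` in terms of the level functions: the first chain is moved by the growth
rule across the first strip of the second chain, and this strip is replaced by the one that comes
out at the other end. -/
structure IsIota (x y : SkewFilling n × SkewFilling n) : Prop where
  sorted_fst : y.1.RowSorted
  sorted_snd : y.2.RowSorted
  fst_zero : y.1.lev 0 = x.2.lev 1
  growth : ∀ k < n, IsGrowth (x.1.lev k) (x.1.lev (k + 1)) (y.1.lev k) (y.1.lev (k + 1))
  snd_lt : ∀ k < n, y.2.lev k = x.2.lev (k + 1)
  snd_last : y.2.lev n = y.1.lev n

namespace IsIota

variable {x x' y y' : SkewFilling n × SkewFilling n}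

theorem unique (h : IsIota x y) (h' : IsIota x y') : y = y' := by
  have e1 : ∀ k ≤ n, y.1.lev k = y'.1.lev k := by
    intro k
    induction k with
    | zero => intro _; rw [h.fst_zero, h'.fst_zero]
    | succ k ih =>
      intro hk
      have g := h.growth k hk
      rw [ih (by omega)] at g
      exact g.top_unique (h'.growth k hk)
  refine Prod.ext (ext_of_lev h.sorted_fst h'.sorted_fst e1)
    (ext_of_lev h.sorted_snd h'.sorted_snd fun k hk => ?_)
  rcases hk.eq_or_lt with rfl | hk
  · rw [h.snd_last, h'.snd_last, e1 _ le_rfl]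
  · rw [h.snd_lt k hk, h'.snd_lt k hk]

/-- Every level of the first tableau grows by a horizontal strip. -/
theorem isStrip [NeZero n] (h : IsIota x y) (hx : x ∈ sstPairs n) {k : ℕ} (hk : k ≤ n) :
    IsStrip (x.1.lev k) (y.1.lev k) := by
  induction k with
  | zero =>
    rw [h.fst_zero, lev_zero_eq hx]
    exact hx.2.1.isStrip (NeZero.pos n)
  | succ k ih =>
    exact (h.growth k hk).isStrip_top (hx.1.isStrip hk) (ih (by omega))

theorem mem [NeZero n] (h : IsIota x y) (hx : x ∈ sstPairs n) : y ∈ sstPairs n := by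
  have hn := NeZero.pos n
  obtain ⟨a, b, M, h1, h2⟩ := hx.1.lev_bounds
  obtain ⟨a', b', M', h1', h2'⟩ := hx.2.1.lev_bounds
  have hM : M = M' := by
    have e := congrFun (lev_zero_eq hx) (min a a')
    rwa [h1 0 hn.le _ (min_le_left _ _), h1' 0 hn.le _ (min_le_right _ _)] at e
  subst hM
  refine mem_sstPairs_of_lev h.sorted_fst h.sorted_snd (fun k hk => ?_) (fun k hk => ?_) ?_
    h.snd_last.symm ?_ ?_
  · exact (h.growth k hk).symm.isStrip_top (h.isStrip hx hk.le) (hx.1.isStrip hk)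
  · rcases (Nat.succ_le_of_lt hk).eq_or_lt with hk' | hk'
    · rw [h.snd_lt k hk, show k + 1 = n from hk', h.snd_last, ← lev_last_eq hx]
      exact h.isStrip hx le_rfl
    · rw [h.snd_lt k hk, h.snd_lt (k + 1) hk']
      exact hx.2.1.isStrip hk'
  · rw [h.fst_zero, h.snd_lt 0 hn]
  · refine ⟨max b b' + 1, fun r hr => ?_⟩
    have : ∀ k ≤ n, y.1.lev k r = 0 := by
      intro k
      induction k with
      | zero => intro _; rw [h.fst_zero, h2' 1 hn r (by omega)]
      | succ k ih =>
        intro hk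
        have g := h.growth k hk (r - 1)
        rw [sub_add_cancel, ih (by omega), h2 _ hk r (by omega), h2 _ hk (r - 1) (by omega)] at g
        omega
    exact this n le_rfl
  · refine ⟨min a a', M, fun r hr => ?_⟩
    have : ∀ k ≤ n, ∀ r ≤ min a a', y.1.lev k r = M := by
      intro k
      induction k with
      | zero => intro _ r hr; rw [h.fst_zero, h1' 1 hn r (by omega)]
      | succ k ih =>
        intro hk r hr
        have g := h.growth k hk (r - 1)
        rw [sub_add_cancel, ih (by omega) r (by omega), ih (by omega) (r - 1) (by omega),
          h1 _ hk r (by omega), h1 _ hk (r - 1) (by omega), h1 k (by omega) (r - 1) (by omega)] at g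
        omega
    exact ⟨this 0 hn.le r hr, this n le_rfl r hr⟩

theorem injective [NeZero n] (hx : x ∈ sstPairs n) (hx' : x' ∈ sstPairs n) (h : IsIota x y)
    (h' : IsIota x' y) : x = x' := by
  have e2 : ∀ k < n, x.2.lev (k + 1) = x'.2.lev (k + 1) := fun k hk => by
    rw [← h.snd_lt k hk, ← h'.snd_lt k hk]
  have e1 : ∀ j ≤ n, x.1.lev (n - j) = x'.1.lev (n - j) := by
    intro j
    induction j with
    | zero =>
      intro _
      rw [Nat.sub_zero, lev_last_eq hx, lev_last_eq hx']
      have := e2 (n - 1) (by have := NeZero.pos n; omega)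
      rwa [Nat.sub_add_cancel (NeZero.pos n)] at this
    | succ j ih =>
      intro hj
      have g := h.growth (n - (j + 1)) (by omega)
      have g' := h'.growth (n - (j + 1)) (by omega)
      rw [show n - (j + 1) + 1 = n - j by omega] at g g'
      rw [ih (by omega)] at g
      exact g.bot_unique g'
  have e1' : ∀ k ≤ n, x.1.lev k = x'.1.lev k := fun k hk => by
    have := e1 (n - k) (Nat.sub_le _ _)
    rwa [Nat.sub_sub_self hk] at this
  refine Prod.ext (ext_of_lev hx.1.rowSorted hx'.1.rowSorted e1')
    (ext_of_lev hx.2.1.rowSorted hx'.2.1.rowSorted fun k hk => ?_)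
  cases k with
  | zero => rw [← lev_zero_eq hx, ← lev_zero_eq hx', e1' 0 (Nat.zero_le _)]
  | succ k => exact e2 k hk

end IsIota

/-- The level functions of the first tableau of a preimage under `ι₂`, from the last one down to
the first one. -/
def iotaInvLev (n : ℕ) (y : SkewFilling n × SkewFilling n) : ℕ → ℤ → ℕ
  | 0 => y.2.lev (n - 1)
  | j + 1 => fun i => max (iotaInvLev n y j (i + 1)) (y.1.lev (n - (j + 1)) (i + 1)) +
      min (iotaInvLev n y j i) (y.1.lev (n - (j + 1)) i) - y.1.lev (n - j) (i + 1)

/-- Running the local rule backwards through the chain, starting from the last level, produces a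
preimage under `ι₂`. -/
theorem exists_isIota [NeZero n] {y : SkewFilling n × SkewFilling n} (hy : y ∈ sstPairs n) :
    ∃ x ∈ sstPairs n, IsIota x y := by
  have hn := NeZero.pos n
  set M := iotaInvLev n y with hM
  have hstrip : ∀ j ≤ n, IsStrip (M j) (y.1.lev (n - j)) ∧
      ∀ i < j, IsGrowth (M (i + 1)) (M i) (y.1.lev (n - (i + 1))) (y.1.lev (n - i)) := by
    intro j
    induction j with
    | zero =>
      intro _
      have := hy.2.1.isStrip (show n - 1 < n by omega)
      rw [Nat.sub_add_cancel hn, ← lev_last_eq hy] at this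
      exact ⟨this, fun i hi => absurd hi (Nat.not_lt_zero i)⟩
    | succ j ih =>
      intro hj
      obtain ⟨ih1, ih2⟩ := ih (by omega)
      have s := hy.1.isStrip (show n - (j + 1) < n by omega)
      rw [show n - (j + 1) + 1 = n - j by omega] at s
      have g : IsGrowth (M (j + 1)) (M j) (y.1.lev (n - (j + 1))) (y.1.lev (n - j)) := by
        intro i
        have a2 := ih1 i
        have b2 := s i
        simp only [hM, iotaInvLev] at a2 ⊢
        omega
      refine ⟨g.symm.isStrip_bot s ih1, fun i hi => ?_⟩
      rcases (Nat.lt_succ_iff.1 hi).eq_or_lt with rfl | hi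
      · exact g
      · exact ih2 i hi
  set L : ℕ → ℤ → ℕ := fun k => M (n - k) with hL
  set K : ℕ → ℤ → ℕ := fun k => if k = 0 then L 0 else y.2.lev (k - 1) with hK
  have growth : ∀ k < n, IsGrowth (L k) (L (k + 1)) (y.1.lev k) (y.1.lev (k + 1)) := by
    intro k hk
    have := (hstrip n le_rfl).2 (n - (k + 1)) (by omega)
    rwa [show n - (k + 1) + 1 = n - k by omega, show n - (n - k) = k by omega,
      show n - (n - (k + 1)) = k + 1 by omega] at this
  have strip : ∀ k ≤ n, IsStrip (L k) (y.1.lev k) := by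
    intro k hk
    have := (hstrip (n - k) (by omega)).1
    rwa [show n - (n - k) = k by omega] at this
  have stripL : ∀ k < n, IsStrip (L k) (L (k + 1)) := fun k hk =>
    (growth k hk).isStrip_bot (strip (k + 1) hk) (hy.1.isStrip hk)
  have stripK : ∀ k < n, IsStrip (K k) (K (k + 1)) := by
    intro k hk
    cases k with
    | zero =>
      have := strip 0 hn.le
      rw [lev_zero_eq hy] at this
      simpa [hK] using this
    | succ k =>
      simpa [hK] using hy.2.1.isStrip (show k < n by omega)
  have hLn : L n = y.2.lev (n - 1) := by simp [hL, hM, iotaInvLev]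
  have levL : ∀ k ≤ n, (ofLev n L).lev k = L k := fun k hk =>
    lev_ofLev (fun k hk r => (stripL k hk r).1) hk
  have levK : ∀ k ≤ n, (ofLev n K).lev k = K k := fun k hk =>
    lev_ofLev (fun k hk r => (stripK k hk r).1) hk
  refine ⟨(ofLev n L, ofLev n K), ?_, ?_⟩
  · refine mem_sstPairs_of_lev (rowSorted_ofLev L) (rowSorted_ofLev K) ?_ ?_ ?_ ?_ ?_ ?_
    · intro k hk
      rw [levL k hk.le, levL (k + 1) hk]
      exact stripL k hk
    · intro k hk
      rw [levK k hk.le, levK (k + 1) hk]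
      exact stripK k hk
    · rw [levL 0 hn.le, levK 0 hn.le]; simp [hK]
    · rw [levL n le_rfl, levK n le_rfl, hLn]; simp [hK, hn.ne']
    · obtain ⟨a, b, M', h1, h2⟩ := hy.1.lev_bounds
      refine ⟨b, fun r hr => ?_⟩
      rw [levL n le_rfl]
      have := strip n le_rfl r
      rw [h2 n le_rfl r hr] at this
      omega
    · obtain ⟨a, b, M', h1, h2⟩ := hy.1.lev_bounds
      refine ⟨a - 1, M', fun r hr => ?_⟩
      rw [levL n le_rfl, levL 0 hn.le]
      have t1 := strip n le_rfl r
      have t2 := strip 0 hn.le r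
      rw [h1 _ le_rfl r (by omega), h1 _ le_rfl (r + 1) (by omega)] at t1
      rw [h1 _ hn.le r (by omega), h1 _ hn.le (r + 1) (by omega)] at t2
      omega
  · refine ⟨hy.1.rowSorted, hy.2.1.rowSorted, ?_, fun k hk => ?_, fun k hk => ?_,
      (lev_last_eq hy).symm⟩
    · rw [levK 1 hn, lev_zero_eq hy]; simp [hK]
    · rw [levL k hk.le, levL (k + 1) hk]
      exact growth k hk
    · rw [levK (k + 1) hk]; simp [hK]

theorem isIota_iota₂ [NeZero n] {x : SkewFilling n × SkewFilling n} (hx : x ∈ sstPairs n) :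
    IsIota x (iota₂ x) := by
  have hn := NeZero.pos n
  obtain ⟨h0, hg⟩ := internalInserts_spec hx.1.rowSorted (x.2.pairwise_rowCoords 0)
  set P' := x.1.internalInserts (x.2.rowCoords 0) with hP'
  have e0 : P'.lev 0 = x.2.lev 1 := by
    funext r
    have := lev_succ x.2 0 r
    rw [Fin.val_zero, zero_add] at this
    rw [h0, hx.2.1.count_rowCoords, lev_zero_eq hx, this]
  have strip : ∀ k ≤ n, IsStrip (x.1.lev k) (P'.lev k) := by
    intro k
    induction k with
    | zero => intro _; rw [e0, lev_zero_eq hx]; exact hx.2.1.isStrip hn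
    | succ k ih => intro hk; exact (hg k hk).isStrip_top (hx.1.isStrip hk) (ih (by omega))
  have hv : ∀ k, x.2.vacateOnes.lev k = x.2.lev (k + 1) := fun k => by
    funext r; exact lev_vacateOnes _ k r
  have hlast := val_zero_sub_one (n := n)
  have hout : ∀ r, x.2.vacateOnes.outer r = x.2.lev n r := by
    intro r
    have h1 := lev_succ x.2 ⟨n - 1, by omega⟩ r
    have h2 := (x.2.vacateOnes).lev_last
    rw [hv] at h2
    rw [← h2]
    have h3 : ∀ (T : SkewFilling n) r, T.lev (n + 1) r = T.lev n r := by
      intro T r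
      unfold lev
      congr 2
      funext z
      simp only [decide_eq_decide]
      omega
    exact h3 _ _
  refine ⟨rowSorted_internalInserts hx.1.rowSorted _, ?_, e0, hg, ?_, ?_⟩
  · refine rowSorted_extend (rowSorted_vacateOnes hx.2.1.rowSorted) ?_ _
    rw [hlast]
  · intro k hk
    funext r
    simp only [iota₂]
    rw [lev_extend, if_neg (by omega), hv, add_zero]
  · funext r
    simp only [iota₂]
    rw [lev_extend, if_pos (by omega), hout, lev_last, hout, ← hP', ← lev_last]
    have := (strip n le_rfl r).1
    rw [lev_last_eq hx] at this
    omega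

theorem iota₂_eq [NeZero n] {x y : SkewFilling n × SkewFilling n} (hx : x ∈ sstPairs n)
    (h : IsIota x y) : iota₂ x = y :=
  (isIota_iota₂ hx).unique h

theorem iota₂_mem [NeZero n] {x : SkewFilling n × SkewFilling n} (hx : x ∈ sstPairs n) :
    iota₂ x ∈ sstPairs n :=
  (isIota_iota₂ hx).mem hx

theorem iota₁_mem [NeZero n] {x : SkewFilling n × SkewFilling n} (hx : x ∈ sstPairs n) :
    iota₁ x ∈ sstPairs n :=
  swap_mem (iota₂_mem (swap_mem hx))

theorem bijOn_iota₂ (n : ℕ) [NeZero n] : Set.BijOn iota₂ (sstPairs n) (sstPairs n) := by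
  refine ⟨fun x hx => iota₂_mem hx, fun x hx x' hx' h => ?_, fun y hy => ?_⟩
  · have := isIota_iota₂ hx'
    rw [← h] at this
    exact IsIota.injective hx hx' (isIota_iota₂ hx) this
  · obtain ⟨x, hx, h⟩ := exists_isIota hy
    exact ⟨x, hx, iota₂_eq hx h⟩

theorem bijOn_iota₁ (n : ℕ) [NeZero n] : Set.BijOn iota₁ (sstPairs n) (sstPairs n) := by
  have hs : Set.BijOn Prod.swap (sstPairs n) (sstPairs n) :=
    ⟨fun x hx => swap_mem hx, Prod.swap_injective.injOn, fun x hx => ⟨x.swap, swap_mem hx, by simp⟩⟩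
  exact hs.comp ((bijOn_iota₂ n).comp hs)

/-! ### Commutation of the two cyclings, and the skew RSK map -/

theorem isIota_iota₁ [NeZero n] {x : SkewFilling n × SkewFilling n} (hx : x ∈ sstPairs n) :
    IsIota x.swap (iota₁ x).swap := by
  rw [iota₁, Prod.swap_swap]
  exact isIota_iota₂ (swap_mem hx)

/-- Both composites compute the corner of the same growth diagram. -/
theorem iota_comm [NeZero n] {x : SkewFilling n × SkewFilling n} (hx : x ∈ sstPairs n) :
    iota₁ (iota₂ x) = iota₂ (iota₁ x) := by
  have hn := NeZero.pos n
  have y := isIota_iota₂ hx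
  have z := isIota_iota₁ (iota₂_mem hx)
  have y' := isIota_iota₁ hx
  have z' := isIota_iota₂ (iota₁_mem hx)
  have hx0 := lev_zero_eq hx
  have hxn := lev_last_eq hx
  set Y := iota₂ x
  set Y' := iota₁ x
  set Z := iota₁ Y
  set Z' := iota₂ Y'
  have y'0 : Y'.2.lev 0 = x.1.lev 1 := y'.fst_zero
  have y'g : ∀ k < n, IsGrowth (x.2.lev k) (x.2.lev (k + 1)) (Y'.2.lev k) (Y'.2.lev (k + 1)) :=
    y'.growth
  have y's : ∀ k < n, Y'.1.lev k = x.1.lev (k + 1) := y'.snd_lt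
  have y'n : Y'.1.lev n = Y'.2.lev n := y'.snd_last
  have z0 : Z.2.lev 0 = Y.1.lev 1 := z.fst_zero
  have zg : ∀ k < n, IsGrowth (Y.2.lev k) (Y.2.lev (k + 1)) (Z.2.lev k) (Z.2.lev (k + 1)) :=
    z.growth
  have zs : ∀ k < n, Z.1.lev k = Y.1.lev (k + 1) := z.snd_lt
  have zn : Z.1.lev n = Z.2.lev n := z.snd_last
  -- All new shapes are fourth corners of the diagram spanned by the chains of `x.1` and `x.2`.
  have a1 : ∀ k < n, Z.2.lev k = Y'.2.lev (k + 1) := by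
    intro k
    induction k with
    | zero =>
      intro _
      have g1 := y.growth 0 hn
      have g2 := y'g 0 hn
      rw [hx0, y.fst_zero] at g1
      rw [y'0] at g2
      rw [z0]
      exact g1.top_unique g2.symm
    | succ k ih =>
      intro hk
      have g1 := zg k (by omega)
      have g2 := y'g (k + 1) hk
      rw [ih (by omega), y.snd_lt k (by omega), y.snd_lt (k + 1) hk] at g1
      exact g1.top_unique g2
  have a2 : ∀ k < n, Z'.1.lev k = Y.1.lev (k + 1) := by
    intro k
    induction k with
    | zero =>
      intro _
      have g1 := y.growth 0 hn
      have g2 := y'g 0 hn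
      rw [hx0, y.fst_zero] at g1
      rw [y'0] at g2
      rw [z'.fst_zero]
      exact g2.top_unique g1.symm
    | succ k ih =>
      intro hk
      have g1 := z'.growth k (by omega)
      have g2 := y.growth (k + 1) hk
      rw [ih (by omega), y's k (by omega), y's (k + 1) hk] at g1
      exact g1.top_unique g2
  have a3 : Z.2.lev n = Z'.1.lev n := by
    have g1 := zg (n - 1) (by omega)
    have g2 := z'.growth (n - 1) (by omega)
    rw [a1 _ (by omega), y.snd_lt _ (by omega), Nat.sub_add_cancel hn, y.snd_last] at g1
    rw [a2 _ (by omega), y's _ (by omega), Nat.sub_add_cancel hn, y'n, hxn] at g2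
    exact g1.top_unique g2.symm
  refine Prod.ext (ext_of_lev z.sorted_snd z'.sorted_fst fun k hk => ?_)
    (ext_of_lev z.sorted_fst z'.sorted_snd fun k hk => ?_)
  · rcases hk.eq_or_lt with rfl | hk
    · rw [zn, a3]
    · rw [zs k hk, a2 k hk]
  · rcases hk.eq_or_lt with rfl | hk
    · rw [z'.snd_last, a3]
    · rw [z'.snd_lt k hk]; exact a1 k hk

theorem iterate_iota₂_mem [NeZero n] {x : SkewFilling n × SkewFilling n} (hx : x ∈ sstPairs n)
    (j : ℕ) : iota₂^[j] x ∈ sstPairs n := by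
  induction j with
  | zero => exact hx
  | succ j ih => rw [Function.iterate_succ_apply']; exact iota₂_mem ih

/-- After `j ≤ n` cyclings the second chain consists of the last `n - j` strips of the original one
and of `j` strips that have come out. -/
theorem lev_iterate_iota₂_snd [NeZero n] {x : SkewFilling n × SkewFilling n}
    (hx : x ∈ sstPairs n) {j : ℕ} (hj : j ≤ n) :
    (∀ k ≤ n - j, (iota₂^[j] x).2.lev k = x.2.lev (k + j)) ∧
    ∀ k ≤ j, (iota₂^[j] x).2.lev (n - j + k) = (iota₂^[k] x).1.lev n := by
  induction j with
  | zero =>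
    refine ⟨fun k _ => rfl, fun k hk => ?_⟩
    obtain rfl : k = 0 := by omega
    exact (lev_last_eq hx).symm
  | succ j ih =>
    obtain ⟨ih1, ih2⟩ := ih (by omega)
    have h := isIota_iota₂ (iterate_iota₂_mem hx j)
    rw [← Function.iterate_succ_apply' (f := iota₂)] at h
    refine ⟨fun k hk => ?_, fun k hk => ?_⟩
    · rw [h.snd_lt k (by omega), ih1 _ (by omega)]
      congr 1; omega
    · rcases hk.eq_or_lt with rfl | hk
      · rw [show n - (j + 1) + (j + 1) = n by omega, h.snd_last]
      · rw [h.snd_lt _ (by omega), show n - (j + 1) + k + 1 = n - j + k by omega,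
          ih2 k (by omega)]

theorem rowCoords_congr {T T' : SkewFilling n} (hT : T.IsSemistandard) (hT' : T'.IsSemistandard)
    {j j' : Fin n} (h : ∀ r, (T.row r).count j = (T'.row r).count j') :
    T.rowCoords j = T'.rowCoords j' := by
  refine List.Perm.eq_of_pairwise (fun a b _ _ h1 h2 => le_antisymm h2 h1)
    (T.pairwise_rowCoords j) (T'.pairwise_rowCoords j') ?_
  rw [List.perm_iff_count]
  intro r
  rw [hT.count_rowCoords, hT'.count_rowCoords, h]

/-- The `j`-th step of the skew RSK map is a cycling step, because after `j - 1` cyclings the first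
strip of the second tableau is the original strip of the letter `j`. -/
theorem skewRSK_eq_iterate_iota₂ [NeZero n] {x : SkewFilling n × SkewFilling n}
    (hx : x ∈ sstPairs n) : skewRSK x = iota₂^[n] x := by
  -- After `j` steps the new second tableau consists of the last `j` strips of the cycled one.
  have key : ∀ j ≤ n, ∀ S, S = ((List.finRange n).take j).foldl (skewRSKStep x.2)
      (x.1, emptyOf n x.1.outer) →
      S.1 = (iota₂^[j] x).1 ∧ S.2.RowSorted ∧
      (∀ k ≤ j, S.2.lev k = (iota₂^[j] x).2.lev (n - j + k)) ∧
      (∀ k, j ≤ k → k ≤ n → S.2.lev k = (iota₂^[j] x).1.lev n) := by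
    intro j
    induction j with
    | zero =>
      rintro _ S rfl
      refine ⟨rfl, fun r => List.Pairwise.nil, fun k hk => ?_, fun k _ _ => ?_⟩
      · obtain rfl : k = 0 := by omega
        rw [Function.iterate_zero, id, Nat.sub_zero, add_zero, ← lev_last_eq hx, lev_last]
        simp [lev_zero, emptyOf]
      · rw [Function.iterate_zero, id, lev_last]
        funext r
        simp [lev, emptyOf]
    | succ j ih =>
      rintro hj S' rfl
      have hj' : j < n := hj
      have htake : (List.finRange n).take (j + 1) = (List.finRange n).take j ++ [⟨j, hj'⟩] := by
        rw [List.take_add_one]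
        simp [hj']
      rw [htake, List.foldl_append, List.foldl_cons, List.foldl_nil]
      obtain ⟨h1, h2, h3, h4⟩ := ih hj'.le _ rfl
      set S := ((List.finRange n).take j).foldl (skewRSKStep x.2) (x.1, emptyOf n x.1.outer)
      have hz := iterate_iota₂_mem hx j
      obtain ⟨l1, l2⟩ := lev_iterate_iota₂_snd hx hj'.le
      have hi := isIota_iota₂ hz
      have hstrip := hi.isStrip hz le_rfl
      rw [Function.iterate_succ_apply']
      set z := iota₂^[j] x
      have hrows : x.2.rowCoords ⟨j, hj'⟩ = z.2.rowCoords 0 := by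
        refine rowCoords_congr hx.2.1 hz.2.1 fun r => ?_
        rw [count_row, count_row, Fin.val_zero, zero_add, l1 1 (by omega), l1 0 (by omega),
          add_comm 1 j, zero_add]
      have hP : S.1.internalInserts (x.2.rowCoords ⟨j, hj'⟩) = (iota₂ z).1 := by
        rw [h1, hrows]; rfl
      have hout : S.2.outer = z.1.lev n := by rw [← lev_last, h4 n hj'.le le_rfl]
      simp only [skewRSKStep, hP]
      refine ⟨trivial, rowSorted_extend h2 ?_ _, fun k hk => ?_, fun k hk hkn => ?_⟩
      · rw [h4 _ (Nat.le_succ j) hj, h4 n hj'.le le_rfl]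
      · funext r
        rw [lev_extend]
        rcases hk.eq_or_lt with rfl | hk
        · rw [if_pos (by simp), hout, h4 _ (Nat.le_succ j) hj, ← lev_last,
            show n - (j + 1) + (j + 1) = n by omega, hi.snd_last]
          have := (hstrip r).1
          omega
        · rw [if_neg (by simp only; omega), h3 k (by omega), hi.snd_lt _ (by omega),
            show n - (j + 1) + k + 1 = n - j + k by omega, add_zero]
      · funext r
        rw [lev_extend, if_pos (by simp only; omega), hout, h4 k (by omega) hkn, ← lev_last]
        have := (hstrip r).1
        omega
  have htake : (List.finRange n).take n = List.finRange n := by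
    rw [List.take_of_length_le]; simp
  obtain ⟨h1, h2, h3, -⟩ := key n le_rfl _ rfl
  rw [htake] at h1 h2 h3
  refine Prod.ext h1 (ext_of_lev h2 (iterate_iota₂_mem hx n).2.1.rowSorted fun k hk => ?_)
  have := h3 k hk
  rwa [Nat.sub_self, zero_add] at this

theorem iterate_iota₁ (x : SkewFilling n × SkewFilling n) [NeZero n] (j : ℕ) :
    iota₁^[j] x = (iota₂^[j] x.swap).swap := by
  induction j with
  | zero => simp
  | succ j ih => rw [Function.iterate_succ_apply', Function.iterate_succ_apply', ih, iota₁,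
      Prod.swap_swap]

/-- The `n`-th iterates of both cyclings read off the same `n × n` growth diagram. -/
theorem iterate_iota_eq [NeZero n] {x : SkewFilling n × SkewFilling n} (hx : x ∈ sstPairs n) :
    iota₂^[n] x = iota₁^[n] x := by
  have hx' := swap_mem hx
  -- The diagram of the cyclings `ι₁` is the transpose of that of the cyclings `ι₂`.
  have grid : ∀ j ≤ n, ∀ k ≤ n, (iota₂^[j] x).1.lev k = (iota₂^[k] x.swap).1.lev j := by
    intro j
    induction j with
    | zero =>
      intro _ k hk
      rw [lev_zero_eq (iterate_iota₂_mem hx' k), (lev_iterate_iota₂_snd hx' hk).1 0 (Nat.zero_le _),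
        zero_add]
      rfl
    | succ j ihj =>
      intro hj k
      induction k with
      | zero =>
        intro _
        rw [lev_zero_eq (iterate_iota₂_mem hx (j + 1)),
          (lev_iterate_iota₂_snd hx hj).1 0 (Nat.zero_le _), zero_add]
        rfl
      | succ k ihk =>
        intro hk
        have g1 := (isIota_iota₂ (iterate_iota₂_mem hx j)).growth k hk
        have g2 := (isIota_iota₂ (iterate_iota₂_mem hx' k)).growth j hj
        rw [← Function.iterate_succ_apply' (f := iota₂)] at g1 g2
        rw [ihj (by omega) k (by omega), ihj (by omega) (k + 1) hk, ihk (by omega)] at g1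
        exact g1.top_unique g2.symm
  have hm := iterate_iota₂_mem hx n
  have hm' := iterate_iota₂_mem hx' n
  have e := (lev_iterate_iota₂_snd hx le_rfl).2
  have e' := (lev_iterate_iota₂_snd hx' le_rfl).2
  simp only [Nat.sub_self, zero_add] at e e'
  rw [iterate_iota₁]
  refine Prod.ext (ext_of_lev hm.1.rowSorted hm'.2.1.rowSorted fun k hk => ?_)
    (ext_of_lev hm.2.1.rowSorted hm'.1.rowSorted fun k hk => ?_)
  · rw [Prod.fst_swap, e' k hk, grid n le_rfl k hk]
  · rw [Prod.snd_swap, e k hk, grid k hk n le_rfl]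

theorem skewRSK_eq_iterate_iota₁ [NeZero n] {x : SkewFilling n × SkewFilling n}
    (hx : x ∈ sstPairs n) : skewRSK x = iota₁^[n] x := by
  rw [skewRSK_eq_iterate_iota₂ hx, iterate_iota_eq hx]

end Cycling

/-! ### Words and their unmatched parentheses -/

theorem lt_length_of_getElem? {A : Type*} {w : List A} {p : ℕ} {x : A} (h : w[p]? = some x) :
    p < w.length :=
  (List.getElem?_eq_some_iff.1 h).1

theorem set_eq_self_of_getElem? {A : Type*} {w : List A} {p : ℕ} {x : A} (h : w[p]? = some x) :
    w.set p x = w := by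
  obtain ⟨hlt, rfl⟩ := List.getElem?_eq_some_iff.1 h
  exact List.set_getElem_self hlt

section Words

variable {A : Type*} [DecidableEq A] {a b : A}

/-- The weight of a letter: `b` is an opening and `a` a closing parenthesis. -/
def parenWeight (a b x : A) : ℤ := (if x = b then 1 else 0) - (if x = a then 1 else 0)

/-- The excess of opening over closing parentheses in the word from position `q` on. -/
def sufSum (a b : A) (w : List A) (q : ℕ) : ℤ := ((w.drop q).map (parenWeight a b)).sum

/-- The number of unmatched closing parentheses. -/
def closeCount (a b : A) : List A → ℕ
  | [] => 0
  | x :: w => if x = a then closeCount a b w + 1 else if x = b then closeCount a b w - 1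
    else closeCount a b w

/-- The positions of the unmatched opening parentheses, the rightmost one first, for a word whose
first letter has position `pos`. -/
def openPos (a b : A) : List A → ℕ → List ℕ
  | [], _ => []
  | x :: w, pos => openPos a b w (pos + 1) ++
    if x ≠ a ∧ x = b ∧ closeCount a b w = 0 then [pos] else []

/-- The positions of the closing parentheses that remain unmatched when the word is preceded by `m`
opening ones, the rightmost one first. -/
def closePos (a b : A) : List A → ℕ → ℕ → List ℕ
  | [], _, _ => []
  | x :: w, pos, m =>
    if x = a then
      match m with
      | 0 => closePos a b w (pos + 1) 0 ++ [pos]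
      | m + 1 => closePos a b w (pos + 1) m
    else if x = b then closePos a b w (pos + 1) (m + 1)
    else closePos a b w (pos + 1) m

theorem matchParens_snd (w : List A) (pos : ℕ) (cl op : List ℕ) :
    (matchParens a b w pos cl op).2 = openPos a b w pos ++ op.drop (closeCount a b w) := by
  induction w generalizing pos cl op with
  | nil => simp [matchParens, openPos, closeCount]
  | cons x w ih =>
    by_cases hxa : x = a
    · cases op with
      | nil => simp [matchParens, openPos, hxa, ih]
      | cons o op => simp [matchParens, openPos, closeCount, hxa, ih]
    · by_cases hxb : x = b
      · rcases Nat.eq_zero_or_pos (closeCount a b w) with hk | hk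
        · simp only [matchParens, if_neg hxa, if_pos hxb, ih, openPos, closeCount]
          rw [if_pos ⟨hxa, hxb, hk⟩, hk]
          simp
        · obtain ⟨k, hk⟩ := Nat.exists_eq_succ_of_ne_zero hk.ne'
          simp only [matchParens, if_neg hxa, if_pos hxb, ih, openPos, closeCount, hk]
          simp
      · simp [matchParens, openPos, closeCount, hxa, hxb, ih]

theorem matchParens_fst (w : List A) (pos : ℕ) (cl op : List ℕ) :
    (matchParens a b w pos cl op).1 = closePos a b w pos op.length ++ cl := by
  induction w generalizing pos cl op with
  | nil => simp [matchParens, closePos]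
  | cons x w ih =>
    by_cases hxa : x = a
    · cases op with
      | nil => simp [matchParens, closePos, hxa, ih]
      | cons o op => simp [matchParens, closePos, hxa, ih]
    · by_cases hxb : x = b
      · simp only [matchParens, if_neg hxa, if_pos hxb, ih, closePos, List.length_cons]
      · simp [matchParens, closePos, hxa, hxb, ih]

theorem sufSum_nil (q : ℕ) : sufSum a b [] q = 0 := by simp [sufSum]

theorem sufSum_cons_zero (x : A) (w : List A) :
    sufSum a b (x :: w) 0 = parenWeight a b x + sufSum a b w 0 := by simp [sufSum]

theorem sufSum_cons_succ (x : A) (w : List A) (q : ℕ) :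
    sufSum a b (x :: w) (q + 1) = sufSum a b w q := by simp [sufSum]

theorem sufSum_of_le {w : List A} {q : ℕ} (h : w.length ≤ q) : sufSum a b w q = 0 := by
  simp [sufSum, List.drop_eq_nil_of_le h]

theorem sufSum_zero (w : List A) : sufSum a b w 0 = (w.count b : ℤ) - w.count a := by
  induction w with
  | nil => simp [sufSum]
  | cons x w ih =>
    rw [sufSum_cons_zero, ih, List.count_cons, List.count_cons, parenWeight]
    simp only [beq_iff_eq]
    push_cast
    ring

theorem sufSum_succ {w : List A} {q : ℕ} {x : A} (h : w[q]? = some x) :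
    sufSum a b w q = parenWeight a b x + sufSum a b w (q + 1) := by
  induction w generalizing q with
  | nil => simp at h
  | cons y w ih =>
    cases q with
    | zero =>
      simp only [List.getElem?_cons_zero, Option.some.injEq] at h
      rw [sufSum_cons_zero, sufSum_cons_succ, h]
    | succ q => rw [sufSum_cons_succ, sufSum_cons_succ, ih (by simpa using h)]

theorem sufSum_set {w : List A} {p : ℕ} {x : A} (h : w[p]? = some x) (y : A) (q : ℕ) :
    sufSum a b (w.set p y) q =
      sufSum a b w q + if q ≤ p then parenWeight a b y - parenWeight a b x else 0 := by
  induction w generalizing p q with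
  | nil => simp at h
  | cons z w ih =>
    cases p with
    | zero =>
      simp only [List.getElem?_cons_zero, Option.some.injEq] at h
      subst h
      cases q with
      | zero => simp only [List.set_cons_zero, sufSum_cons_zero, le_refl, if_true]; ring
      | succ q => simp [sufSum_cons_succ]
    | succ p =>
      have h' : w[p]? = some x := by simpa using h
      cases q with
      | zero =>
        simp only [List.set_cons_succ, sufSum_cons_zero, ih h', Nat.zero_le, if_true]; ring
      | succ q => simp [sufSum_cons_succ, ih h']

/-- The suffix that starts at the leftmost unmatched opening parenthesis has the largest excess, and
all shorter suffixes have a smaller one. -/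
theorem openPos_spec (hab : a ≠ b) (w : List A) (pos : ℕ) :
    sufSum a b w 0 = ((openPos a b w pos).length : ℤ) - closeCount a b w ∧
    (∀ q, sufSum a b w q ≤ (openPos a b w pos).length) ∧
    (openPos a b w pos = [] ∨ ∃ p, (openPos a b w pos).getLast? = some (pos + p) ∧
      w[p]? = some b ∧ sufSum a b w p = (openPos a b w pos).length ∧
      ∀ q, p < q → sufSum a b w q < (openPos a b w pos).length) := by
  induction w generalizing pos with
  | nil => simp [openPos, closeCount, sufSum_nil]
  | cons x w ih =>
    obtain ⟨h1, h2, h3⟩ := ih (pos + 1)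
    have hu : (openPos a b w (pos + 1)).length ≥ 0 := Nat.zero_le _
    have hw : parenWeight a b x = if x = a then -1 else if x = b then 1 else 0 := by
      unfold parenWeight
      by_cases hxa : x = a
      · subst hxa; simp [hab]
      · simp [hxa]
    by_cases hc : x ≠ a ∧ x = b ∧ closeCount a b w = 0
    · have hlen : (openPos a b (x :: w) pos).length = (openPos a b w (pos + 1)).length + 1 := by
        simp only [openPos]
        rw [if_pos hc]
        simp
      obtain ⟨hxa, hxb, hk⟩ := hc
      rw [if_neg hxa, if_pos hxb] at hw
      have hk' : closeCount a b (x :: w) = 0 := by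
        rw [closeCount, if_neg hxa, if_pos hxb, hk]
      rw [hlen, hk', sufSum_cons_zero, hw, h1, hk]
      refine ⟨by push_cast; ring, ?_, Or.inr ⟨0, ?_, ?_, ?_, ?_⟩⟩
      · intro q
        cases q with
        | zero => rw [sufSum_cons_zero, hw, h1, hk]; push_cast; omega
        | succ q => rw [sufSum_cons_succ]; have := h2 q; push_cast; omega
      · simp only [openPos]
        rw [if_pos ⟨hxa, hxb, hk⟩, List.getLast?_concat, add_zero]
      · simp [hxb]
      · rw [sufSum_cons_zero, hw, h1, hk]; push_cast; omega
      · intro q hq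
        obtain ⟨q, rfl⟩ := Nat.exists_eq_succ_of_ne_zero hq.ne'
        rw [Nat.succ_eq_add_one, sufSum_cons_succ]
        have := h2 q
        push_cast; omega
    · have hop : openPos a b (x :: w) pos = openPos a b w (pos + 1) := by
        simp only [openPos, if_neg hc, List.append_nil]
      have h0 : sufSum a b (x :: w) 0 =
          ((openPos a b w (pos + 1)).length : ℤ) - closeCount a b (x :: w) := by
        rw [sufSum_cons_zero, hw, h1, closeCount]
        by_cases hxa : x = a
        · simp only [if_pos hxa]; push_cast; ring
        · by_cases hxb : x = b
          · simp only [if_neg hxa, if_pos hxb]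
            have : closeCount a b w ≠ 0 := fun h => hc ⟨hxa, hxb, h⟩
            omega
          · simp only [if_neg hxa, if_neg hxb]; ring
      rw [hop]
      refine ⟨h0, ?_, ?_⟩
      · intro q
        cases q with
        | zero => rw [h0]; omega
        | succ q => rw [sufSum_cons_succ]; exact h2 q
      · rcases h3 with h3 | ⟨p, e1, e2, e3, e4⟩
        · exact Or.inl h3
        · refine Or.inr ⟨p + 1, by rw [e1]; congr 1; omega, by simpa using e2,
            by rw [sufSum_cons_succ, e3], ?_⟩
          intro q hq
          obtain ⟨q, rfl⟩ := Nat.exists_eq_succ_of_ne_zero (Nat.ne_zero_of_lt hq)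
          rw [Nat.succ_eq_add_one, sufSum_cons_succ]
          exact e4 q (by omega)

/-- Position `p` carries the leftmost unmatched opening parenthesis. -/
def IsRaisePos (a b : A) (w : List A) (p : ℕ) : Prop :=
  w[p]? = some b ∧ 1 ≤ sufSum a b w p ∧ (∀ q < p, sufSum a b w q ≤ sufSum a b w p) ∧
    ∀ q, p < q → sufSum a b w q < sufSum a b w p

/-- Position `p` carries the rightmost unmatched closing parenthesis. -/
def IsLowerPos (a b : A) (w : List A) (p : ℕ) : Prop :=
  w[p]? = some a ∧ (∀ q ≤ p, sufSum a b w q < sufSum a b w (p + 1)) ∧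
    ∀ q, p < q → sufSum a b w q ≤ sufSum a b w (p + 1)

theorem IsRaisePos.unique {w : List A} {p q : ℕ} (hp : IsRaisePos a b w p)
    (hq : IsRaisePos a b w q) : p = q := by
  rcases lt_trichotomy p q with h | h | h
  · have := hp.2.2.2 q h
    have := hq.2.2.1 p h
    omega
  · exact h
  · have := hp.2.2.1 q h
    have := hq.2.2.2 p h
    omega

theorem IsLowerPos.unique {w : List A} {p q : ℕ} (hp : IsLowerPos a b w p)
    (hq : IsLowerPos a b w q) : p = q := by
  rcases lt_trichotomy p q with h | h | h
  · have := hp.2.2 (q + 1) (by omega)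
    have := hq.2.1 (p + 1) (by omega)
    omega
  · exact h
  · have := hp.2.1 (q + 1) (by omega)
    have := hq.2.2 (p + 1) (by omega)
    omega

theorem closePos_spec (hab : a ≠ b) (w : List A) (pos m : ℕ) :
    ((closePos a b w pos m = [] ∧ ∀ q, sufSum a b w q ≤ sufSum a b w 0 + m) ∨
      ∃ p, (closePos a b w pos m).head? = some (pos + p) ∧ IsLowerPos a b w p ∧
        sufSum a b w 0 + m < sufSum a b w (p + 1)) := by
  have succ_iff : ∀ (x : A) (w : List A) (p : ℕ), IsLowerPos a b w p →
      sufSum a b (x :: w) 0 < sufSum a b w (p + 1) → IsLowerPos a b (x :: w) (p + 1) := by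
    rintro x w p ⟨h1, h2, h3⟩ h0
    refine ⟨by simpa using h1, fun q hq => ?_, fun q hq => ?_⟩
    · cases q with
      | zero => rw [sufSum_cons_succ]; exact h0
      | succ q => rw [sufSum_cons_succ, sufSum_cons_succ]; exact h2 q (by omega)
    · obtain ⟨q, rfl⟩ := Nat.exists_eq_succ_of_ne_zero (Nat.ne_zero_of_lt hq)
      rw [Nat.succ_eq_add_one, sufSum_cons_succ, sufSum_cons_succ]; exact h3 q (by omega)
  induction w generalizing pos m with
  | nil => left; simp [closePos, sufSum_nil]
  | cons x w ih =>
    have hw : parenWeight a b x = if x = a then -1 else if x = b then 1 else 0 := by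
      unfold parenWeight
      by_cases hxa : x = a
      · subst hxa; simp [hab]
      · simp [hxa]
    have h0 := sufSum_cons_zero (a := a) (b := b) x w
    -- The letter `x` only changes the number of available opening parentheses from `m` to `m'`.
    have step : ∀ m' : ℕ, closePos a b (x :: w) pos m = closePos a b w (pos + 1) m' →
        (m' : ℤ) = m + parenWeight a b x →
        ((closePos a b (x :: w) pos m = [] ∧
          ∀ q, sufSum a b (x :: w) q ≤ sufSum a b (x :: w) 0 + m) ∨
        ∃ p, (closePos a b (x :: w) pos m).head? = some (pos + p) ∧ IsLowerPos a b (x :: w) p ∧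
          sufSum a b (x :: w) 0 + m < sufSum a b (x :: w) (p + 1)) := by
      intro m' e hm
      rw [e]
      rcases ih (pos + 1) m' with ⟨h1, h2⟩ | ⟨p, h1, h2, h3⟩
      · refine Or.inl ⟨h1, fun q => ?_⟩
        cases q with
        | zero => omega
        | succ q => rw [sufSum_cons_succ]; have := h2 q; omega
      · refine Or.inr ⟨p + 1, by rw [h1]; congr 1; omega, succ_iff x w p h2 (by omega), ?_⟩
        rw [sufSum_cons_succ]
        omega
    by_cases hxa : x = a
    · rw [if_pos hxa] at hw
      cases m with
      | succ m =>
        refine step m (by simp [closePos, hxa]) ?_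
        rw [hw]; push_cast; ring
      | zero =>
        have e : closePos a b (x :: w) pos 0 = closePos a b w (pos + 1) 0 ++ [pos] := by
          simp [closePos, hxa]
        rw [e]
        rcases ih (pos + 1) 0 with ⟨h1, h2⟩ | ⟨p, h1, h2, h3⟩
        · refine Or.inr ⟨0, by simp [h1], ⟨by simp [hxa], fun q hq => ?_, fun q hq => ?_⟩, ?_⟩
          · obtain rfl : q = 0 := by omega
            rw [sufSum_cons_succ]
            omega
          · obtain ⟨q, rfl⟩ := Nat.exists_eq_succ_of_ne_zero hq.ne'
            rw [Nat.succ_eq_add_one, sufSum_cons_succ, sufSum_cons_succ]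
            have := h2 q
            omega
          · rw [sufSum_cons_succ]
            omega
        · refine Or.inr ⟨p + 1, ?_, succ_iff x w p h2 (by omega), ?_⟩
          · rw [List.head?_append, h1, Option.some_or]; congr 1; omega
          · rw [sufSum_cons_succ]
            omega
    · rw [if_neg hxa] at hw
      by_cases hxb : x = b
      · refine step (m + 1) (by simp only [closePos, if_neg hxa, if_pos hxb]) ?_
        rw [hw, if_pos hxb]; push_cast; ring
      · refine step m (by simp only [closePos, if_neg hxa, if_neg hxb]) ?_
        rw [hw, if_neg hxb]; ring

theorem wordRaise_cases (hab : a ≠ b) (w : List A) :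
    (wordRaise a b w = none ∧ ∀ q, sufSum a b w q ≤ 0) ∨
      ∃ p, IsRaisePos a b w p ∧ wordRaise a b w = some (w.set p a) := by
  obtain ⟨-, h2, h3⟩ := openPos_spec hab w 0
  have e : (matchParens a b w 0 [] []).2 = openPos a b w 0 := by simp [matchParens_snd]
  rcases h3 with h3 | ⟨p, e1, e2, e3, e4⟩
  · left
    rw [wordRaise, e, h3]
    rw [h3] at h2
    exact ⟨rfl, h2⟩
  · right
    have hpos : 0 < (openPos a b w 0).length := by
      refine List.length_pos_iff.2 fun h => ?_
      rw [h] at e1; cases e1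
    refine ⟨p, ⟨e2, by omega, fun q _ => e3 ▸ h2 q, fun q hq => e3 ▸ e4 q hq⟩, ?_⟩
    rw [wordRaise, e, e1, zero_add, Option.map_some]

theorem wordLower_cases (hab : a ≠ b) (w : List A) :
    (wordLower a b w = none ∧ ∀ q, sufSum a b w q ≤ sufSum a b w 0) ∨
      ∃ p, IsLowerPos a b w p ∧ wordLower a b w = some (w.set p b) := by
  have e : (matchParens a b w 0 [] []).1 = closePos a b w 0 0 := by simp [matchParens_fst]
  rcases closePos_spec hab w 0 0 with ⟨h1, h2⟩ | ⟨p, h1, h2, h3⟩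
  · left
    rw [wordLower, e, h1]
    exact ⟨rfl, by simpa using h2⟩
  · right
    exact ⟨p, h2, by rw [wordLower, e, h1, zero_add, Option.map_some]⟩

theorem wordRaise_eq_some_iff (hab : a ≠ b) {w w' : List A} :
    wordRaise a b w = some w' ↔ ∃ p, IsRaisePos a b w p ∧ w' = w.set p a := by
  rcases wordRaise_cases hab w with ⟨h1, h2⟩ | ⟨p, h1, h2⟩
  · rw [h1]
    simp only [reduceCtorEq, false_iff]
    rintro ⟨p, hp, -⟩
    have := h2 p
    have := hp.2.1
    omega
  · rw [h2, Option.some.injEq]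
    constructor
    · rintro rfl
      exact ⟨p, h1, rfl⟩
    · rintro ⟨q, hq, rfl⟩
      rw [h1.unique hq]

theorem wordLower_eq_some_iff (hab : a ≠ b) {w w' : List A} :
    wordLower a b w = some w' ↔ ∃ p, IsLowerPos a b w p ∧ w' = w.set p b := by
  rcases wordLower_cases hab w with ⟨h1, h2⟩ | ⟨p, h1, h2⟩
  · rw [h1]
    simp only [reduceCtorEq, false_iff]
    rintro ⟨p, hp, -⟩
    have := h2 (p + 1)
    have := hp.2.1 0 (Nat.zero_le _)
    omega
  · rw [h2, Option.some.injEq]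
    constructor
    · rintro rfl
      exact ⟨p, h1, rfl⟩
    · rintro ⟨q, hq, rfl⟩
      rw [h1.unique hq]

theorem parenWeight_left (hab : a ≠ b) : parenWeight a b a = -1 := by simp [parenWeight, hab]

theorem parenWeight_right (hab : a ≠ b) : parenWeight a b b = 1 := by
  simp [parenWeight, hab.symm]

theorem wordLower_iff_wordRaise (hab : a ≠ b) {w w' : List A} :
    wordLower a b w = some w' ↔ wordRaise a b w' = some w := by
  rw [wordLower_eq_some_iff hab, wordRaise_eq_some_iff hab]
  have ha := parenWeight_left hab
  have hb := parenWeight_right hab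
  constructor
  · rintro ⟨p, ⟨h1, h2, h3⟩, rfl⟩
    have hlt := lt_length_of_getElem? h1
    have hs := sufSum_set (a := a) (b := b) h1 b
    have hp := sufSum_succ (a := a) (b := b) h1
    simp only [ha, hb] at hs hp
    refine ⟨p, ⟨by simp [hlt], ?_, ?_, ?_⟩, ?_⟩
    · have h4 := h3 (w.length) (by omega)
      rw [sufSum_of_le le_rfl] at h4
      rw [hs, if_pos le_rfl]
      omega
    · intro q hq
      have := h2 q hq.le
      rw [hs, hs, if_pos le_rfl, if_pos hq.le]
      omega
    · intro q hq
      have := h3 q hq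
      rw [hs, hs, if_pos le_rfl, if_neg (by omega)]
      omega
    · rw [List.set_set, set_eq_self_of_getElem? h1]
  · rintro ⟨p, ⟨h1, h0, h2, h3⟩, rfl⟩
    have hlt := lt_length_of_getElem? h1
    have hs := sufSum_set (a := a) (b := b) h1 a
    have hp := sufSum_succ (a := a) (b := b) h1
    simp only [ha, hb] at hs hp
    refine ⟨p, ⟨by simp [hlt], ?_, ?_⟩, ?_⟩
    · intro q hq
      have : sufSum a b w' q ≤ sufSum a b w' p := by
        rcases hq.eq_or_lt with rfl | hq
        · exact le_rfl
        · exact h2 q hq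
      rw [hs, hs, if_pos hq, if_neg (by omega)]
      omega
    · intro q hq
      have := h3 q hq
      rw [hs, hs, if_neg (by omega), if_neg (by omega)]
      omega
    · rw [List.set_set, set_eq_self_of_getElem? h1]

/-- The number of unmatched opening parentheses. -/
def openCount (a b : A) (w : List A) : ℕ := (openPos a b w 0).length

theorem openCount_spec (hab : a ≠ b) (w : List A) :
    (∀ q, sufSum a b w q ≤ openCount a b w) ∧ ∃ q, sufSum a b w q = openCount a b w := by
  obtain ⟨-, h2, h3⟩ := openPos_spec hab w 0
  refine ⟨h2, ?_⟩
  rcases h3 with h3 | ⟨p, e1, e2, e3, e4⟩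
  · exact ⟨w.length, by rw [sufSum_of_le le_rfl, openCount, h3]; rfl⟩
  · exact ⟨p, e3⟩

theorem closeCount_sub_openCount (hab : a ≠ b) (w : List A) :
    (closeCount a b w : ℤ) - openCount a b w = w.count a - w.count b := by
  have h1 := (openPos_spec hab w 0).1
  rw [sufSum_zero] at h1
  unfold openCount
  omega

theorem wordRaise_eq_none_iff (hab : a ≠ b) (w : List A) :
    wordRaise a b w = none ↔ openCount a b w = 0 := by
  obtain ⟨h1, q, hq⟩ := openCount_spec hab w
  rcases wordRaise_cases hab w with ⟨h, h'⟩ | ⟨p, h, h'⟩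
  · have := h' q
    simp only [h, true_iff]
    omega
  · have := h.2.1
    have := h1 p
    simp only [h', reduceCtorEq, false_iff]
    omega

theorem wordLower_eq_none_iff (hab : a ≠ b) (w : List A) :
    wordLower a b w = none ↔ closeCount a b w = 0 := by
  obtain ⟨h1, q, hq⟩ := openCount_spec hab w
  have h2 := closeCount_sub_openCount hab w
  have h3 := sufSum_zero (a := a) (b := b) w
  rcases wordLower_cases hab w with ⟨h, h'⟩ | ⟨p, h, h'⟩
  · have := h' q
    have := h1 0
    simp only [h, true_iff]
    omega
  · have := h.2.1 0 (Nat.zero_le _)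
    have := h1 (p + 1)
    simp only [h', reduceCtorEq, false_iff]
    omega

theorem count_wordRaise (hab : a ≠ b) {w w' : List A} (h : wordRaise a b w = some w') (j : A) :
    (w'.count j : ℤ) = w.count j + ((if j = a then 1 else 0) - (if j = b then 1 else 0)) := by
  obtain ⟨p, hp, rfl⟩ := (wordRaise_eq_some_iff hab).1 h
  have hlt := lt_length_of_getElem? hp.1
  have hb : w[p] = b := by
    have := hp.1
    rw [List.getElem?_eq_getElem hlt] at this
    exact Option.some.inj this
  have hmem : 0 < w.count b := List.count_pos_iff.2 (hb ▸ List.getElem_mem hlt)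
  rw [List.count_set hlt, hb]
  simp only [beq_iff_eq, eq_comm (b := j)]
  by_cases h1 : j = a
  · subst h1
    simp [hab]
  · by_cases h2 : j = b
    · subst h2
      simp [h1]
      omega
    · simp [h1, h2]

theorem openCount_wordRaise (hab : a ≠ b) {w w' : List A} (h : wordRaise a b w = some w') :
    openCount a b w = openCount a b w' + 1 := by
  obtain ⟨p, ⟨h1, h0, h2, h3⟩, rfl⟩ := (wordRaise_eq_some_iff hab).1 h
  have ha := parenWeight_left hab
  have hb := parenWeight_right hab
  have hs := sufSum_set (a := a) (b := b) h1 a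
  have hp := sufSum_succ (a := a) (b := b) h1
  simp only [ha, hb] at hs hp
  obtain ⟨u1, q, hq⟩ := openCount_spec hab w
  obtain ⟨v1, q', hq'⟩ := openCount_spec hab (w.set p a)
  have e : sufSum a b w p = openCount a b w := by
    have := u1 p
    rcases lt_trichotomy q p with h | h | h
    · have := h2 q h; omega
    · rw [← h]; exact hq
    · have := h3 q h; omega
  have l1 := v1 (p + 1)
  rw [hs, if_neg (by omega)] at l1
  have l2 : sufSum a b (w.set p a) q' < sufSum a b w p := by
    rw [hs]
    rcases lt_trichotomy q' p with h | h | h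
    · rw [if_pos h.le]; have := h2 q' h; omega
    · rw [if_pos h.le, h]; omega
    · rw [if_neg (by omega)]; have := h3 q' h; omega
  omega

theorem closeCount_wordLower (hab : a ≠ b) {w w' : List A} (h : wordLower a b w = some w') :
    closeCount a b w = closeCount a b w' + 1 := by
  rw [wordLower_iff_wordRaise hab] at h
  have h1 := openCount_wordRaise hab h
  have h2 := count_wordRaise hab h a
  have h3 := count_wordRaise hab h b
  have h4 := closeCount_sub_openCount hab w
  have h5 := closeCount_sub_openCount hab w'
  simp only [if_true, if_neg hab, if_neg hab.symm] at h2 h3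
  omega

end Words

/-! ### Two consecutive horizontal strips -/

/-- The weight of the cell in column `c` and row `r` for two consecutive horizontal strips `M/L` and
`N/M`: a cell of `N/M` is an opening and a cell of `M/L` a closing parenthesis. -/
def stripWeight (L M N : ℤ → ℕ) (c : ℕ) (r : ℤ) : ℤ :=
  (if M r < c ∧ c ≤ N r then 1 else 0) - (if L r < c ∧ c ≤ M r then 1 else 0)

/-- The total weight of the cells of `S` from the cell `(c, r)` on in the column reading order. -/
def tailSum (S : Finset (ℕ × ℤ)) (L M N : ℤ → ℕ) (c : ℕ) (r : ℤ) : ℤ :=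
  ∑ z ∈ S, if c < z.1 ∨ (z.1 = c ∧ z.2 ≤ r) then stripWeight L M N z.1 z.2 else 0

/-- `H r` is the total weight of the rows above row `r`. -/
structure IsPotential (L M N : ℤ → ℕ) (H : ℤ → ℤ) : Prop where
  above : ∃ a, ∀ s ≤ a, H s = 0
  step : ∀ s, H (s + 1) = H s + L s + N s - 2 * M s

/-- The raising operator acts on row `r`: the excess of opening parentheses from the start of the
block of opening parentheses of the row is positive, at least as large as for all the rows below and
larger than for all the rows above. -/
def IsRaiseRow (M N : ℤ → ℕ) (H : ℤ → ℤ) (r : ℤ) : Prop :=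
  1 ≤ H r + N r - M r ∧ (∀ s < r, H s + N s - M s < H r + N r - M r) ∧
    ∀ s, r < s → H s + N s - M s ≤ H r + N r - M r

theorem IsPotential.unique {L M N : ℤ → ℕ} {H H' : ℤ → ℤ} (h : IsPotential L M N H)
    (h' : IsPotential L M N H') : H = H' := by
  obtain ⟨a, ha⟩ := h.above
  obtain ⟨a', ha'⟩ := h'.above
  funext s
  rcases le_total s (min a a') with hs | hs
  · rw [ha s (by omega), ha' s (by omega)]
  · induction s, hs using Int.leInduction with
    | base => rw [ha _ (by omega), ha' _ (by omega)]
    | succ s _ ih => rw [h.step, h'.step, ih]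

theorem IsRaiseRow.unique {M N : ℤ → ℕ} {H : ℤ → ℤ} {r r' : ℤ} (h : IsRaiseRow M N H r)
    (h' : IsRaiseRow M N H r') : r = r' := by
  rcases lt_trichotomy r r' with hr | hr | hr
  · have := h.2.2 r' hr
    have := h'.2.1 r hr
    omega
  · exact hr
  · have := h.2.1 r' hr
    have := h'.2.2 r hr
    omega

section Strips

variable {L M N : ℤ → ℕ} {S : Finset (ℕ × ℤ)} {H : ℤ → ℤ}

/-- Rows without opening parentheses are irrelevant for the maximal excess. -/
theorem IsPotential.excess_le (hH : IsPotential L M N H) (hLM : ∀ r, L r ≤ M r) (s : ℤ) :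
    H s + N s - M s ≤ 0 ∨ ∃ u ≤ s, M u < N u ∧ H s + N s - M s ≤ H u + N u - M u := by
  obtain ⟨a, ha⟩ := hH.above
  rcases le_total s a with hs | hs
  · rw [ha s hs]
    by_cases h : M s < N s
    · exact Or.inr ⟨s, le_rfl, h, by rw [ha s hs]⟩
    · left; omega
  · induction s, hs using Int.leInduction with
    | base =>
      rw [ha a le_rfl]
      by_cases h : M a < N a
      · exact Or.inr ⟨a, le_rfl, h, by rw [ha a le_rfl]⟩
      · left; omega
    | succ s _ ih =>
      by_cases h : M (s + 1) < N (s + 1)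
      · exact Or.inr ⟨s + 1, le_rfl, h, le_rfl⟩
      · have h1 := hH.step s
        have h2 := hLM s
        rcases ih with ih | ⟨u, hu, hu', ih⟩
        · left; omega
        · exact Or.inr ⟨u, by omega, hu', by omega⟩

theorem sum_row_eq {α β : ℤ → ℕ} {s : ℤ} (h : α s ≤ β s)
    (hS : ∀ c, α s < c → c ≤ β s → (c, s) ∈ S) :
    (∑ z ∈ S, if z.2 = s ∧ α z.2 < z.1 ∧ z.1 ≤ β z.2 then (1 : ℤ) else 0) = β s - α s := by
  rw [Finset.sum_boole]
  have : S.filter (fun z => z.2 = s ∧ α z.2 < z.1 ∧ z.1 ≤ β z.2) =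
      (Finset.Ioc (α s) (β s)).image (fun c => (c, s)) := by
    ext ⟨c, r⟩
    simp only [Finset.mem_filter, Finset.mem_image, Finset.mem_Ioc, Prod.mk.injEq]
    constructor
    · rintro ⟨_, rfl, h1, h2⟩
      exact ⟨c, ⟨h1, h2⟩, rfl, rfl⟩
    · rintro ⟨c, ⟨h1, h2⟩, rfl, rfl⟩
      exact ⟨hS _ h1 h2, rfl, h1, h2⟩
  rw [this, Finset.card_image_of_injective _ (fun c c' h => (Prod.mk.inj h).1), Nat.card_Ioc]
  omega

/-- The total weight of the cells above row `s`. -/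
def rowPotential (S : Finset (ℕ × ℤ)) (L M N : ℤ → ℕ) (s : ℤ) : ℤ :=
  ∑ z ∈ S, if z.2 < s then stripWeight L M N z.1 z.2 else 0

theorem isPotential_rowPotential (hLM : IsStrip L M) (hMN : IsStrip M N)
    (hS : ∀ c r, L r < c → c ≤ N r → (c, r) ∈ S)
    (ha : ∃ a, ∀ r ≤ a, L r = N r) : IsPotential L M N (rowPotential S L M N) := by
  constructor
  · obtain ⟨a, ha⟩ := ha
    refine ⟨a, fun s hs => Finset.sum_eq_zero fun z _ => ?_⟩
    split_ifs with h
    · have := ha z.2 (by omega)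
      have := (hLM z.2).1
      have := (hMN z.2).1
      rw [stripWeight, if_neg (by omega), if_neg (by omega), sub_zero]
    · rfl
  · intro s
    have h1 := sum_row_eq (hLM s).1 (S := S) (fun c h h' => hS c s h (h'.trans (hMN s).1))
    have h2 := sum_row_eq (hMN s).1 (S := S) (fun c h h' => hS c s (lt_of_le_of_lt (hLM s).1 h) h')
    have : rowPotential S L M N (s + 1) = rowPotential S L M N s +
        ((∑ z ∈ S, if z.2 = s ∧ M z.2 < z.1 ∧ z.1 ≤ N z.2 then (1 : ℤ) else 0) -
        ∑ z ∈ S, if z.2 = s ∧ L z.2 < z.1 ∧ z.1 ≤ M z.2 then (1 : ℤ) else 0) := by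
      rw [rowPotential, rowPotential, ← Finset.sum_sub_distrib, ← Finset.sum_add_distrib]
      refine Finset.sum_congr rfl fun z _ => ?_
      unfold stripWeight
      rcases lt_trichotomy z.2 s with h | h | h
      · simp [h, h.ne, show z.2 < s + 1 by omega]
      · simp [h]
      · simp [h.ne', show ¬ z.2 < s + 1 by omega, show ¬ z.2 < s by omega]
    rw [this, h1, h2]
    ring

theorem tailSum_step (hS : ∀ c r, L r < c → c ≤ N r → (c, r) ∈ S) (hLM : ∀ r, L r ≤ M r)
    (hMN : ∀ r, M r ≤ N r) (c : ℕ) (r : ℤ) :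
    tailSum S L M N c r = tailSum S L M N c (r - 1) + stripWeight L M N c r := by
  have h : tailSum S L M N c r = tailSum S L M N c (r - 1) +
      ∑ z ∈ S, if z = (c, r) then stripWeight L M N z.1 z.2 else 0 := by
    rw [tailSum, tailSum, ← Finset.sum_add_distrib]
    refine Finset.sum_congr rfl fun z _ => ?_
    rcases z with ⟨c', r'⟩
    simp only [Prod.mk.injEq]
    split_ifs <;> omega
  rw [h, Finset.sum_ite_eq']
  split_ifs with hm
  · rfl
  · have : ¬ (L r < c ∧ c ≤ N r) := fun h => hm (hS c r h.1 h.2)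
    have := hLM r
    have := hMN r
    rw [stripWeight, if_neg (by omega), if_neg (by omega), sub_zero]

theorem tailSum_congr {c c' : ℕ} {r r' : ℤ}
    (h : ∀ z ∈ S, L z.2 < z.1 → z.1 ≤ N z.2 → (c < z.1 ∨ z.1 = c ∧ z.2 ≤ r ↔
      c' < z.1 ∨ z.1 = c' ∧ z.2 ≤ r')) (hLM : ∀ r, L r ≤ M r) (hMN : ∀ r, M r ≤ N r) :
    tailSum S L M N c r = tailSum S L M N c' r' := by
  refine Finset.sum_congr rfl fun z hz => ?_
  by_cases hc : L z.2 < z.1 ∧ z.1 ≤ N z.2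
  · simp only [h z hz hc.1 hc.2]
  · have := hLM z.2
    have := hMN z.2
    rw [stripWeight, if_neg (by omega : ¬ (M z.2 < z.1 ∧ z.1 ≤ N z.2)),
      if_neg (by omega : ¬ (L z.2 < z.1 ∧ z.1 ≤ M z.2))]
    simp

/-- From the leftmost cell of `N/M` in row `s` on, the column reading and the row reading meet the
same cells of the two strips. -/
theorem tailSum_eq_excess (hLM : IsStrip L M) (hMN : IsStrip M N)
    (hS : ∀ c r, L r < c → c ≤ N r → (c, r) ∈ S) {s : ℤ} (hs : M s < N s) :
    tailSum S L M N (M s + 1) s = rowPotential S L M N s + N s - M s := by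
  have h2 := sum_row_eq (hMN s).1 (S := S) (fun c h h' => hS c s (lt_of_le_of_lt (hLM s).1 h) h')
  rw [add_sub_assoc, ← h2, tailSum, rowPotential, ← Finset.sum_add_distrib]
  refine Finset.sum_congr rfl fun z _ => ?_
  rcases z with ⟨c, r⟩
  simp only [stripWeight]
  have l1 := (hLM r).1
  have l2 := (hMN r).1
  rcases lt_trichotomy r s with h | h | h
  · have h3 := (hLM r).2
    have h4 := hLM.antitone_right (show r + 1 ≤ s by omega)
    split_ifs <;> omega
  · subst h
    split_ifs <;> omega
  · have h3 := (hMN s).2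
    have h4 := hMN.antitone_right (show s + 1 ≤ r by omega)
    split_ifs <;> omega

/-- The cell of the leftmost unmatched opening parenthesis is the leftmost cell of `N/M` in its row,
it can be moved to the strip `M/L`, and its row is the one described by `IsRaiseRow`. -/
theorem raise_cell_spec (hLM : IsStrip L M) (hMN : IsStrip M N)
    (hS : ∀ c r, L r < c → c ≤ N r → (c, r) ∈ S) (ha : ∃ a, ∀ r ≤ a, L r = N r)
    {c : ℕ} {r : ℤ} (hc : M r < c) (hc' : c ≤ N r)
    (h0 : 1 ≤ tailSum S L M N c r)
    (h1 : ∀ c' r', (c' < c ∨ c' = c ∧ r ≤ r') → tailSum S L M N c' r' ≤ tailSum S L M N c r)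
    (h2 : ∀ c' r', (c < c' ∨ c' = c ∧ r' < r) → tailSum S L M N c' r' < tailSum S L M N c r) :
    c = M r + 1 ∧ c ≤ L (r - 1) ∧ IsRaiseRow M N (rowPotential S L M N) r := by
  have hstep := tailSum_step hS (fun r => (hLM r).1) (fun r => (hMN r).1)
  have hN := (hMN (r - 1)).2
  rw [sub_add_cancel] at hN
  have hL := (hLM (r - 1)).2
  rw [sub_add_cancel] at hL
  have hcL : c ≤ L (r - 1) := by
    by_contra hlt
    have e1 := hstep c r
    have e2 := hstep c (r - 1)
    rw [stripWeight, if_pos ⟨hc, hc'⟩, if_neg (by omega)] at e1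
    rw [stripWeight, if_neg (by omega), if_pos (by omega)] at e2
    have := h2 c (r - 1 - 1) (Or.inr ⟨rfl, by omega⟩)
    omega
  have hcM : c = M r + 1 := by
    by_contra hne
    obtain ⟨d, rfl⟩ : ∃ d, c = d + 1 := ⟨c - 1, by omega⟩
    have e1 := hstep d r
    rw [stripWeight, if_pos (by omega), if_neg (by omega)] at e1
    have e2 : tailSum S L M N d (r - 1) = tailSum S L M N (d + 1) r := by
      refine tailSum_congr (fun z _ z1 z2 => ?_) (fun r => (hLM r).1) (fun r => (hMN r).1)
      rcases le_or_gt z.2 (r - 1) with hz | hz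
      · have := hLM.antitone_left hz
        omega
      · rcases le_or_gt z.2 r with hz' | hz'
        · obtain rfl : z.2 = r := by omega
          omega
        · have := hMN.antitone_right (show r + 1 ≤ z.2 by omega)
          have := (hMN r).2
          omega
    have := h1 d r (Or.inl (Nat.lt_succ_self d))
    omega
  refine ⟨hcM, hcL, ?_⟩
  have hpot := isPotential_rowPotential hLM hMN hS ha
  have hW := tailSum_eq_excess hLM hMN hS (show M r < N r by omega)
  rw [← hcM] at hW
  rw [IsRaiseRow, ← hW]
  have key1 : ∀ u < r, M u < N u →
      rowPotential S L M N u + N u - M u < tailSum S L M N c r := by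
    intro u hu hu'
    rw [← tailSum_eq_excess hLM hMN hS hu']
    refine h2 _ _ (Or.inl ?_)
    have := hLM.antitone_right (show u ≤ r - 1 by omega)
    omega
  have key2 : ∀ u, r < u → M u < N u →
      rowPotential S L M N u + N u - M u ≤ tailSum S L M N c r := by
    intro u hu hu'
    rw [← tailSum_eq_excess hLM hMN hS hu']
    refine h1 _ _ (Or.inl ?_)
    have := hMN.antitone_right (show r + 1 ≤ u by omega)
    have := (hMN r).2
    omega
  refine ⟨h0, fun s hs => ?_, fun s hs => ?_⟩
  · rcases hpot.excess_le (fun r => (hLM r).1) s with h | ⟨u, hu, hu', h⟩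
    · omega
    · have := key1 u (by omega) hu'
      omega
  · rcases hpot.excess_le (fun r => (hLM r).1) s with h | ⟨u, hu, hu', h⟩
    · omega
    · rcases lt_trichotomy u r with hur | hur | hur
      · have := key1 u hur hu'
        omega
      · subst hur; omega
      · have := key2 u hur hu'
        omega

theorem excess_nonpos_of_tailSum (hLM : IsStrip L M) (hMN : IsStrip M N)
    (hS : ∀ c r, L r < c → c ≤ N r → (c, r) ∈ S) (ha : ∃ a, ∀ r ≤ a, L r = N r)
    (h : ∀ c r, tailSum S L M N c r ≤ 0) (s : ℤ) :
    rowPotential S L M N s + N s - M s ≤ 0 := by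
  have hpot := isPotential_rowPotential hLM hMN hS ha
  rcases hpot.excess_le (fun r => (hLM r).1) s with h' | ⟨u, -, hu', h'⟩
  · exact h'
  · rw [← tailSum_eq_excess hLM hMN hS hu'] at h'
    exact h'.trans (h _ _)

/-- The cell of the rightmost unmatched closing parenthesis is the rightmost cell of `M/L` in its
row, and it can be moved to the strip `N/M`. -/
theorem lower_cell_spec (hLM : IsStrip L M) (hMN : IsStrip M N)
    (hS : ∀ c r, L r < c → c ≤ N r → (c, r) ∈ S)
    {c : ℕ} {r : ℤ} (hc : L r < c) (hc' : c ≤ M r)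
    (h1 : ∀ c' r', (c' < c ∨ c' = c ∧ r ≤ r') →
      tailSum S L M N c' r' < tailSum S L M N c (r - 1))
    (h2 : ∀ c' r', (c < c' ∨ c' = c ∧ r' < r) →
      tailSum S L M N c' r' ≤ tailSum S L M N c (r - 1)) :
    c = M r ∧ N (r + 1) < c := by
  have hstep := tailSum_step hS (fun r => (hLM r).1) (fun r => (hMN r).1)
  have hcN : N (r + 1) < c := by
    by_contra hlt
    have e1 := hstep c (r + 1)
    have e2 := hstep c r
    have := (hLM r).2
    rw [stripWeight, if_pos (by omega), if_neg (by omega), add_sub_cancel_right] at e1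
    rw [stripWeight, if_neg (by omega), if_pos (by omega)] at e2
    have := h1 c (r + 1) (Or.inr ⟨rfl, by omega⟩)
    omega
  refine ⟨?_, hcN⟩
  by_contra hne
  have e1 := hstep (c + 1) r
  rw [stripWeight, if_neg (by omega), if_pos (by omega)] at e1
  have e2 : tailSum S L M N c (r - 1) = tailSum S L M N (c + 1) r := by
    refine tailSum_congr (fun z _ z1 z2 => ?_) (fun r => (hLM r).1) (fun r => (hMN r).1)
    rcases le_or_gt z.2 (r - 1) with hz | hz
    · have := hLM.antitone_left hz
      have := (hLM (r - 1)).2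
      rw [sub_add_cancel] at this
      omega
    · rcases le_or_gt z.2 r with hz' | hz'
      · obtain rfl : z.2 = r := by omega
        omega
      · have := hMN.antitone_right (show r + 1 ≤ z.2 by omega)
        omega
  have := h2 (c + 1) (r - 1) (Or.inl (Nat.lt_succ_self c))
  omega

end Strips

/-! ### The column reading word -/

/-- If a list is strictly increasing, dropping its elements below `ζ` leaves those that are `≥ ζ`.
-/
theorem drop_length_filter_lt {Z : Type*} [LinearOrder Z] {l : List Z} (hl : l.Pairwise (· < ·))
    (ζ : Z) : l.drop (l.filter (fun z => decide (z < ζ))).length =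
      l.filter (fun z => decide (ζ ≤ z)) := by
  induction l with
  | nil => rfl
  | cons x l ih =>
    rw [List.pairwise_cons] at hl
    by_cases hx : x < ζ
    · rw [List.filter_cons_of_pos (by simpa using hx), List.filter_cons_of_neg (by simpa using hx),
        List.length_cons, List.drop_succ_cons, ih hl.2]
    · rw [not_lt] at hx
      have h1 : ∀ z ∈ l, ζ ≤ z := fun z hz => hx.trans (hl.1 z hz).le
      rw [List.filter_cons_of_neg (by simpa using hx), List.filter_cons_of_pos (by simpa using hx),
        List.filter_eq_nil_iff.2 (by simpa using h1), List.filter_eq_self.2 (by simpa using h1)]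
      rfl

theorem length_filter_lt_le_iff {Z : Type*} [LinearOrder Z] {l : List Z}
    (hl : l.Pairwise (· < ·)) (ζ : Z) {p : ℕ} {k : Z} (hk : l[p]? = some k) :
    (l.filter (fun z => decide (z < ζ))).length ≤ p ↔ ζ ≤ k := by
  induction l generalizing p with
  | nil => simp at hk
  | cons x l ih =>
    rw [List.pairwise_cons] at hl
    by_cases hx : x < ζ
    · rw [List.filter_cons_of_pos (by simpa using hx), List.length_cons]
      cases p with
      | zero =>
        simp only [List.getElem?_cons_zero, Option.some.injEq] at hk
        subst hk
        simpa using hx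
      | succ p =>
        rw [← ih hl.2 (p := p) (by simpa using hk)]
        omega
    · rw [not_lt] at hx
      have h1 : ∀ z ∈ l, ζ ≤ z := fun z hz => hx.trans (hl.1 z hz).le
      rw [List.filter_cons_of_neg (by simpa using hx), List.filter_eq_nil_iff.2 (by simpa using h1)]
      simp only [List.length_nil, Nat.zero_le, true_iff]
      rcases List.mem_cons.1 (List.mem_of_getElem? hk) with rfl | h
      · exact hx
      · exact h1 k h

theorem sum_map_filter_eq {Z : Type*} (l : List Z) (P : Z → Prop) [DecidablePred P] (g : Z → ℤ) :
    ((l.filter (fun z => decide (P z))).map g).sum =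
      (l.map (fun z => if P z then g z else 0)).sum := by
  induction l with
  | nil => rfl
  | cons x l ih =>
    by_cases hx : P x
    · rw [List.filter_cons_of_pos (by simpa using hx)]; simp [hx, ih]
    · rw [List.filter_cons_of_neg (by simpa using hx)]; simp [hx, ih]

/-- The place of a cell in the column reading order. -/
def cellKey (z : ℕ × ℤ) : ℕ ×ₗ ℤᵒᵈ := toLex (z.1, OrderDual.toDual z.2)

theorem cellKey_le_iff {z w : ℕ × ℤ} :
    cellKey z ≤ cellKey w ↔ z.1 < w.1 ∨ z.1 = w.1 ∧ w.2 ≤ z.2 := by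
  simp [cellKey, Prod.Lex.toLex_le_toLex]

theorem cellKey_injective : Function.Injective cellKey := by
  intro z w h
  have h1 := congrArg (fun k => (ofLex k).1) h
  have h2 := congrArg (fun k => OrderDual.ofDual (ofLex k).2) h
  exact Prod.ext h1 h2

namespace SkewFilling

variable {n : ℕ}

theorem IsSemistandard.finite_cells {T : SkewFilling n} (hT : T.IsSemistandard) :
    T.cells.Finite := by
  obtain ⟨b, hb⟩ := hT.below
  obtain ⟨a, M, ha⟩ := hT.above
  refine ((Set.finite_Icc 0 M).prod (Set.finite_Icc a b)).subset ?_
  rintro ⟨c, r⟩ ⟨h1, h2⟩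
  simp only at h1 h2
  have h3 : a ≤ r := by
    by_contra h
    have := ha r (by omega)
    omega
  have h4 : r ≤ b := by
    by_contra h
    have := hb r (by omega)
    omega
  have h5 := hT.outer_anti h3
  have h6 := (ha a le_rfl).2
  simp only [Set.mem_prod, Set.mem_Icc]
  omega

/-- The label of the cell with a given place in the column reading order. -/
def labelAt (T : SkewFilling n) (k : ℕ ×ₗ ℤᵒᵈ) : Option (Fin n) :=
  T.label (ofLex k).1 (OrderDual.ofDual (ofLex k).2)

theorem labelAt_cellKey (T : SkewFilling n) (z : ℕ × ℤ) : T.labelAt (cellKey z) = T.label z.1 z.2 :=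
  rfl

theorem mem_cells_iff (T : SkewFilling n) (z : ℕ × ℤ) :
    z ∈ T.cells ↔ ∃ x, T.label z.1 z.2 = some x := by
  unfold label cells outer
  simp only [Set.mem_ofPred_eq]
  split_ifs with h
  · rw [← Option.isSome_iff_exists, isSome_getElem?]
    omega
  · simp [h]

theorem mem_readingCells {T : SkewFilling n} (h : T.cells.Finite) (z : ℕ × ℤ) :
    cellKey z ∈ T.readingCells ↔ z ∈ T.cells := by
  unfold readingCells
  rw [dif_pos h, Finset.mem_sort, Finset.mem_image]
  constructor
  · rintro ⟨w, hw, e⟩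
    rw [← cellKey_injective (show cellKey w = cellKey z from e)]
    exact h.mem_toFinset.1 hw
  · intro hz
    exact ⟨z, h.mem_toFinset.2 hz, rfl⟩

theorem pairwise_readingCells (T : SkewFilling n) : T.readingCells.Pairwise (· < ·) := by
  unfold readingCells
  split_ifs
  · exact (Finset.sortedLT_sort _).pairwise
  · exact List.Pairwise.nil

theorem sum_readingCells {T : SkewFilling n} (h : T.cells.Finite) (g : ℕ ×ₗ ℤᵒᵈ → ℤ) :
    (T.readingCells.map g).sum = ∑ z ∈ h.toFinset, g (cellKey z) := by
  classical
  rw [← Finset.sum_image (g := cellKey) (fun z _ w _ e => cellKey_injective e)]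
  have : T.readingCells.toFinset = h.toFinset.image cellKey := by
    ext k
    rw [List.mem_toFinset, Finset.mem_image]
    constructor
    · intro hk
      refine ⟨((ofLex k).1, OrderDual.ofDual (ofLex k).2), ?_, rfl⟩
      rw [h.mem_toFinset, ← mem_readingCells h]
      exact hk
    · rintro ⟨z, hz, rfl⟩
      exact (mem_readingCells h z).2 (h.mem_toFinset.1 hz)
  rw [← this, List.sum_toFinset _ (T.pairwise_readingCells.imp ne_of_lt)]

theorem map_some_colWord {T : SkewFilling n} (h : T.cells.Finite) :
    T.colWord.map some = T.readingCells.map T.labelAt := by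
  have : ∀ l : List (ℕ ×ₗ ℤᵒᵈ), (∀ k ∈ l, ∃ x, T.labelAt k = some x) →
      (l.filterMap T.labelAt).map some = l.map T.labelAt := by
    intro l hl
    induction l with
    | nil => rfl
    | cons k l ih =>
      obtain ⟨x, hx⟩ := hl k List.mem_cons_self
      rw [List.filterMap_cons_some hx, List.map_cons, List.map_cons,
        ih fun k hk => hl k (List.mem_cons_of_mem _ hk), hx]
  refine this _ fun k hk => ?_
  have := (mem_readingCells h ((ofLex k).1, OrderDual.ofDual (ofLex k).2)).1 hk
  exact (T.mem_cells_iff _).1 this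

theorem cells_congr {T T' : SkewFilling n} (h1 : T'.inner = T.inner) (h2 : T'.outer = T.outer) :
    T'.cells = T.cells := by
  unfold cells; rw [h1, h2]

theorem readingCells_congr {T T' : SkewFilling n} (h : T'.cells = T.cells) :
    T'.readingCells = T.readingCells := by
  unfold readingCells
  generalize T'.cells = s at h ⊢
  subst h
  rfl

/-- A filling is determined by its shape and its column reading word. -/
theorem ext_of_colWord {T T' : SkewFilling n} (h : T.cells.Finite) (h1 : T'.inner = T.inner)
    (h2 : T'.outer = T.outer) (h3 : T'.colWord = T.colWord) : T' = T := by
  have hc := cells_congr h1 h2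
  have hr := readingCells_congr hc
  have e := map_some_colWord (T := T') (hc ▸ h)
  rw [h3, map_some_colWord h, hr] at e
  have hlab : ∀ c r, T'.label c r = T.label c r := by
    intro c r
    by_cases hm : (c, r) ∈ T.cells
    · exact (List.map_inj_left.1 e _ ((mem_readingCells h _).2 hm)).symm
    · have m1 : ∀ x, T.label c r ≠ some x := fun x hx => hm ((T.mem_cells_iff _).2 ⟨x, hx⟩)
      have m2 : ∀ x, T'.label c r ≠ some x := fun x hx =>
        hm (hc ▸ (T'.mem_cells_iff _).2 ⟨x, hx⟩)
      rw [Option.eq_none_iff_forall_ne_some.2 m1, Option.eq_none_iff_forall_ne_some.2 m2]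
  have hrow : T'.row = T.row := by
    funext r
    refine List.ext_getElem? fun i => ?_
    have := hlab (T.inner r + i + 1) r
    unfold label at this
    rw [h1, if_pos (by omega), if_pos (by omega)] at this
    rwa [show T.inner r + i + 1 - T.inner r - 1 = i by omega] at this
  cases T; cases T'; simp_all

theorem withColWord_eq_some_iff {T T' : SkewFilling n} (h : T.cells.Finite)
    {w : Option (List (Fin n))} : T.withColWord w = some T' ↔
      T'.inner = T.inner ∧ T'.outer = T.outer ∧ w = some T'.colWord := by
  unfold withColWord
  constructor
  · intro e
    split_ifs at e with hex
    obtain rfl := Option.some.inj e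
    exact hex.choose_spec
  · intro hT'
    have hex : ∃ T' : SkewFilling n, T'.inner = T.inner ∧ T'.outer = T.outer ∧
      w = some T'.colWord := ⟨T', hT'⟩
    rw [dif_pos hex]
    obtain ⟨e1, e2, e3⟩ := hex.choose_spec
    obtain ⟨f1, f2, f3⟩ := hT'
    congr 1
    refine ext_of_colWord (cells_congr f1 f2 ▸ h) (e1.trans f1.symm) (e2.trans f2.symm) ?_
    rw [e3] at f3
    exact Option.some.inj f3

theorem raise_eq_some_iff [NeZero n] {T T' : SkewFilling n} (h : T.cells.Finite) {i : Fin n} :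
    T.raise i = some T' ↔ T'.inner = T.inner ∧ T'.outer = T.outer ∧
      wordRaise (i - 1) i T.colWord = some T'.colWord :=
  withColWord_eq_some_iff h

theorem lower_eq_some_iff [NeZero n] {T T' : SkewFilling n} (h : T.cells.Finite) {i : Fin n} :
    T.lower i = some T' ↔ T'.inner = T.inner ∧ T'.outer = T.outer ∧
      wordLower (i - 1) i T.colWord = some T'.colWord :=
  withColWord_eq_some_iff h

theorem sub_one_ne [NeZero n] {i : Fin n} (hi : i ≠ 0) : i - 1 ≠ i := by
  intro h
  have := val_sub_one hi
  rw [h] at this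
  omega

theorem lower_iff_raise [NeZero n] {T T' : SkewFilling n} (h : T.cells.Finite)
    (h' : T'.cells.Finite) {i : Fin n} (hi : i ≠ 0) :
    T.lower i = some T' ↔ T'.raise i = some T := by
  rw [lower_eq_some_iff h, raise_eq_some_iff h', wordLower_iff_wordRaise (sub_one_ne hi)]
  exact ⟨fun ⟨a, b, c⟩ => ⟨a.symm, b.symm, c⟩, fun ⟨a, b, c⟩ => ⟨a.symm, b.symm, c⟩⟩

/-- The number of cells that precede `(c, r)` in the column reading. -/
noncomputable def readingIndex (T : SkewFilling n) (c : ℕ) (r : ℤ) : ℕ :=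
  (T.readingCells.filter (fun k => decide (k < cellKey (c, r)))).length

/-- Suffix sums of the column reading word are tail sums over the cells. -/
theorem sufSum_colWord {T : SkewFilling n} (hT : T.RowSorted) (h : T.cells.Finite) {x y : Fin n}
    (hxy : x.val + 1 = y.val) (c : ℕ) (r : ℤ) :
    sufSum x y T.colWord (T.readingIndex c r) =
      tailSum h.toFinset (T.lev x.val) (T.lev y.val) (T.lev (y.val + 1)) c r := by
  set f : Option (Fin n) → ℤ := fun o => o.elim 0 (parenWeight x y) with hf
  have e1 : ∀ l : List (Fin n), l.map (parenWeight x y) = (l.map some).map f := by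
    intro l; rw [List.map_map]; rfl
  rw [sufSum, e1, List.map_drop, map_some_colWord h, ← List.map_drop, readingIndex,
    drop_length_filter_lt T.pairwise_readingCells, List.map_map, sum_map_filter_eq,
    sum_readingCells h, tailSum]
  refine Finset.sum_congr rfl fun z hz => ?_
  obtain ⟨u, hu⟩ := (T.mem_cells_iff z).1 (h.mem_toFinset.1 hz)
  have hu' := (label_eq_some_iff hT).1 hu
  have hcond : cellKey (c, r) ≤ cellKey z ↔ (c < z.1 ∨ z.1 = c ∧ z.2 ≤ r) := by
    rw [cellKey_le_iff, eq_comm (a := c)]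
  simp only [hcond, Function.comp_apply, labelAt_cellKey, hu, hf, Option.elim_some]
  congr 1
  unfold parenWeight stripWeight
  have hx := T.label_eq_some_iff (x := x) (c := z.1) (r := z.2) hT
  have hy := T.label_eq_some_iff (x := y) (c := z.1) (r := z.2) hT
  rw [hu, Option.some.injEq] at hx hy
  rw [hxy] at hx
  simp only [hx, hy]

theorem readingIndex_le_iff (T : SkewFilling n) {p : ℕ} {z : ℕ × ℤ}
    (hz : T.readingCells[p]? = some (cellKey z)) (c : ℕ) (r : ℤ) :
    T.readingIndex c r ≤ p ↔ (c < z.1 ∨ c = z.1 ∧ z.2 ≤ r) := by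
  rw [readingIndex, length_filter_lt_le_iff T.pairwise_readingCells _ hz, cellKey_le_iff]

theorem readingIndex_eq (T : SkewFilling n) {p : ℕ} {z : ℕ × ℤ}
    (hz : T.readingCells[p]? = some (cellKey z)) : T.readingIndex z.1 z.2 = p := by
  refine le_antisymm ((T.readingIndex_le_iff hz _ _).2 (Or.inr ⟨rfl, le_rfl⟩)) ?_
  by_contra hlt
  obtain ⟨q, rfl⟩ : ∃ q, p = q + 1 := ⟨p - 1, by omega⟩
  obtain ⟨hl, e⟩ := List.getElem?_eq_some_iff.1 hz
  have hq : T.readingCells[q]? = some (T.readingCells[q]) := List.getElem?_eq_getElem (by omega)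
  have h1 := (length_filter_lt_le_iff T.pairwise_readingCells (cellKey z) hq).1
    (by rw [readingIndex] at hlt; simpa using hlt)
  have h2 := List.pairwise_iff_getElem.1 T.pairwise_readingCells q (q + 1) (by omega) hl (by omega)
  rw [e] at h2
  exact absurd h1 (not_le.2 h2)

theorem exists_cell_of_getElem? {T : SkewFilling n} (h : T.cells.Finite) {p : ℕ} {x : Fin n}
    (hp : T.colWord[p]? = some x) :
    ∃ z : ℕ × ℤ, T.readingCells[p]? = some (cellKey z) ∧ T.label z.1 z.2 = some x := by
  have e := congrArg (fun l => l[p]?) (map_some_colWord h)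
  simp only [List.getElem?_map, hp, Option.map_some] at e
  obtain ⟨k, hk1, hk2⟩ := Option.map_eq_some_iff.1 e.symm
  exact ⟨((ofLex k).1, OrderDual.ofDual (ofLex k).2), hk1, hk2⟩

/-- Changing the level `m` of a tableau by one cell changes one letter of the column reading word.
-/
theorem colWord_eq_set {T T' : SkewFilling n} (h : T.cells.Finite) (hT : T.RowSorted)
    (hT' : T'.RowSorted) {m p : ℕ} {z : ℕ × ℤ} {u : Fin n} (hm : 0 < m) (hmn : m < n)
    (hlev : ∀ k ≤ n, ∀ s, ¬ (k = m ∧ s = z.2) → T'.lev k s = T.lev k s)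
    (hz : ∀ c, c ≠ z.1 → (T'.lev m z.2 < c ↔ T.lev m z.2 < c))
    (hp : T.readingCells[p]? = some (cellKey z)) (hu : T'.label z.1 z.2 = some u) :
    T'.inner = T.inner ∧ T'.outer = T.outer ∧ T'.colWord = T.colWord.set p u := by
  have h1 : T'.inner = T.inner := by
    funext s
    rw [← lev_zero, ← lev_zero, hlev 0 (Nat.zero_le _) s (by omega)]
  have h2 : T'.outer = T.outer := by
    funext s
    rw [← lev_last, ← lev_last, hlev n le_rfl s (by omega)]
  have hc := cells_congr h1 h2
  refine ⟨h1, h2, ?_⟩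
  have hlab : ∀ w : ℕ × ℤ, w ≠ z → T'.label w.1 w.2 = T.label w.1 w.2 := by
    intro w hw
    have hk : ∀ k ≤ n, (T'.lev k w.2 < w.1 ↔ T.lev k w.2 < w.1) := by
      intro k hk
      by_cases hkm : k = m ∧ w.2 = z.2
      · rw [hkm.1, hkm.2]
        exact hz w.1 fun h => hw (Prod.ext h hkm.2)
      · rw [hlev k hk _ hkm]
    refine Option.ext fun v => ?_
    rw [label_eq_some_iff hT, label_eq_some_iff hT', hk _ v.isLt.le, ← not_lt, ← not_lt,
      hk _ v.isLt]
  have hinj : Function.Injective (List.map (some : Fin n → Option (Fin n))) :=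
    List.map_injective_iff.2 (Option.some_injective _)
  apply hinj
  rw [List.map_set, map_some_colWord h, map_some_colWord (hc ▸ h), readingCells_congr hc]
  refine List.ext_getElem? fun q => ?_
  rw [List.getElem?_set]
  have hlen := lt_length_of_getElem? hp
  by_cases hqp : p = q
  · subst hqp
    rw [if_pos rfl, List.length_map, if_pos hlen, List.getElem?_map, hp, Option.map_some,
      labelAt_cellKey, hu]
  · rw [if_neg hqp, List.getElem?_map, List.getElem?_map]
    rcases hq : T.readingCells[q]? with _ | k
    · rfl
    · rw [Option.map_some, Option.map_some]
      congr 1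
      refine hlab ((ofLex k).1, OrderDual.ofDual (ofLex k).2) fun e => hqp ?_
      have hk : k = cellKey z := by rw [← e]; rfl
      rw [hk] at hq
      rw [← T.readingIndex_eq hp, T.readingIndex_eq hq]

/-! ### The classical Kashiwara operators in terms of the level functions -/

theorem mem_cells_of_lev {T : SkewFilling n} (h : T.cells.Finite)
    {x y : Fin n} (c : ℕ) (r : ℤ) (h1 : T.lev x.val r < c) (h2 : c ≤ T.lev (y.val + 1) r) :
    (c, r) ∈ h.toFinset := by
  rw [h.mem_toFinset]
  have m1 := T.lev_mono (Nat.zero_le x.val) r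
  have m2 := T.lev_mono (show y.val + 1 ≤ n from y.isLt) r
  rw [lev_zero] at m1
  rw [lev_last] at m2
  exact ⟨by simp only; omega, by simp only; omega⟩

section Operators

variable [NeZero n] {T : SkewFilling n} {i : Fin n}

theorem IsSemistandard.isStrip_below (hT : T.IsSemistandard) (hi : i ≠ 0) :
    IsStrip (T.lev (i - 1).val) (T.lev i.val) := by
  have h := hT.isStrip (i - 1).isLt
  rwa [val_sub_one hi] at h

theorem IsSemistandard.lev_above (hT : T.IsSemistandard) :
    ∃ a, ∀ r ≤ a, T.lev (i - 1).val r = T.lev (i.val + 1) r := by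
  obtain ⟨a, b, M, h1, -⟩ := hT.lev_bounds
  exact ⟨a, fun r hr => by rw [h1 _ (i - 1).isLt.le r hr, h1 _ i.isLt r hr]⟩

theorem IsSemistandard.isPotential (hT : T.IsSemistandard) (hi : i ≠ 0) :
    IsPotential (T.lev (i - 1).val) (T.lev i.val) (T.lev (i.val + 1))
      (rowPotential hT.finite_cells.toFinset (T.lev (i - 1).val) (T.lev i.val)
        (T.lev (i.val + 1))) :=
  isPotential_rowPotential (hT.isStrip_below hi) (hT.isStrip i.isLt)
    (mem_cells_of_lev hT.finite_cells) hT.lev_above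

/-- Semi-standardness is preserved when the level `m` changes in such a way that it still fits
between its neighbours. -/
theorem IsSemistandard.of_lev_eq {T T' : SkewFilling n} (hT : T.IsSemistandard)
    (hT' : T'.RowSorted) {m : ℕ} (hm : 0 < m) (hmn : m < n)
    (hlev : ∀ k ≤ n, k ≠ m → T'.lev k = T.lev k)
    (h1 : IsStrip (T.lev (m - 1)) (T'.lev m)) (h2 : IsStrip (T'.lev m) (T.lev (m + 1))) :
    T'.IsSemistandard := by
  refine isSemistandard_of_isStrip hT' (fun k hk => ?_) ?_ ?_
  · by_cases e1 : k = m
    · subst e1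
      rw [hlev (k + 1) hk (by omega)]
      exact h2
    · rw [hlev k hk.le e1]
      by_cases e2 : k + 1 = m
      · subst e2
        exact h1
      · rw [hlev (k + 1) hk e2]
        exact hT.isStrip hk
  · rw [hlev n le_rfl (by omega), lev_last]
    exact hT.below
  · rw [hlev n le_rfl (by omega), hlev 0 (Nat.zero_le _) (by omega), lev_last, lev_zero]
    exact hT.above

/-- The raising operator adds one cell to the level `i`, in the row described by `IsRaiseRow`. -/
theorem IsSemistandard.raise_cases (hT : T.IsSemistandard) (hi : i ≠ 0) {H : ℤ → ℤ}
    (hH : IsPotential (T.lev (i - 1).val) (T.lev i.val) (T.lev (i.val + 1)) H) :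
    (T.raise i = none ∧ wordRaise (i - 1) i T.colWord = none ∧
      ∀ s, H s + T.lev (i.val + 1) s - T.lev i.val s ≤ 0) ∨
    ∃ r T', T.raise i = some T' ∧ IsRaiseRow (T.lev i.val) (T.lev (i.val + 1)) H r ∧
      T'.IsSemistandard ∧
      ∀ k ≤ n, ∀ s, T'.lev k s = T.lev k s + if k = i.val ∧ s = r then 1 else 0 := by
  have hab := sub_one_ne hi
  have hfin := hT.finite_cells
  have hv := val_sub_one hi
  have hLM := hT.isStrip_below hi
  have hMN := hT.isStrip i.isLt
  have hS := mem_cells_of_lev hfin (x := i - 1) (y := i)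
  rw [hH.unique (hT.isPotential hi)]
  have hsuf := sufSum_colWord hT.rowSorted hfin hv
  rcases wordRaise_cases hab T.colWord with ⟨h1, h2⟩ | ⟨p, ⟨h1, h0, h2, h3⟩, h4⟩
  · left
    refine ⟨?_, h1, excess_nonpos_of_tailSum hLM hMN hS hT.lev_above fun c r => ?_⟩
    · rw [raise, h1, withColWord, dif_neg]
      rintro ⟨T', -, -, h⟩
      cases h
    · rw [← hsuf]
      exact h2 _
  · right
    obtain ⟨⟨c, r⟩, hz, hlab⟩ := exists_cell_of_getElem? hfin h1
    have hidx := T.readingIndex_eq hz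
    simp only at hlab hidx
    obtain ⟨hc, hc'⟩ := (label_eq_some_iff hT.rowSorted).1 hlab
    have hp : sufSum (i - 1) i T.colWord p = _ := hidx ▸ hsuf c r
    obtain ⟨hcM, hcL, hrow⟩ := raise_cell_spec hLM hMN hS hT.lev_above hc hc'
      (by rw [← hp]; exact h0)
      (fun c' r' h => by
        rw [← hp, ← hsuf]
        have := (T.readingIndex_le_iff hz c' r').2 h
        rcases this.eq_or_lt with e | hlt
        · rw [e]
        · exact h2 _ hlt)
      (fun c' r' h => by
        rw [← hp, ← hsuf]
        refine h3 _ (not_le.1 fun hle => ?_)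
        have := (T.readingIndex_le_iff hz c' r').1 hle
        simp only at this
        omega)
    have hi0 : 0 < i.val := by omega
    set K : ℕ → ℤ → ℕ := fun k s => T.lev k s + if k = i.val ∧ s = r then 1 else 0 with hK
    have hmono : ∀ k < n, ∀ s, K k s ≤ K (k + 1) s := by
      intro k hk s
      have := T.lev_mono (Nat.le_succ k) s
      simp only [hK]
      by_cases e : k = i.val ∧ s = r
      · rw [if_pos e, if_neg (by omega), e.1, e.2]
        omega
      · rw [if_neg e]
        split_ifs <;> simp only [Nat.succ_eq_add_one] at this <;> omega
    have hlev : ∀ k ≤ n, (ofLev n K).lev k = K k := fun k hk => lev_ofLev hmono hk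
    have hsort := rowSorted_ofLev (n := n) K
    obtain ⟨g1, g2, g3⟩ := colWord_eq_set (T' := ofLev n K) (m := i.val) (u := i - 1) hfin
      hT.rowSorted hsort hi0 i.isLt
      (fun k hk s h => by rw [hlev k hk]; simp only [hK]; rw [if_neg h, add_zero])
      (fun c' h => by
        rw [hlev _ i.isLt.le]
        simp only [hK, and_self, if_true]
        simp only at h
        omega)
      hz
      (by
        rw [label_eq_some_iff hsort, hv, hlev _ (i - 1).isLt.le, hlev _ i.isLt.le]
        simp only [hK, and_self, if_true]
        rw [if_neg (by omega)]
        have := hLM r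
        omega)
    refine ⟨r, ofLev n K, ?_, hrow, ?_, fun k hk s => by rw [hlev k hk]⟩
    · rw [raise_eq_some_iff hfin]
      exact ⟨g1, g2, by rw [h4, g3]⟩
    · refine hT.of_lev_eq hsort hi0 i.isLt ?_ ?_ ?_
      · intro k hk hne
        rw [hlev k hk]
        funext s
        simp [hK, hne]
      · rw [hlev _ i.isLt.le, show i.val - 1 = (i - 1).val by omega]
        intro s
        have h5 := hLM s
        simp only [hK, true_and]
        by_cases e1 : s + 1 = r
        · rw [show r - 1 = s by omega] at hcL
          rw [if_neg (by omega), if_pos e1, e1]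
          omega
        · rw [if_neg e1]
          split_ifs <;> omega
      · rw [hlev _ i.isLt.le]
        intro s
        have h5 := hMN s
        simp only [hK, true_and]
        by_cases e1 : s = r
        · subst e1
          rw [if_pos rfl]
          omega
        · rw [if_neg e1]
          omega

/-- The lowering operator removes one cell from the level `i`. -/
theorem IsSemistandard.lower_cases (hT : T.IsSemistandard) (hi : i ≠ 0) :
    (T.lower i = none ∧ wordLower (i - 1) i T.colWord = none) ∨
    ∃ T', T.lower i = some T' ∧ T'.IsSemistandard := by
  have hab := sub_one_ne hi
  have hfin := hT.finite_cells
  have hv := val_sub_one hi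
  have hLM := hT.isStrip_below hi
  have hMN := hT.isStrip i.isLt
  have hS := mem_cells_of_lev hfin (x := i - 1) (y := i)
  have hsuf := sufSum_colWord hT.rowSorted hfin hv
  rcases wordLower_cases hab T.colWord with ⟨h1, h2⟩ | ⟨p, ⟨h1, h2, h3⟩, h4⟩
  · left
    refine ⟨?_, h1⟩
    rw [lower, h1, withColWord, dif_neg]
    rintro ⟨T', -, -, h⟩
    cases h
  · right
    obtain ⟨⟨c, r⟩, hz, hlab⟩ := exists_cell_of_getElem? hfin h1
    have hidx := T.readingIndex_eq hz
    simp only at hlab hidx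
    obtain ⟨hc, hc'⟩ := (label_eq_some_iff hT.rowSorted).1 hlab
    rw [hv] at hc'
    have hp : sufSum (i - 1) i T.colWord p = _ := hidx ▸ hsuf c r
    have hp1 : sufSum (i - 1) i T.colWord (p + 1) = tailSum hfin.toFinset (T.lev (i - 1).val)
        (T.lev i.val) (T.lev (i.val + 1)) c (r - 1) := by
      have e := sufSum_succ (a := i - 1) (b := i) h1
      rw [parenWeight_left hab, hp, tailSum_step hS (fun r => (hLM r).1) (fun r => (hMN r).1),
        stripWeight, if_neg (by omega), if_pos ⟨hc, hc'⟩] at e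
      omega
    obtain ⟨hcM, hcN⟩ := lower_cell_spec hLM hMN hS hc hc'
      (fun c' r' h => by
        rw [← hp1, ← hsuf]
        exact h2 _ ((T.readingIndex_le_iff hz c' r').2 h))
      (fun c' r' h => by
        rw [← hp1, ← hsuf]
        refine h3 _ (not_le.1 fun hle => ?_)
        have := (T.readingIndex_le_iff hz c' r').1 hle
        simp only at this
        omega)
    have hi0 : 0 < i.val := by omega
    set K : ℕ → ℤ → ℕ := fun k s => T.lev k s - if k = i.val ∧ s = r then 1 else 0 with hK
    have hmono : ∀ k < n, ∀ s, K k s ≤ K (k + 1) s := by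
      intro k hk s
      have := T.lev_mono (Nat.le_succ k) s
      simp only [hK]
      by_cases e : k + 1 = i.val ∧ s = r
      · rw [if_pos e, if_neg (by omega), e.1, e.2]
        rw [show k = (i - 1).val by omega]
        omega
      · rw [if_neg e]
        split_ifs <;> simp only [Nat.succ_eq_add_one] at this <;> omega
    have hlev : ∀ k ≤ n, (ofLev n K).lev k = K k := fun k hk => lev_ofLev hmono hk
    have hsort := rowSorted_ofLev (n := n) K
    obtain ⟨g1, g2, g3⟩ := colWord_eq_set (T' := ofLev n K) (m := i.val) (u := i) hfin
      hT.rowSorted hsort hi0 i.isLt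
      (fun k hk s h => by rw [hlev k hk]; simp only [hK]; rw [if_neg h, Nat.sub_zero])
      (fun c' h => by
        rw [hlev _ i.isLt.le]
        simp only [hK, and_self, if_true]
        simp only at h
        omega)
      hz
      (by
        rw [label_eq_some_iff hsort, hlev (i.val + 1) i.isLt, hlev _ i.isLt.le]
        simp only [hK, and_self, if_true]
        rw [if_neg (by omega)]
        have := hMN r
        omega)
    refine ⟨ofLev n K, ?_, ?_⟩
    · rw [lower_eq_some_iff hfin]
      exact ⟨g1, g2, by rw [h4, g3]⟩
    · refine hT.of_lev_eq hsort hi0 i.isLt ?_ ?_ ?_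
      · intro k hk hne
        rw [hlev k hk]
        funext s
        simp [hK, hne]
      · rw [hlev _ i.isLt.le, show i.val - 1 = (i - 1).val by omega]
        intro s
        have h5 := hLM s
        simp only [hK, true_and]
        by_cases e1 : s = r
        · subst e1
          rw [if_pos rfl]
          omega
        · rw [if_neg e1]
          split_ifs <;> omega
      · rw [hlev _ i.isLt.le]
        intro s
        have h5 := hMN s
        simp only [hK, true_and]
        by_cases e1 : s = r
        · subst e1
          rw [if_pos rfl]
          omega
        · rw [if_neg e1]
          omega

end Operators

/-! ### Contents -/

theorem content_eq_count {T : SkewFilling n} (h : T.cells.Finite) (j : Fin n) :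
    T.content j = T.colWord.count j := by
  have e1 : T.colWord.count j = (T.readingCells.map T.labelAt).count (some j) := by
    rw [← map_some_colWord h, List.count_map_of_injective _ _ (Option.some_injective _)]
  have e2 : ((T.readingCells.map T.labelAt).count (some j) : ℤ) =
      (T.readingCells.map fun k => if T.labelAt k = some j then (1 : ℤ) else 0).sum := by
    induction T.readingCells with
    | nil => rfl
    | cons k l ih =>
      rw [List.map_cons, List.count_cons, List.map_cons, List.sum_cons, ← ih]
      simp only [beq_iff_eq]
      push_cast
      ring
  rw [sum_readingCells h, Finset.sum_boole] at e2
  have e3 : {p : ℕ × ℤ | T.label p.1 p.2 = some j} =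
      ((h.toFinset.filter fun z => T.labelAt (cellKey z) = some j : Finset (ℕ × ℤ)) :
        Set (ℕ × ℤ)) := by
    ext z
    rw [Finset.mem_coe, Finset.mem_filter, h.mem_toFinset, labelAt_cellKey]
    exact ⟨fun hz => ⟨(T.mem_cells_iff z).2 ⟨j, hz⟩, hz⟩, fun hz => hz.2⟩
  rw [content, e3, Set.ncard_coe_finset, e1]
  exact_mod_cast e2.symm

/-- The content is the size of the corresponding horizontal strip. -/
theorem content_eq_sum {T : SkewFilling n} (hT : T.RowSorted) {a b : ℤ}
    (h : ∀ r, (r < a ∨ b ≤ r) → T.lev 0 r = T.lev n r) (j : Fin n) :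
    (T.content j : ℤ) = ∑ r ∈ Finset.Ico a b, ((T.lev (j.val + 1) r : ℤ) - T.lev j.val r) := by
  classical
  have e : {p : ℕ × ℤ | T.label p.1 p.2 = some j} =
      (((Finset.Ico a b).sigma fun r => Finset.Ioc (T.lev j.val r) (T.lev (j.val + 1) r)).image
        (fun s : (_ : ℤ) × ℕ => (s.2, s.1)) : Finset (ℕ × ℤ)) := by
    ext ⟨c, r⟩
    simp only [Set.mem_ofPred_eq, label_eq_some_iff hT, Finset.coe_image, Set.mem_image,
      Finset.mem_coe, Finset.mem_sigma, Finset.mem_Ico, Finset.mem_Ioc, Prod.mk.injEq]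
    constructor
    · rintro ⟨h1, h2⟩
      refine ⟨⟨r, c⟩, ⟨?_, h1, h2⟩, rfl, rfl⟩
      by_contra hr
      have := h r (by simp only at hr; omega)
      have := T.lev_mono (Nat.zero_le j.val) r
      have := T.lev_mono (show j.val + 1 ≤ n from j.isLt) r
      omega
    · rintro ⟨⟨r, c⟩, ⟨-, h1, h2⟩, rfl, rfl⟩
      exact ⟨h1, h2⟩
  rw [content, e, Set.ncard_coe_finset, Finset.card_image_of_injective, Finset.card_sigma]
  · push_cast
    refine Finset.sum_congr rfl fun r _ => ?_
    have := T.lev_mono (Nat.le_succ j.val) r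
    rw [Nat.card_Ioc]
    simp only [Nat.succ_eq_add_one] at this
    omega
  · rintro ⟨r, c⟩ ⟨r', c'⟩ h
    simp only [Prod.mk.injEq] at h
    obtain ⟨rfl, rfl⟩ := h
    rfl

end SkewFilling

/-! ### The raising operators commute with internal insertions -/

/-- The row in which the new cell of the next level is placed. -/
def nextRow (α β : ℤ → ℕ) (q : ℤ) : ℤ := if α q < β q then q + 1 else q

/-- Add one cell to row `q`. -/
def addAt (α : ℤ → ℕ) (q : ℤ) (s : ℤ) : ℕ := α s + if s = q then 1 else 0

section Insert

variable {L M N : ℤ → ℕ} {H : ℤ → ℤ} {q q₁ q₂ : ℤ}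

/-- The potential after new cells have been placed in the rows `q`, `q₁`, `q₂` of three consecutive
levels. -/
def insertPotential (H : ℤ → ℤ) (q q₁ q₂ s : ℤ) : ℤ :=
  H s + (if q < s then 1 else 0) + (if q₂ < s then 1 else 0) - 2 * (if q₁ < s then 1 else 0)

theorem IsPotential.insert (hH : IsPotential L M N H) (h1 : q ≤ q₁) (h2 : q₁ ≤ q₂) :
    IsPotential (addAt L q) (addAt M q₁) (addAt N q₂) (insertPotential H q q₁ q₂) := by
  constructor
  · obtain ⟨a, ha⟩ := hH.above
    refine ⟨min a q, fun s hs => ?_⟩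
    rw [insertPotential, ha s (by omega), if_neg (by omega), if_neg (by omega), if_neg (by omega)]
    ring
  · intro s
    have := hH.step s
    simp only [insertPotential, addAt]
    push_cast
    split_ifs <;> omega

/-- How the excess of every row changes: at most at one row, whose excess is dominated by that of a
neighbouring row. -/
theorem excess_insert (H : ℤ → ℤ) (hLM : ∀ s, L s ≤ M s) (hMN : ∀ s, M s ≤ N s)
    (h1 : q₁ = nextRow L M q) (h2 : q₂ = nextRow M N q₁) (s : ℤ) :
    insertPotential H q q₁ q₂ s + addAt N q₂ s - addAt M q₁ s = H s + N s - M s +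
      if L q < M q ∧ M q₁ = N q₁ ∧ s = q + 1 then 1 else
      if L q = M q ∧ M q < N q ∧ s = q then -1 else 0 := by
  have l1 := hLM q
  have m1 := hMN q₁
  simp only [nextRow] at h1 h2
  simp only [insertPotential, addAt]
  push_cast
  by_cases hA : L q < M q
  · rw [if_pos hA] at h1
    rw [if_neg (show ¬ (L q = M q ∧ M q < N q ∧ s = q) by omega)]
    subst h1
    by_cases hB : M (q + 1) < N (q + 1)
    · rw [if_pos hB] at h2
      rw [if_neg (show ¬ (L q < M q ∧ M (q + 1) = N (q + 1) ∧ s = q + 1) by omega)]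
      split_ifs <;> omega
    · rw [if_neg hB] at h2
      split_ifs <;> omega
  · rw [if_neg hA] at h1
    subst h1
    rw [if_neg (show ¬ (L q₁ < M q₁ ∧ M q₁ = N q₁ ∧ s = q₁ + 1) by omega)]
    by_cases hB : M q₁ < N q₁
    · rw [if_pos hB] at h2
      split_ifs <;> omega
    · rw [if_neg hB] at h2
      split_ifs <;> omega

theorem excess_insert_nonpos (hH : IsPotential L M N H) (hLM : ∀ s, L s ≤ M s)
    (hMN : ∀ s, M s ≤ N s) (h1 : q₁ = nextRow L M q) (h2 : q₂ = nextRow M N q₁)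
    (h : ∀ s, H s + N s - M s ≤ 0) (s : ℤ) :
    insertPotential H q q₁ q₂ s + addAt N q₂ s - addAt M q₁ s ≤ 0 := by
  rw [excess_insert H hLM hMN h1 h2]
  have := h s
  have := h q
  have := hH.step q
  split_ifs with c1 c2
  · obtain ⟨c1, c2, rfl⟩ := c1
    rw [nextRow, if_pos c1] at h1
    rw [h1] at c2
    omega
  · omega
  · omega

/-- Inserting a cell commutes with moving a cell of row `r` from the strip `N/M` to the strip `M/L`;
the moved cell may go to another row, but the three levels agree. -/
theorem raiseRow_insert (hH : IsPotential L M N H) (hLM : ∀ s, L s ≤ M s) (hMN : ∀ s, M s ≤ N s)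
    (h1 : q₁ = nextRow L M q) (h2 : q₂ = nextRow M N q₁) {r : ℤ} (hr : IsRaiseRow M N H r)
    {q₁' q₂' : ℤ} (h1' : q₁' = nextRow L (addAt M r) q) (h2' : q₂' = nextRow (addAt M r) N q₁') :
    q₂' = q₂ ∧ ∃ r', IsRaiseRow (addAt M q₁) (addAt N q₂) (insertPotential H q q₁ q₂) r' ∧
      ∀ s, addAt (addAt M r) q₁' s = addAt (addAt M q₁) r' s := by
  have hW := excess_insert H hLM hMN h1 h2
  obtain ⟨r0, r1, r2⟩ := hr
  have l1 := hLM q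
  have m1 := hMN q
  have m2 := hMN (q + 1)
  have s1 := hH.step q
  have b1 := r1 q
  have b2 := r2 q
  have b3 := r1 (q + 1)
  have b4 := r2 (q + 1)
  have l3 := hLM (r - 1)
  have s3 := hH.step (r - 1)
  have b5 := r1 (r - 1) (by omega)
  rw [sub_add_cancel] at s3
  have hmove : M r < N r := by omega
  -- If the row `q` has an opening but no closing parenthesis, the inserted cell pushes its first
  -- opening parenthesis to the next row; otherwise the row `r` does not change.
  by_cases hc : L q = M q ∧ r = q
  · obtain ⟨hA, rfl⟩ := hc
    have e1 : q₁ = r := by rw [h1, nextRow, if_neg (by omega)]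
    have e2 : q₂ = r + 1 := by rw [h2, e1, nextRow, if_pos hmove]
    have e1' : q₁' = r + 1 := by
      rw [h1', nextRow, if_pos]; simp only [addAt, if_true]; omega
    have e2' : q₂' = r + 1 := by
      rw [h2', e1', nextRow, if_neg]; simp only [addAt]; rw [if_neg (by omega)]; omega
    refine ⟨by rw [e2, e2'], r + 1, ?_, fun s => ?_⟩
    · refine ⟨?_, fun s hs => ?_, fun s hs => ?_⟩
      · rw [hW]
        split_ifs <;> omega
      · rw [hW, hW]
        have := r1 s
        by_cases hsr : s = r
        · subst hsr
          split_ifs <;> omega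
        · split_ifs <;> omega
      · rw [hW, hW]
        have := r2 s
        split_ifs <;> omega
    · rw [e1, e1']
  · have e1' : q₁' = q₁ := by
      have : L q < addAt M r q ↔ L q < M q := by
        unfold addAt
        split_ifs <;> omega
      rw [h1, h1']
      simp only [nextRow, this]
    have hrow : ¬ (M q₁ < N q₁) → r ≠ q₁ := by rintro h rfl; exact h hmove
    have e2' : q₂' = q₂ := by
      have : addAt M r q₁ < N q₁ ↔ M q₁ < N q₁ := by
        unfold addAt
        by_cases hA : L q < M q
        · rw [nextRow, if_pos hA] at h1
          subst h1
          by_cases hqr : q + 1 = r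
          · subst hqr
            rw [if_pos rfl]
            omega
          · rw [if_neg hqr, add_zero]
        · rw [nextRow, if_neg hA] at h1
          subst h1
          rw [if_neg (show ¬ q₁ = r by omega), add_zero]
      rw [h2, h2', e1']
      simp only [nextRow, this]
    refine ⟨e2', r, ?_, fun s => ?_⟩
    · have g1 : L q < M q → q₁ = q + 1 := fun h => by rw [h1, nextRow, if_pos h]
      have hd : ¬ (L q < M q ∧ M q₁ = N q₁ ∧ r = q + 1) := by
        rintro ⟨h, h', e⟩
        exact hrow (by omega) (e.trans (g1 h).symm)
      refine ⟨?_, fun s hs => ?_, fun s hs => ?_⟩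
      · rw [hW, if_neg hd]
        split_ifs <;> omega
      · rw [hW, hW, if_neg hd]
        have := r1 s hs
        split_ifs with c d <;> try omega
        · rw [g1 c.1] at c
          rw [c.2.2]
          omega
      · rw [hW, hW, if_neg hd]
        have := r2 s hs
        split_ifs with c d <;> try omega
        · rw [g1 c.1] at c
          rw [c.2.2]
          by_cases hrq : r = q
          · subst hrq; omega
          · omega
    · rw [e1']; simp only [addAt]; ring

end Insert

namespace SkewFilling

variable {n : ℕ}

/-- `T'` has one cell more than `T` in row `r` of the level `m`, and no other difference. -/
def LevelMove (m : ℕ) (r : ℤ) (T T' : SkewFilling n) : Prop :=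
  T'.RowSorted ∧ ∀ k ≤ n, ∀ s, T'.lev k s = T.lev k s + if k = m ∧ s = r then 1 else 0

/-- A single internal insertion commutes with the raising operator: it carries a raise row to a
raise row, although possibly a different one, and does not create one if there is none. -/
theorem internalInsert_raise {T : SkewFilling n} (hT : T.RowSorted) {m : ℕ} (hm : m + 1 < n)
    {H : ℤ → ℤ} (hH : IsPotential (T.lev m) (T.lev (m + 1)) (T.lev (m + 2)) H) (t : ℤ) :
    ∃ H', IsPotential ((T.internalInsert t).lev m) ((T.internalInsert t).lev (m + 1))
        ((T.internalInsert t).lev (m + 2)) H' ∧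
      ((∀ s, H s + T.lev (m + 2) s - T.lev (m + 1) s ≤ 0) → ∀ s,
        H' s + (T.internalInsert t).lev (m + 2) s - (T.internalInsert t).lev (m + 1) s ≤ 0) ∧
      ∀ r T', IsRaiseRow (T.lev (m + 1)) (T.lev (m + 2)) H r → LevelMove (m + 1) r T T' →
        ∃ r', IsRaiseRow ((T.internalInsert t).lev (m + 1))
          ((T.internalInsert t).lev (m + 2)) H' r' ∧
          LevelMove (m + 1) r' (T.internalInsert t) (T'.internalInsert t) := by
  obtain ⟨hTs, p, hp0, hp, hpl⟩ := T.internalInsert_spec t hT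
  have hlev : ∀ k ≤ n, (T.internalInsert t).lev k = addAt (T.lev k) (p k) := fun k hk =>
    funext (hpl k hk)
  have e1 : p (m + 1) = nextRow (T.lev m) (T.lev (m + 1)) (p m) := hp m (Nat.zero_le _) (by omega)
  have e2 : p (m + 2) = nextRow (T.lev (m + 1)) (T.lev (m + 2)) (p (m + 1)) :=
    hp (m + 1) (Nat.zero_le _) (by omega)
  have i1 : p m ≤ p (m + 1) := by rw [e1, nextRow]; split_ifs <;> omega
  have i2 : p (m + 1) ≤ p (m + 2) := by rw [e2, nextRow]; split_ifs <;> omega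
  have lm := T.lev_mono (Nat.le_succ m)
  have lm' := T.lev_mono (Nat.le_succ (m + 1))
  rw [hlev m (by omega), hlev (m + 1) (by omega), hlev (m + 2) (by omega)]
  refine ⟨insertPotential H (p m) (p (m + 1)) (p (m + 2)), hH.insert i1 i2,
    excess_insert_nonpos hH lm lm' e1 e2, ?_⟩
  rintro r T' hr ⟨hT', hT'l⟩
  obtain ⟨hTs', p', hp0', hp', hpl'⟩ := T'.internalInsert_spec t hT'
  have hne : ∀ k ≤ n, k ≠ m + 1 → T'.lev k = T.lev k := fun k hk h => by
    funext s
    rw [hT'l k hk, if_neg (by omega), add_zero]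
  have heq : T'.lev (m + 1) = addAt (T.lev (m + 1)) r := by
    funext s
    rw [hT'l _ (by omega), addAt]
    simp
  have hlow : ∀ k ≤ m, p' k = p k := by
    intro k
    induction k with
    | zero => intro _; rw [hp0, hp0']
    | succ k ih =>
      intro hk
      rw [hp k (Nat.zero_le _) (by omega), hp' k (Nat.zero_le _) (by omega), ih (by omega),
        hne k (by omega) (by omega), hne (k + 1) (by omega) (by omega)]
  have e1' : p' (m + 1) = nextRow (T.lev m) (addAt (T.lev (m + 1)) r) (p m) := by
    have := hp' m (Nat.zero_le _) (by omega)
    rwa [hlow m le_rfl, hne m (by omega) (by omega), heq] at this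
  have e2' : p' (m + 2) = nextRow (addAt (T.lev (m + 1)) r) (T.lev (m + 2)) (p' (m + 1)) := by
    have := hp' (m + 1) (Nat.zero_le _) (by omega)
    rwa [hne (m + 1 + 1) (by omega) (by omega), heq] at this
  obtain ⟨f, r', hr', hadd⟩ := raiseRow_insert hH lm lm' e1 e2 hr e1' e2'
  have hhigh : ∀ k, m + 2 ≤ k → k ≤ n → p' k = p k := by
    intro k hk
    induction k, hk using Nat.le_induction with
    | base => intro _; exact f
    | succ k hk ih =>
      intro hkn
      rw [hp k (Nat.zero_le _) (by omega), hp' k (Nat.zero_le _) (by omega), ih (by omega),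
        hne k (by omega) (by omega), hne (k + 1) (by omega) (by omega)]
  refine ⟨r', hr', hTs', fun k hk s => ?_⟩
  rw [hpl' k hk, hpl k hk]
  rcases lt_trichotomy k (m + 1) with h | h | h
  · rw [hlow k (by omega), hne k hk (by omega), if_neg (show ¬ (k = m + 1 ∧ s = r') by omega),
      add_zero]
  · subst h
    have := hadd s
    rw [heq]
    simp only [addAt] at this ⊢
    rw [this]
    simp
  · rw [hhigh k (by omega) hk, hne k hk (by omega),
      if_neg (show ¬ (k = m + 1 ∧ s = r') by omega), add_zero]

theorem internalInserts_raise {T : SkewFilling n} (hT : T.RowSorted) {m : ℕ} (hm : m + 1 < n)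
    {H : ℤ → ℤ} (hH : IsPotential (T.lev m) (T.lev (m + 1)) (T.lev (m + 2)) H) (rs : List ℤ) :
    ∃ H', IsPotential ((T.internalInserts rs).lev m) ((T.internalInserts rs).lev (m + 1))
        ((T.internalInserts rs).lev (m + 2)) H' ∧
      ((∀ s, H s + T.lev (m + 2) s - T.lev (m + 1) s ≤ 0) → ∀ s,
        H' s + (T.internalInserts rs).lev (m + 2) s - (T.internalInserts rs).lev (m + 1) s ≤ 0) ∧
      ∀ r T', IsRaiseRow (T.lev (m + 1)) (T.lev (m + 2)) H r → LevelMove (m + 1) r T T' →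
        ∃ r', IsRaiseRow ((T.internalInserts rs).lev (m + 1))
          ((T.internalInserts rs).lev (m + 2)) H' r' ∧
          LevelMove (m + 1) r' (T.internalInserts rs) (T'.internalInserts rs) := by
  induction rs generalizing T H with
  | nil => exact ⟨H, hH, fun h => h, fun r T' hr hT' => ⟨r, hr, hT'⟩⟩
  | cons t rs ih =>
    obtain ⟨H₁, a1, a2, a3⟩ := internalInsert_raise hT hm hH t
    obtain ⟨H₂, b1, b2, b3⟩ := ih (T.internalInsert_spec t hT).1 a1
    refine ⟨H₂, b1, fun h => b2 (a2 h), fun r T' hr hT' => ?_⟩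
    obtain ⟨r₁, c1, c2⟩ := a3 r T' hr hT'
    exact b3 r₁ _ c1 c2

end SkewFilling

/-! ### Partial maps and colors of a crystal -/

section Abstract

variable {n : ℕ} {X : Type*} {B : Set X}

/-- The partial map `f` maps `B` to itself. -/
def PartialMapsTo (B : Set X) (f : X → Option X) : Prop := ∀ b ∈ B, ∀ b', f b = some b' → b' ∈ B

/-- The partial map `f` commutes with the map `φ` on `B`. -/
def CommutesOn (B : Set X) (f : X → Option X) (φ : X → X) : Prop :=
  ∀ b ∈ B, (f b).map φ = f (φ b)

/-- The axioms of a crystal for one color, with raising operator `e`, lowering operator `f` and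
coroot `h`. -/
structure IsColor (B : Set X) (content : X → Fin n → ℕ) (e f : X → Option X) (h : Fin n → ℤ) :
    Prop where
  raise_mem : PartialMapsTo B e
  lower_mem : PartialMapsTo B f
  lower_iff_raise : ∀ b ∈ B, ∀ b' ∈ B, f b = some b' ↔ e b' = some b
  string_lengths : ∀ b ∈ B, ∃ φ ε : ℕ, IsGreatest {m | partialIter f m b ≠ none} φ ∧
    IsGreatest {m | partialIter e m b ≠ none} ε ∧ ∑ j, h j * (content b j : ℤ) = (φ : ℤ) - ε
  content_lower : ∀ b ∈ B, ∀ b', f b = some b' → ∀ j, (content b' j : ℤ) = content b j - h j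

theorem partialIter_zero (f : X → Option X) (b : X) : partialIter f 0 b = some b := rfl

theorem partialIter_succ (f : X → Option X) (m : ℕ) (b : X) :
    partialIter f (m + 1) b = (f b).bind (partialIter f m) := by
  unfold partialIter
  rw [Function.iterate_succ_apply, Option.bind_some]
  cases f b with
  | none =>
    rw [Option.bind_none]
    induction m with
    | zero => rfl
    | succ m ih => rw [Function.iterate_succ_apply, Option.bind_none, ih]
  | some b' => rfl

/-- A statistic that drops by one under a partial map, and vanishes exactly where the map is
undefined, is the string length. -/
theorem isGreatest_partialIter {f : X → Option X} {ε : X → ℕ} (hf : PartialMapsTo B f)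
    (h0 : ∀ b ∈ B, f b = none ↔ ε b = 0) (h1 : ∀ b ∈ B, ∀ b', f b = some b' → ε b = ε b' + 1)
    {b : X} (hb : b ∈ B) : IsGreatest {m | partialIter f m b ≠ none} (ε b) := by
  have key : ∀ m, ∀ b ∈ B, partialIter f m b ≠ none ↔ m ≤ ε b := by
    intro m
    induction m with
    | zero => intro b _; simp [partialIter_zero]
    | succ m ih =>
      intro b hb
      rw [partialIter_succ]
      rcases hfb : f b with _ | b'
      · have := (h0 b hb).1 hfb
        simp [this]
      · rw [Option.bind_some, ih b' (hf b hb b' hfb), h1 b hb b' hfb]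
        omega
  exact ⟨(key _ b hb).2 le_rfl, fun m hm => (key m b hb).1 hm⟩

theorem partialIter_conj {e e' : X → Option X} {σ : X → X} (he : PartialMapsTo B e)
    (h : ∀ b ∈ B, e' (σ b) = (e b).map σ) (m : ℕ) {b : X} (hb : b ∈ B) :
    partialIter e' m (σ b) = (partialIter e m b).map σ := by
  induction m generalizing b with
  | zero => rfl
  | succ m ih =>
    rw [partialIter_succ, partialIter_succ, h b hb]
    rcases hfb : e b with _ | b'
    · rfl
    · exact ih (he b hb b' hfb)

/-- The axioms of a crystal are transported by bijections. -/
theorem IsColor.transport {content content' : X → Fin n → ℕ} {e f e' f' : X → Option X}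
    {h h' : Fin n → ℤ} (H : IsColor B content e f h) {σ : X → X} (hσ : Set.BijOn σ B B)
    (he : ∀ b ∈ B, e' (σ b) = (e b).map σ) (hf : ∀ b ∈ B, f' (σ b) = (f b).map σ)
    (π : Equiv.Perm (Fin n)) (hc : ∀ b ∈ B, ∀ j, content' (σ b) j = content b (π j))
    (hh : ∀ j, h' j = h (π j)) : IsColor B content' e' f' h' := by
  have mapsTo : ∀ {e e' : X → Option X}, PartialMapsTo B e → (∀ b ∈ B, e' (σ b) = (e b).map σ) →
      PartialMapsTo B e' := by
    intro e e' he he' b hb b' hb'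
    obtain ⟨a, ha, rfl⟩ := hσ.surjOn hb
    rw [he' a ha] at hb'
    obtain ⟨a', ha', rfl⟩ := Option.map_eq_some_iff.1 hb'
    exact hσ.mapsTo (he a ha a' ha')
  have iff : ∀ {e e' : X → Option X}, PartialMapsTo B e → (∀ b ∈ B, e' (σ b) = (e b).map σ) →
      ∀ a ∈ B, ∀ a' ∈ B, (e' (σ a) = some (σ a') ↔ e a = some a') := by
    intro e e' he he' a ha a' ha'
    rw [he' a ha, Option.map_eq_some_iff]
    constructor
    · rintro ⟨c, hc, hca⟩
      rw [hc, hσ.injOn (he a ha c hc) ha' hca]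
    · intro h
      exact ⟨a', h, rfl⟩
  refine ⟨mapsTo H.raise_mem he, mapsTo H.lower_mem hf, ?_, ?_, ?_⟩
  · intro b hb b' hb'
    obtain ⟨a, ha, rfl⟩ := hσ.surjOn hb
    obtain ⟨a', ha', rfl⟩ := hσ.surjOn hb'
    rw [iff H.lower_mem hf a ha a' ha', iff H.raise_mem he a' ha' a ha]
    exact H.lower_iff_raise a ha a' ha'
  · intro b hb
    obtain ⟨a, ha, rfl⟩ := hσ.surjOn hb
    obtain ⟨φ, ε, h1, h2, h3⟩ := H.string_lengths a ha
    refine ⟨φ, ε, ?_, ?_, ?_⟩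
    · simpa only [partialIter_conj H.lower_mem hf _ ha, ne_eq, Option.map_eq_none_iff] using h1
    · simpa only [partialIter_conj H.raise_mem he _ ha, ne_eq, Option.map_eq_none_iff] using h2
    · rw [← h3, ← Equiv.sum_comp π fun j => h j * (content a j : ℤ)]
      exact Finset.sum_congr rfl fun j _ => by rw [hh, hc a ha]
  · intro b hb b' hb' j
    obtain ⟨a, ha, rfl⟩ := hσ.surjOn hb
    rw [hf a ha] at hb'
    obtain ⟨a', ha', rfl⟩ := Option.map_eq_some_iff.1 hb'
    rw [hc a ha, hc a' (H.lower_mem a ha a' ha'), hh]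
    exact H.content_lower a ha a' ha' (π j)

/-- A bijection that commutes with a partial map commutes with its partial inverse. -/
theorem CommutesOn.of_inverse {e f : X → Option X} {φ : X → X} (hφ : Set.BijOn φ B B)
    (he : PartialMapsTo B e) (hf : PartialMapsTo B f)
    (hef : ∀ b ∈ B, ∀ b' ∈ B, f b = some b' ↔ e b' = some b) (h : CommutesOn B e φ) :
    CommutesOn B f φ := by
  intro b hb
  have hφb := hφ.mapsTo hb
  rcases hfb : f b with _ | b'
  · rcases hfφ : f (φ b) with _ | c
    · rfl
    · have hc := hf _ hφb c hfφ
      obtain ⟨a, ha, rfl⟩ := hφ.surjOn hc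
      have h1 := (hef _ hφb _ hc).1 hfφ
      rw [← h a ha] at h1
      obtain ⟨d, hd, hdb⟩ := Option.map_eq_some_iff.1 h1
      rw [hφ.injOn (he a ha d hd) hb hdb] at hd
      rw [(hef b hb a ha).2 hd] at hfb
      cases hfb
  · have hb' := hf b hb b' hfb
    have h1 := (hef b hb b' hb').1 hfb
    have h2 := h b' hb'
    rw [h1, Option.map_some] at h2
    rw [Option.map_some]
    exact ((hef _ hφb _ (hφ.mapsTo hb')).2 h2.symm).symm

theorem CommutesOn.iterate {f : X → Option X} {φ : X → X} (hφ : Set.MapsTo φ B B)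
    (h : CommutesOn B f φ) (m : ℕ) : CommutesOn B f (φ^[m]) := by
  induction m with
  | zero => intro b _; simp
  | succ m ih =>
    intro b hb
    have h1 := ih (φ b) (hφ hb)
    rw [← h b hb, Option.map_map] at h1
    exact h1

theorem PartialCommute.symm {f g : X → Option X} (h : PartialCommute B f g) :
    PartialCommute B g f := fun b hb => (h b hb).symm

end Abstract

section Conj

variable {n : ℕ} {ι κ : SkewFilling n × SkewFilling n → SkewFilling n × SkewFilling n}
  {f g : SkewFilling n × SkewFilling n → Option (SkewFilling n × SkewFilling n)}

theorem conjOnPairs_apply (hι : Set.BijOn ι (sstPairs n) (sstPairs n))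
    {b : SkewFilling n × SkewFilling n} (hb : b ∈ sstPairs n) :
    conjOnPairs ι f (ι b) = (f b).map ι := by
  rw [conjOnPairs, hι.injOn.leftInvOn_invFunOn hb]

theorem PartialMapsTo.conj (hι : Set.BijOn ι (sstPairs n) (sstPairs n))
    (hf : PartialMapsTo (sstPairs n) f) : PartialMapsTo (sstPairs n) (conjOnPairs ι f) := by
  intro b hb b' hb'
  obtain ⟨a, ha, rfl⟩ := hι.surjOn hb
  rw [conjOnPairs_apply hι ha] at hb'
  obtain ⟨a', ha', rfl⟩ := Option.map_eq_some_iff.1 hb'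
  exact hι.mapsTo (hf a ha a' ha')

theorem CommutesOn.conj (hι : Set.BijOn ι (sstPairs n) (sstPairs n))
    (hκ : Set.MapsTo κ (sstPairs n) (sstPairs n)) (hικ : ∀ b ∈ sstPairs n, ι (κ b) = κ (ι b))
    (hf : PartialMapsTo (sstPairs n) f) (h : CommutesOn (sstPairs n) f κ) :
    CommutesOn (sstPairs n) (conjOnPairs ι f) κ := by
  intro b hb
  obtain ⟨a, ha, rfl⟩ := hι.surjOn hb
  rw [conjOnPairs_apply hι ha, ← hικ a ha, conjOnPairs_apply hι (hκ ha), ← h a ha]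
  rcases hfa : f a with _ | a'
  · rfl
  · simp only [Option.map_some, hικ a' (hf a ha a' hfa)]

theorem PartialCommute.conj (hι : Set.BijOn ι (sstPairs n) (sstPairs n))
    (hf : PartialMapsTo (sstPairs n) f) (hg : PartialMapsTo (sstPairs n) g)
    (hgι : CommutesOn (sstPairs n) g ι) (h : PartialCommute (sstPairs n) f g) :
    PartialCommute (sstPairs n) (conjOnPairs ι f) g := by
  intro b hb
  obtain ⟨a, ha, rfl⟩ := hι.surjOn hb
  have h1 : ((f a).map ι).bind g = ((f a).bind g).map ι := by
    rcases hfa : f a with _ | a'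
    · rfl
    · exact (hgι a' (hf a ha a' hfa)).symm
  have h2 : ((g a).map ι).bind (conjOnPairs ι f) = ((g a).bind f).map ι := by
    rcases hga : g a with _ | a'
    · rfl
    · exact conjOnPairs_apply hι (hg a ha a' hga)
  rw [conjOnPairs_apply hι ha, h1, h a ha, ← h2, hgι a ha]

end Conj

/-! ### The classical operators on pairs -/

section Classical

variable {n : ℕ} [NeZero n] {i : Fin n}

theorem partialMapsTo_onFst_raise (hi : i ≠ 0) :
    PartialMapsTo (sstPairs n) (onFst (SkewFilling.raise i)) := by
  rintro ⟨P, Q⟩ ⟨hP, hQ, h1, h2⟩ y hy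
  obtain ⟨P', hP', rfl⟩ := Option.map_eq_some_iff.1 hy
  obtain ⟨e1, e2, -⟩ := (raise_eq_some_iff hP.finite_cells).1 hP'
  refine ⟨?_, hQ, e1.trans h1, e2.trans h2⟩
  rcases hP.raise_cases hi (hP.isPotential hi) with ⟨h, -⟩ | ⟨r, T', h, -, hT', -⟩
  · rw [h] at hP'
    cases hP'
  · rw [h] at hP'
    cases hP'
    exact hT'

theorem partialMapsTo_onFst_lower (hi : i ≠ 0) :
    PartialMapsTo (sstPairs n) (onFst (SkewFilling.lower i)) := by
  rintro ⟨P, Q⟩ ⟨hP, hQ, h1, h2⟩ y hy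
  obtain ⟨P', hP', rfl⟩ := Option.map_eq_some_iff.1 hy
  obtain ⟨e1, e2, -⟩ := (lower_eq_some_iff hP.finite_cells).1 hP'
  refine ⟨?_, hQ, e1.trans h1, e2.trans h2⟩
  rcases hP.lower_cases hi with ⟨h, -⟩ | ⟨T', h, hT'⟩
  · rw [h] at hP'
    cases hP'
  · rw [h] at hP'
    cases hP'
    exact hT'

theorem onFst_lower_iff_raise (hi : i ≠ 0) : ∀ x ∈ sstPairs n, ∀ y ∈ sstPairs n,
    onFst (SkewFilling.lower i) x = some y ↔ onFst (SkewFilling.raise i) y = some x := by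
  rintro ⟨P, Q⟩ hx ⟨P', Q'⟩ hy
  simp only [onFst, Option.map_eq_some_iff, Prod.mk.injEq]
  have := lower_iff_raise hx.1.finite_cells hy.1.finite_cells hi
  constructor
  · rintro ⟨T, hT, rfl, rfl⟩
    exact ⟨P, this.1 hT, rfl, rfl⟩
  · rintro ⟨T, hT, rfl, rfl⟩
    exact ⟨P', this.2 hT, rfl, rfl⟩

theorem sum_simpleCoroot_mul (i : Fin n) (c : Fin n → ℤ) :
    ∑ j, simpleCoroot i j * c j = c (i - 1) - c i := by
  simp [simpleCoroot, sub_mul, Finset.sum_sub_distrib]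

/-- The string lengths are the numbers of unmatched parentheses of the column reading word. -/
theorem isColor_onFst (hi : i ≠ 0) : IsColor (sstPairs n) (fun x => x.1.content)
    (onFst (SkewFilling.raise i)) (onFst (SkewFilling.lower i)) (simpleCoroot i) := by
  have hab := sub_one_ne hi
  refine ⟨partialMapsTo_onFst_raise hi, partialMapsTo_onFst_lower hi, onFst_lower_iff_raise hi,
    fun x hx => ⟨closeCount (i - 1) i x.1.colWord, openCount (i - 1) i x.1.colWord, ?_, ?_, ?_⟩, ?_⟩
  · refine isGreatest_partialIter (ε := fun y => closeCount (i - 1) i y.1.colWord)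
      (partialMapsTo_onFst_lower hi) (fun y hy => ?_) (fun y hy y' h => ?_) hx
    · rw [← wordLower_eq_none_iff hab, onFst, Option.map_eq_none_iff]
      rcases hy.1.lower_cases hi with ⟨h, h'⟩ | ⟨T', h, -⟩
      · simp [h, h']
      · have := ((lower_eq_some_iff hy.1.finite_cells).1 h).2.2
        simp [h, this]
    · obtain ⟨P', hP', rfl⟩ := Option.map_eq_some_iff.1 h
      exact closeCount_wordLower hab ((lower_eq_some_iff hy.1.finite_cells).1 hP').2.2
  · refine isGreatest_partialIter (ε := fun y => openCount (i - 1) i y.1.colWord)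
      (partialMapsTo_onFst_raise hi) (fun y hy => ?_) (fun y hy y' h => ?_) hx
    · rw [← wordRaise_eq_none_iff hab, onFst, Option.map_eq_none_iff]
      rcases hy.1.raise_cases hi (hy.1.isPotential hi) with ⟨h, h', -⟩ | ⟨r, T', h, -⟩
      · simp [h, h']
      · have := ((raise_eq_some_iff hy.1.finite_cells).1 h).2.2
        simp [h, this]
    · obtain ⟨P', hP', rfl⟩ := Option.map_eq_some_iff.1 h
      exact openCount_wordRaise hab ((raise_eq_some_iff hy.1.finite_cells).1 hP').2.2
  · rw [sum_simpleCoroot_mul, content_eq_count hx.1.finite_cells,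
      content_eq_count hx.1.finite_cells, closeCount_sub_openCount hab]
  · intro x hx y h j
    have hy := partialMapsTo_onFst_lower hi x hx y h
    obtain ⟨P', hP', rfl⟩ := Option.map_eq_some_iff.1 h
    have h1 := ((lower_eq_some_iff hx.1.finite_cells).1 hP').2.2
    have h2 := count_wordRaise hab ((wordLower_iff_wordRaise hab).1 h1) j
    simp only [content_eq_count hx.1.finite_cells, content_eq_count hy.1.finite_cells,
      simpleCoroot]
    linarith

/-- The classical operators on the first tableau commute with internal insertion, because they do
so with every single internal insertion. -/
theorem commutesOn_onFst_raise (hi : i ≠ 0) :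
    CommutesOn (sstPairs n) (onFst (SkewFilling.raise i)) iota₂ := by
  intro x hx
  have hy := iota₂_mem hx
  have hv := val_sub_one hi
  have hm : (i - 1).val + 1 < n := hv ▸ i.isLt
  have hpot := hx.1.isPotential hi
  have c1 := hx.1.raise_cases hi hpot
  simp only [← hv, add_assoc, Nat.reduceAdd] at hpot c1
  obtain ⟨H', p1, p2, p3⟩ := internalInserts_raise hx.1.rowSorted hm hpot (x.2.rowCoords 0)
  have c2 := hy.1.raise_cases hi (H := H') (by
    simp only [← hv, add_assoc, Nat.reduceAdd]
    exact p1)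
  simp only [← hv, add_assoc, Nat.reduceAdd] at c2
  rcases c1 with ⟨h1, -, h2⟩ | ⟨r, T', h1, h2, h3, h4⟩
  · have h0 := p2 h2
    rcases c2 with ⟨h5, -⟩ | ⟨r, -, -, h5, -⟩
    · simp [onFst, h1, h5]
    · have t1 := h0 r
      have t2 := h5.1
      simp only [iota₂] at t2
      exact absurd t2 (by omega)
  · obtain ⟨r', q1, q2⟩ := p3 r T' h2 ⟨h3.rowSorted, h4⟩
    rcases c2 with ⟨-, -, h5⟩ | ⟨r'', T'', h5, h6, h7, h8⟩
    · have t1 := q1.1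
      have t2 := h5 r'
      simp only [iota₂] at t2
      exact absurd t2 (by omega)
    · obtain rfl := q1.unique h6
      have hT : T'' = T'.internalInserts (x.2.rowCoords 0) :=
        ext_of_lev h7.rowSorted q2.1 fun k hk => funext fun s => by
          rw [h8 k hk, q2.2 k hk]; rfl
      have ho : T''.outer = (iota₂ x).1.outer :=
        ((raise_eq_some_iff hy.1.finite_cells).1 h5).2.1
      have e1 : onFst (SkewFilling.raise i) x = some (T', x.2) := by simp [onFst, h1]
      have e2 : onFst (SkewFilling.raise i) (iota₂ x) = some (T'', (iota₂ x).2) := by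
        simp [onFst, h5]
      rw [e1, e2, Option.map_some]
      congr 1
      refine Prod.ext hT.symm ?_
      simp only [iota₂] at ho ⊢
      rw [← hT, ho]

theorem commutesOn_onFst_lower (hi : i ≠ 0) :
    CommutesOn (sstPairs n) (onFst (SkewFilling.lower i)) iota₂ :=
  (commutesOn_onFst_raise hi).of_inverse (bijOn_iota₂ n) (partialMapsTo_onFst_raise hi)
    (partialMapsTo_onFst_lower hi) (onFst_lower_iff_raise hi)

end Classical

/-! ### Contents under internal insertion with cycling -/

section Content

variable {n : ℕ}

/-- In a growth square opposite strips have the same number of cells up to boundary terms; these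
vanish for strips of finite size. -/
theorem IsGrowth.sum_Ico {ρ α β κ : ℤ → ℕ} (h : IsGrowth ρ α β κ) {a b : ℤ} (hab : a ≤ b) :
    ∑ r ∈ Finset.Ico a b, ((κ r : ℤ) - β r) = ∑ r ∈ Finset.Ico a b, ((α r : ℤ) - ρ r) +
      (min (α (a - 1)) (β (a - 1)) - ρ (a - 1)) - (min (α (b - 1)) (β (b - 1)) - ρ (b - 1)) := by
  induction b, hab using Int.leInduction with
  | base => simp
  | succ b hab ih =>
    have e : Finset.Ico a (b + 1) = insert b (Finset.Ico a b) := by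
      ext r
      simp only [Finset.mem_Ico, Finset.mem_insert]
      omega
    have hb : b ∉ Finset.Ico a b := by simp
    have g := h (b - 1)
    rw [sub_add_cancel] at g
    rw [e, Finset.sum_insert hb, Finset.sum_insert hb, ih, add_sub_cancel_right]
    omega

theorem SkewFilling.IsSemistandard.exists_lev_eq {T : SkewFilling n} (hT : T.IsSemistandard) :
    ∃ N : ℤ, 0 ≤ N ∧ ∀ r, (r < -N ∨ N ≤ r) → ∀ k ≤ n, T.lev k r = T.lev 0 r := by
  obtain ⟨a, b, M, h1, h2⟩ := hT.lev_bounds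
  refine ⟨max (-a) (max b 0), by omega, fun r hr k hk => ?_⟩
  rcases hr with hr | hr
  · rw [h1 k hk r (by omega), h1 0 (Nat.zero_le _) r (by omega)]
  · rw [h2 k hk r (by omega), h2 0 (Nat.zero_le _) r (by omega)]

theorem IsIota.content_eq [NeZero n] {x y : SkewFilling n × SkewFilling n} (hx : x ∈ sstPairs n)
    (h : IsIota x y) :
    y.1.content = x.1.content ∧ ∀ i, y.2.content (i - 1) = x.2.content i := by
  have hn := NeZero.pos n
  have hy := h.mem hx
  obtain ⟨N₁, hN₁, h1⟩ := hx.1.exists_lev_eq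
  obtain ⟨N₂, hN₂, h2⟩ := hy.1.exists_lev_eq
  have bx : ∀ r, (r < -(max N₁ N₂ + 1) ∨ max N₁ N₂ + 1 ≤ r) → x.1.lev 0 r = x.1.lev n r :=
    fun r hr => (h1 r (by omega) n le_rfl).symm
  have bdy : ∀ r, (r < -(max N₁ N₂ + 1) ∨ max N₁ N₂ + 1 ≤ r) → y.1.lev 0 r = y.1.lev n r :=
    fun r hr => (h2 r (by omega) n le_rfl).symm
  have bnd : ∀ k < n, ∀ r, (r < -N₁ ∨ N₁ ≤ r) →
      min (x.1.lev (k + 1) r) (y.1.lev k r) = x.1.lev k r := fun k hk r hr => by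
    have := (h.isStrip hx hk.le r).1
    rw [h1 r hr (k + 1) hk, h1 r hr k hk.le] at *
    omega
  have hab : -(max N₁ N₂ + 1) ≤ max N₁ N₂ + 1 := by omega
  have bnd1 : ∀ k < n, _ := fun k hk => bnd k hk (-(max N₁ N₂ + 1) - 1) (by omega)
  have bnd2 : ∀ k < n, _ := fun k hk => bnd k hk (max N₁ N₂ + 1 - 1) (by omega)
  refine ⟨funext fun j => ?_, fun i => ?_⟩
  · have e1 := content_eq_sum hx.1.rowSorted bx j
    have e2 := content_eq_sum hy.1.rowSorted bdy j
    have g := (h.growth j j.isLt).sum_Ico hab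
    have := bnd1 j j.isLt
    have := bnd2 j j.isLt
    omega
  · have bx2 := bx
    have by2 := bdy
    rw [lev_zero_eq hx, lev_last_eq hx] at bx2
    rw [lev_zero_eq hy, lev_last_eq hy] at by2
    have e1 := content_eq_sum hx.2.1.rowSorted bx2 i
    have e2 := content_eq_sum hy.2.1.rowSorted by2 (i - 1)
    by_cases hi : i = 0
    · subst hi
      -- The last letter of the new tableau: the strip between the two chains keeps its size.
      have key : ∀ k ≤ n, ∑ r ∈ Finset.Ico (-(max N₁ N₂ + 1)) (max N₁ N₂ + 1),
          ((y.1.lev k r : ℤ) - x.1.lev k r) = x.2.content 0 := by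
        intro k
        induction k with
        | zero =>
          intro _
          rw [e1, h.fst_zero, lev_zero_eq hx]
          rfl
        | succ k ih =>
          intro hk
          have g := (h.growth k hk).symm.sum_Ico hab
          rw [ih (by omega)] at g
          have := bnd1 k hk
          have := bnd2 k hk
          omega
      have e3 := key n le_rfl
      have hl : y.2.lev ((0 : Fin n) - 1).val = x.2.lev n := by
        have := h.snd_lt (n - 1) (by omega)
        rw [Nat.sub_add_cancel hn] at this
        rw [← this]
        congr 1
        have := val_zero_sub_one (n := n)
        omega
      rw [val_zero_sub_one, h.snd_last, hl, ← lev_last_eq hx, e3] at e2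
      exact_mod_cast e2
    · have hv := val_sub_one hi
      rw [hv, h.snd_lt _ i.isLt, h.snd_lt _ (i - 1).isLt, hv, ← e1] at e2
      exact_mod_cast e2

theorem content_iota₂_fst [NeZero n] {x : SkewFilling n × SkewFilling n} (hx : x ∈ sstPairs n) :
    (iota₂ x).1.content = x.1.content :=
  ((isIota_iota₂ hx).content_eq hx).1

theorem content_iota₂_snd [NeZero n] {x : SkewFilling n × SkewFilling n} (hx : x ∈ sstPairs n)
    (j : Fin n) : (iota₂ x).2.content j = x.2.content (j + 1) := by
  have := ((isIota_iota₂ hx).content_eq hx).2 (j + 1)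
  rwa [add_sub_cancel_right] at this

theorem content_iota₁_fst [NeZero n] {x : SkewFilling n × SkewFilling n} (hx : x ∈ sstPairs n)
    (j : Fin n) : (iota₁ x).1.content j = x.1.content (j + 1) :=
  content_iota₂_snd (swap_mem hx) j

theorem content_iota₁_snd [NeZero n] {x : SkewFilling n × SkewFilling n} (hx : x ∈ sstPairs n) :
    (iota₁ x).2.content = x.2.content :=
  content_iota₂_fst (swap_mem hx)

end Content

/-! ### The affine operators on pairs -/

section Swap

variable {n : ℕ}

theorem onSnd_swap (u : SkewFilling n → Option (SkewFilling n))
    (x : SkewFilling n × SkewFilling n) : onSnd u x.swap = (onFst u x).map Prod.swap := by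
  simp only [onSnd, onFst, Option.map_map]
  rfl

theorem bijOn_swap : Set.BijOn Prod.swap (sstPairs n) (sstPairs n) :=
  ⟨fun _ hx => swap_mem hx, Prod.swap_injective.injOn, fun x hx => ⟨x.swap, swap_mem hx, by simp⟩⟩

theorem PartialMapsTo.of_swap {u v : SkewFilling n × SkewFilling n →
      Option (SkewFilling n × SkewFilling n)} (h : PartialMapsTo (sstPairs n) u)
    (huv : ∀ x ∈ sstPairs n, v x.swap = (u x).map Prod.swap) :
    PartialMapsTo (sstPairs n) v := by
  intro x hx y hy
  obtain ⟨x, rfl⟩ := Prod.swap_surjective x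
  have hx := swap_mem hx
  rw [Prod.swap_swap] at hx
  rw [huv x hx] at hy
  obtain ⟨z, hz, rfl⟩ := Option.map_eq_some_iff.1 hy
  exact swap_mem (h x hx z hz)

theorem partialCommute_onFst_onSnd (u v : SkewFilling n → Option (SkewFilling n)) :
    PartialCommute (sstPairs n) (onFst u) (onSnd v) := by
  rintro ⟨P, Q⟩ -
  unfold onFst onSnd
  rcases hu : u P with _ | P' <;> rcases hv : v Q with _ | Q' <;> simp [hu, hv]

end Swap

section Affine

variable {n : ℕ} [NeZero n] {f g : Fin n → SkewFilling n → Option (SkewFilling n)}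

/-- The affine family of partial maps obtained from classical partial maps of the first tableau:
color `0` is the conjugate of color `1`. -/
noncomputable def affineFst (f : Fin n → SkewFilling n → Option (SkewFilling n)) (i : Fin n) :
    SkewFilling n × SkewFilling n → Option (SkewFilling n × SkewFilling n) :=
  if i = 0 then conjOnPairs iota₁ (onFst (f 1)) else onFst (f i)

/-- The affine family of partial maps obtained from classical partial maps of the second
tableau. -/
noncomputable def affineSnd (f : Fin n → SkewFilling n → Option (SkewFilling n)) (i : Fin n) :
    SkewFilling n × SkewFilling n → Option (SkewFilling n × SkewFilling n) :=
  if i = 0 then conjOnPairs iota₂ (onSnd (f 1)) else onSnd (f i)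

/-- The properties of the classical raising and lowering operators that carry over to the affine
ones. -/
structure InsertionCompatible (f : Fin n → SkewFilling n → Option (SkewFilling n)) : Prop where
  mapsTo : ∀ i ≠ 0, PartialMapsTo (sstPairs n) (onFst (f i))
  commutes : ∀ i ≠ 0, CommutesOn (sstPairs n) (onFst (f i)) iota₂

theorem insertionCompatible_raise : InsertionCompatible (SkewFilling.raise (n := n)) :=
  ⟨fun _ => partialMapsTo_onFst_raise, fun _ => commutesOn_onFst_raise⟩

theorem insertionCompatible_lower : InsertionCompatible (SkewFilling.lower (n := n)) :=
  ⟨fun _ => partialMapsTo_onFst_lower, fun _ => commutesOn_onFst_lower⟩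

theorem affineSnd_swap (f : Fin n → SkewFilling n → Option (SkewFilling n)) (i : Fin n) :
    ∀ x ∈ sstPairs n, affineSnd f i x.swap = (affineFst f i x).map Prod.swap := by
  intro x hx
  unfold affineSnd affineFst
  split_ifs
  · obtain ⟨y, hy, rfl⟩ := (bijOn_iota₁ n).surjOn hx
    have e : (iota₁ y).swap = iota₂ y.swap := by rw [iota₁, Prod.swap_swap]
    rw [conjOnPairs_apply (bijOn_iota₁ n) hy, e, conjOnPairs_apply (bijOn_iota₂ n) (swap_mem hy),
      onSnd_swap, Option.map_map, Option.map_map]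
    congr 1
  · exact onSnd_swap _ _

theorem PartialMapsTo.affineFst (hn : (1 : Fin n) ≠ 0) (hf : InsertionCompatible f) (i : Fin n) :
    PartialMapsTo (sstPairs n) (affineFst f i) := by
  unfold _root_.affineFst
  split_ifs with hi
  · exact (hf.mapsTo 1 hn).conj (bijOn_iota₁ n)
  · exact hf.mapsTo i hi

theorem CommutesOn.affineFst (hn : (1 : Fin n) ≠ 0) (hf : InsertionCompatible f) (i : Fin n) :
    CommutesOn (sstPairs n) (affineFst f i) iota₂ := by
  unfold _root_.affineFst
  split_ifs with hi
  · exact (hf.commutes 1 hn).conj (bijOn_iota₁ n) (bijOn_iota₂ n).mapsTo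
      (fun _ hb => iota_comm hb) (hf.mapsTo 1 hn)
  · exact hf.commutes i hi

theorem CommutesOn.of_swap {u v : SkewFilling n × SkewFilling n →
      Option (SkewFilling n × SkewFilling n)} (h : CommutesOn (sstPairs n) u iota₂)
    (huv : ∀ x ∈ sstPairs n, v x.swap = (u x).map Prod.swap) :
    CommutesOn (sstPairs n) v iota₁ := by
  intro x hx
  obtain ⟨x, rfl⟩ := Prod.swap_surjective x
  have hx := swap_mem hx
  rw [Prod.swap_swap] at hx
  have e : iota₁ x.swap = (iota₂ x).swap := by rw [iota₁, Prod.swap_swap]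
  rw [huv x hx, e, huv _ (iota₂_mem hx), ← h x hx, Option.map_map, Option.map_map]
  congr 1

theorem PartialCommute.affine (hn : (1 : Fin n) ≠ 0) (hf : InsertionCompatible f)
    (hg : InsertionCompatible g) (i j : Fin n) :
    PartialCommute (sstPairs n) (affineFst f i) (affineSnd g j) := by
  have mapsTo_snd : ∀ k ≠ 0, PartialMapsTo (sstPairs n) (onSnd (g k)) := fun k hk =>
    (hg.mapsTo k hk).of_swap fun x _ => onSnd_swap _ x
  have key : ∀ k ≠ 0, PartialCommute (sstPairs n) (onFst (f k)) (affineSnd g j) := by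
    intro k hk
    unfold affineSnd
    split_ifs with hj
    · exact ((partialCommute_onFst_onSnd _ _).symm.conj (bijOn_iota₂ n) (mapsTo_snd 1 hn)
        (hf.mapsTo k hk) (hf.commutes k hk)).symm
    · exact partialCommute_onFst_onSnd _ _
  have hswap := affineSnd_swap g j
  unfold affineFst
  split_ifs with hi
  · exact (key 1 hn).conj (bijOn_iota₁ n) (hf.mapsTo 1 hn)
      ((PartialMapsTo.affineFst hn hg j).of_swap hswap)
      ((CommutesOn.affineFst hn hg j).of_swap hswap)
  · exact key i hi

theorem simpleCoroot_zero (j : Fin n) : simpleCoroot 0 j = simpleCoroot 1 (j + 1) := by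
  simp [simpleCoroot, eq_neg_iff_add_eq_zero]

theorem isColor_affineFst (hn : (1 : Fin n) ≠ 0) (i : Fin n) :
    IsColor (sstPairs n) (fun x => x.1.content) (affineFst SkewFilling.raise i)
      (affineFst SkewFilling.lower i) (simpleCoroot i) := by
  unfold affineFst
  split_ifs with hi
  · subst hi
    exact (isColor_onFst hn).transport (bijOn_iota₁ n)
      (fun b hb => conjOnPairs_apply (bijOn_iota₁ n) hb)
      (fun b hb => conjOnPairs_apply (bijOn_iota₁ n) hb) (Equiv.addRight 1)
      (fun b hb j => content_iota₁_fst hb j) simpleCoroot_zero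
  · exact isColor_onFst hi

theorem isColor_affineSnd (hn : (1 : Fin n) ≠ 0) (i : Fin n) :
    IsColor (sstPairs n) (fun x => x.2.content) (affineSnd SkewFilling.raise i)
      (affineSnd SkewFilling.lower i) (simpleCoroot i) :=
  (isColor_affineFst hn i).transport bijOn_swap (affineSnd_swap _ i) (affineSnd_swap _ i) 1
    (fun _ _ _ => rfl) fun _ => rfl

theorem isAffineCrystal_of_isColor {X : Type*} {B : Set X} {C : CrystalData n X}
    (h : ∀ i, IsColor B C.content (C.raise i) (C.lower i) (simpleCoroot i)) :
    IsAffineCrystal B C :=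
  ⟨fun i => (h i).raise_mem, fun i => (h i).lower_mem, fun i => (h i).lower_iff_raise,
    fun i => (h i).string_lengths, fun i => (h i).content_lower⟩

end Affine

/-! ### The skew RSK map -/

section RSK

variable {n : ℕ}

/-- A bijective morphism of crystals is an isomorphism. -/
theorem IsCrystalMorphism.inverse {X : Type*} {B : Set X} {C : CrystalData n X} {f g : X → X}
    (h : IsCrystalMorphism B C B C f) (hg : Set.MapsTo g B B) (hfg : Set.InvOn g f B B)
    (hr : ∀ i, PartialMapsTo B (C.raise i)) (hl : ∀ i, PartialMapsTo B (C.lower i)) :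
    IsCrystalMorphism B C B C g := by
  have key : ∀ u, PartialMapsTo B u → CommutesOn B u f → CommutesOn B u g := by
    intro u hu hc b hb
    have h1 := hc (g b) (hg hb)
    rw [hfg.2 hb] at h1
    rw [← h1, Option.map_map]
    rcases hub : u (g b) with _ | c
    · rfl
    · exact congrArg some (hfg.1 (hu _ (hg hb) c hub))
  refine ⟨hg, fun i => key _ (hr i) (h.raise i), fun i => key _ (hl i) (h.lower i), fun b hb => ?_⟩
  rw [← h.content _ (hg hb), hfg.2 hb]

theorem eq_of_mem_iterate {X Y : Type*} {B : Set X} {φ : X → X} (hφ : Set.MapsTo φ B B)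
    {c : X → Y} (hc : ∀ b ∈ B, c (φ b) = c b) (m : ℕ) : ∀ b ∈ B, c (φ^[m] b) = c b := by
  induction m with
  | zero => intro b _; rfl
  | succ m ih =>
    intro b hb
    rw [Function.iterate_succ_apply, ih _ (hφ hb), hc b hb]

theorem bijOn_skewRSK (n : ℕ) [NeZero n] : Set.BijOn skewRSK (sstPairs n) (sstPairs n) :=
  ((bijOn_iota₂ n).iterate n).congr fun _ hx => (skewRSK_eq_iterate_iota₂ hx).symm

theorem CommutesOn.congr {X : Type*} {B : Set X} {u : X → Option X} {φ ψ : X → X}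
    (hu : PartialMapsTo B u) (h : CommutesOn B u φ) (hφψ : ∀ b ∈ B, ψ b = φ b) :
    CommutesOn B u ψ := by
  intro b hb
  rw [hφψ b hb, ← h b hb]
  rcases hub : u b with _ | c
  · rfl
  · exact congrArg some (hφψ c (hu b hb c hub))

theorem isCrystalMorphism_skewRSK_fst [NeZero n] (hn : (1 : Fin n) ≠ 0) :
    IsCrystalMorphism (sstPairs n) (pairCrystal₁ n) (sstPairs n) (pairCrystal₁ n) skewRSK := by
  have key : ∀ f : Fin n → SkewFilling n → Option (SkewFilling n), InsertionCompatible f →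
      ∀ i, CommutesOn (sstPairs n) (affineFst f i) skewRSK := fun f hf i =>
    ((CommutesOn.affineFst hn hf i).iterate (bijOn_iota₂ n).mapsTo n).congr
      (PartialMapsTo.affineFst hn hf i) fun _ => skewRSK_eq_iterate_iota₂
  refine ⟨(bijOn_skewRSK n).mapsTo, key _ insertionCompatible_raise,
    key _ insertionCompatible_lower, fun b hb => ?_⟩
  rw [skewRSK_eq_iterate_iota₂ hb]
  exact eq_of_mem_iterate (bijOn_iota₂ n).mapsTo (c := fun x => x.1.content)
    (fun _ => content_iota₂_fst) n b hb

theorem isCrystalMorphism_skewRSK_snd [NeZero n] (hn : (1 : Fin n) ≠ 0) :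
    IsCrystalMorphism (sstPairs n) (pairCrystal₂ n) (sstPairs n) (pairCrystal₂ n) skewRSK := by
  have key : ∀ f : Fin n → SkewFilling n → Option (SkewFilling n), InsertionCompatible f →
      ∀ i, CommutesOn (sstPairs n) (affineSnd f i) skewRSK := fun f hf i =>
    (((CommutesOn.affineFst hn hf i).of_swap (affineSnd_swap f i)).iterate
      (bijOn_iota₁ n).mapsTo n).congr
      ((PartialMapsTo.affineFst hn hf i).of_swap (affineSnd_swap f i))
      fun _ => skewRSK_eq_iterate_iota₁
  refine ⟨(bijOn_skewRSK n).mapsTo, key _ insertionCompatible_raise,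
    key _ insertionCompatible_lower, fun b hb => ?_⟩
  rw [skewRSK_eq_iterate_iota₁ hb]
  exact eq_of_mem_iterate (bijOn_iota₁ n).mapsTo (c := fun x => x.2.content)
    (fun _ => content_iota₁_snd) n b hb

end RSK

/-- For `n ≥ 2`, the internal insertions with cycling `ι₁`, `ι₂` are bijections of the set of pairs
of semi-standard tableaux of the same generalized skew shape, the Kashiwara operators (whose `0`-th
members are obtained by conjugation with `ι₁`, `ι₂`) make this set an affine bicrystal, and
the skew RSK map is an isomorphism of affine bicrystals from this set to itself. -/
theorem mainTheorem8 (n : ℕ) [NeZero n] (hn : 2 ≤ n) :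
    Set.BijOn iota₁ (sstPairs n) (sstPairs n) ∧
    Set.BijOn iota₂ (sstPairs n) (sstPairs n) ∧
    IsAffineBicrystal (sstPairs n) (pairBicrystal n) ∧
    IsBicrystalIso (sstPairs n) (pairBicrystal n) (sstPairs n) (pairBicrystal n) skewRSK := by
  have h1 : (1 : Fin n) ≠ 0 := by
    rw [ne_eq, Fin.one_eq_zero_iff]
    omega
  have crystal : ∀ ε, IsAffineCrystal (sstPairs n) (pairBicrystal n ε) := by
    rw [Fin.forall_fin_two]
    exact ⟨isAffineCrystal_of_isColor (isColor_affineFst h1),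
      isAffineCrystal_of_isColor (isColor_affineSnd h1)⟩
  refine ⟨bijOn_iota₁ n, bijOn_iota₂ n, ⟨crystal, ?_, ?_, ?_, ?_⟩, ?_⟩
  · exact PartialCommute.affine h1 insertionCompatible_raise insertionCompatible_raise
  · exact PartialCommute.affine h1 insertionCompatible_raise insertionCompatible_lower
  · exact PartialCommute.affine h1 insertionCompatible_lower insertionCompatible_raise
  · exact PartialCommute.affine h1 insertionCompatible_lower insertionCompatible_lower
  · have hb := bijOn_skewRSK n
    have hinv : Set.InvOn (Function.invFunOn skewRSK (sstPairs n)) skewRSK (sstPairs n)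
        (sstPairs n) := hb.invOn_invFunOn
    have hmor : ∀ ε, IsCrystalMorphism (sstPairs n) (pairBicrystal n ε) (sstPairs n)
        (pairBicrystal n ε) skewRSK := by
      rw [Fin.forall_fin_two]
      exact ⟨isCrystalMorphism_skewRSK_fst h1, isCrystalMorphism_skewRSK_snd h1⟩
    exact ⟨_, hinv, hmor, fun ε => (hmor ε).inverse hb.surjOn.mapsTo_invFunOn hinv
      (crystal ε).raise_mem (crystal ε).lower_mem⟩
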